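/- For $0<s<1$ let $K_s(x)=c_s\,\frac{x^\perp}{|x|^{4-2s}}$ ($x\in\mathbb R^2\setminus\{0\}$), where $x^\perp=(-x_2,x_1)$ and $c_s=\frac{(1-s)\Gamma(1-s)}{2^{2s-1}\pi\Gamma(s)}$. For an integer $k\ge 4$ and $T>0$, a strong solution on $[0,T)$ of the SQG vortex-wave system is a pair $(\theta,z)$ with $\theta\in L^\infty([0,T);H^k(\mathbb R^2))\cap C^1([0,T)\times\mathbb R^2)$ real-valued and $z\in C^1([0,T);\mathbb R^2)$, such that on $[0,T)$ $$\partial_t\theta+(v+H)\cdot\nabla\theta=0\quad (x\neq z(t)),\qquad \frac{d}{dt}z(t)=v(t,z(t)),$$ $$v=-\nabla^\perp(-\Delta)^{-s}\theta,\qquad H(t,x)=K_s(x-z(t)),$$ where $v$ is defined as a Fourier multiplier applied to $\theta(t,\cdot)$. **Proposition ($L^2$-stability).** Let $\tfrac12\le s<1$, let $k\ge4$ be an integer, and let $T>0$, $N_1,N_2\ge0$, $R_1,R_2>0$. There exist $\rho>0$, $T_0\in(0,T)$ and $C\ge 0$, depending only on $s,k,T,N_1,N_2,R_1,R_2$, with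 the following property. Let $(\theta_1,z_1)$ and $(\theta_2,z_2)$ be strong solutions on $[0,T)$ with $\|\theta_i(0,\cdot)\|_{H^k}\le N_i$ and such that, for some constants $\beta_1,\beta_2\in\mathbb R$, $\theta_i(0,\cdot)\equiv\beta_i$ on the ball $B(z_i(0),R_i)$ ($i=1,2$). If $|z_2(0)-z_1(0)|<\rho$, then for every $t\in[0,T_0]$ $$\|\theta_2(t,\cdot)-\theta_1(t,\cdot)\|_{L^2}+|z_2(t)-z_1(t)|\le C\big(\|\theta_2(0,\cdot)-\theta_1(0,\cdot)\|_{L^2}+|z_2(0)-z_1(0)|\big).$$ -/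

import Mathlib

open MeasureTheory Set
open scoped ENNReal NNReal FourierTransform SchwartzMap

noncomputable section

namespace VortexWave

/-- The Euclidean plane. -/
abbrev Plane : Type := EuclideanSpace ℝ (Fin 2)

/-- Counter-clockwise rotation by the angle `π / 2`. -/
def perp (x : Plane) : Plane := !₂[-(x 1), x 0]

/-- The constant `c_s = (1 - s) Γ(1 - s) / (2 ^ (2 s - 1) π Γ(s))`. -/
def kernelConst (s : ℝ) : ℝ :=
  (1 - s) * Real.Gamma (1 - s) / ((2 : ℝ) ^ (2 * s - 1) * Real.pi * Real.Gamma s)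

/-- The Biot-Savart kernel `K_s(x) = c_s x^⊥ / |x| ^ (4 - 2 s)`, meaningful for `x ≠ 0`. -/
def kernel (s : ℝ) (x : Plane) : Plane :=
  (kernelConst s / ‖x‖ ^ (4 - 2 * s)) • perp x

open Classical in
/-- The `L²` Fourier transform (kernel `exp (-2 π i x · ξ)`) of a real function in `L²(ℝ²)`;
it is set to `0` for functions that are not in `L²`. -/
def l2Fourier (f : Plane → ℝ) : Plane → ℂ :=
  if h : MemLp (fun x => (f x : ℂ)) 2 (volume : Measure Plane) then
    ⇑(𝓕 (h.toLp (fun x => (f x : ℂ)) : Lp (α := Plane) ℂ 2) : Lp (α := Plane) ℂ 2)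
  else 0

/-- The function `f` belongs to the Sobolev space `H^k(ℝ²)`. -/
def MemH (k : ℕ) (f : Plane → ℝ) : Prop :=
  ∃ h : MemLp (fun x => (f x : ℂ)) 2 (volume : Measure Plane),
    TemperedDistribution.MemSobolev (k : ℝ) 2
      ((h.toLp (fun x => (f x : ℂ)) : Lp (α := Plane) ℂ 2) : 𝓢'(Plane, ℂ))

open Classical in
/-- The norm `‖f‖_{H^k} = ‖(1 - Δ)^(k/2) f‖_{L²}`, computed on the Fourier side
(`2 π ξ` is the angular frequency); it is `∞` outside `L²`. -/
def normH (k : ℕ) (f : Plane → ℝ) : ℝ≥0∞ :=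
  if MemLp (fun x => (f x : ℂ)) 2 (volume : Measure Plane) then
    eLpNorm (fun ξ : Plane =>
      (((1 + (2 * Real.pi * ‖ξ‖) ^ 2) ^ ((k : ℝ) / 2) : ℝ) : ℂ) * l2Fourier f ξ) 2 volume
  else ∞

/-- The velocity `v = -∇^⊥ (-Δ)^(-s) f`, defined as a Fourier multiplier: the symbol of `∇^⊥` is
`i (2 π ξ)^⊥` and the symbol of `(-Δ)^(-s)` is `|2 π ξ| ^ (-2 s)`. For `0 < s < 1` and
`f ∈ H^k(ℝ²)`, `k ≥ 4`, the integral converges absolutely at every point `x`, and it is real. -/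
def velocity (s : ℝ) (f : Plane → ℝ) (x : Plane) : Plane :=
  WithLp.toLp 2 fun i : Fin 2 =>
    (∫ ξ : Plane,
      Complex.exp (2 * Real.pi * Complex.I * (inner ℝ x ξ : ℝ)) *
        (-(Complex.I * ((2 * Real.pi * perp ξ i * (2 * Real.pi * ‖ξ‖) ^ (-2 * s) : ℝ) : ℂ))) *
          l2Fourier f ξ).re

/-- `(θ, z)` is a strong solution on `[0, T)` of the vortex-wave system
`∂ₜθ + (v + H) · ∇θ = 0`, `z' = v(t, z)`, `v = -∇^⊥ (-Δ)^(-s) θ`, `H(t, x) = K_s(x - z(t))`,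
with `θ ∈ L^∞([0, T); H^k) ∩ C¹([0, T) × ℝ²)` and `z ∈ C¹([0, T); ℝ²)`.
The transport equation is required wherever `H` is defined, that is for `x ≠ z(t)`. -/
structure IsStrongSolution (s : ℝ) (k : ℕ) (T : ℝ) (θ : ℝ → Plane → ℝ) (z : ℝ → Plane) :
    Prop where
  contDiffOn_scalar :
    ContDiffOn ℝ 1 (fun p : ℝ × Plane => θ p.1 p.2) (Ico 0 T ×ˢ (univ : Set Plane))
  contDiffOn_vortex : ContDiffOn ℝ 1 z (Ico 0 T)
  memH : ∀ t ∈ Ico 0 T, MemH k (θ t)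
  bounded : ∃ M : ℝ≥0, ∀ t ∈ Ico 0 T, normH k (θ t) ≤ M
  transport : ∀ t ∈ Ico 0 T, ∀ x : Plane, x ≠ z t →
    HasDerivWithinAt (fun τ => θ τ x)
      (-inner ℝ (velocity s (θ t) x + kernel s (x - z t)) (gradient (θ t) x)) (Ico 0 T) t
  vortex : ∀ t ∈ Ico 0 T, HasDerivWithinAt z (velocity s (θ t) (z t)) (Ico 0 T) t

end VortexWave

end

namespace VortexWave

/-! ### The Fourier transform on `L¹` and on `L²` -/

/-! The singular part of the velocity is tangent to the circles around the vortex, so the distance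
of a particle to the vortex changes only through v(x) - v(z), which is at most a Lipschitz constant
times that distance. Hence a ball around the vortex on which θ is constant survives, with a radius
that shrinks at most exponentially (`IsStrongSolution.eq_const`). On this ball ∇θ vanishes, so the
kernel can be replaced by a smooth divergence-free one (`regKernel`), and θ solves a transport
equation with a regular field (`IsStrongSolution.evol`).

Energy estimates for this equation are done on the Fourier side, where u · ∇ is antisymmetric
(`Field.re_integral_advK_eq_zero`) and a third order weight costs only a commutator
(`Field.abs_re_integral_adv_le`). Combined with the propagation of constancy, a continuation
argument gives a time that depends only on s, T, the size of the data and the radius, up to which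
the third order norm and a ball of constancy are both under control (`exists_uniform_time`).

For two solutions, w = θ₂ - θ₁ satisfies ∂ₜw = -u₂ · ∇w - v[w] · ∇θ₁ - (K(x - z₂) - K(x - z₁)) ·
∇θ₁, with K the regularized kernel. The first term does not contribute to the L² energy. The second
contributes at most C‖w‖², because the symbol |ξ|^(1-2s) is bounded at high frequencies for s ≥ 1/2
and square integrable near zero for s < 1 (`norm_integral_adv_velHat_le`). The third is Lipschitz in
the vortex position (`abs_re_integral_sub_le`).

The vortices separate at the rate v₂(z₂) - v₂(z₁) plus v[w](z₁). A point value of v[w] is not an L²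
quantity in general, but w is constant around z₁ while the vortices are close. Writing the velocity
as a superposition of heat flows, odd symmetry removes the constant, and what is left is a kernel
away from its singularity, which is square integrable for s < 1 (`exists_norm_velocity_le`).
Gronwall's inequality for ‖w‖² + |z₂ - z₁|² concludes (`exists_stability`). -/

lemma ae_eq_of_integral_schwartz {f g : Plane → ℂ} (hf : LocallyIntegrable f)
    (hg : LocallyIntegrable g)
    (h : ∀ φ : 𝓢(Plane, ℂ), ∫ x, φ x * f x = ∫ x, φ x * g x) : f =ᵐ[volume] g := by
  refine ae_eq_of_integral_contDiff_smul_eq hf hg fun φ hφ hc => ?_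
  have hc' : HasCompactSupport (Complex.ofRealCLM ∘ φ) := hc.comp_left rfl
  have hs : ContDiff ℝ (⊤ : ℕ∞) (Complex.ofRealCLM ∘ φ) := Complex.ofRealCLM.contDiff.comp hφ
  have := h (hc'.toSchwartzMap hs)
  simpa [Complex.real_smul] using this

/-- Fubini's theorem, with the reflection x ↦ -x turning the inverse transform into the forward one.
Together with `integral_fourier_Lp_mul` it links the transform given by an integral to the one on
L², both being tested against Schwartz functions. -/
lemma integral_fourierInv_mul_fourier {g : Plane → ℂ} (hg : Integrable g) (φ : 𝓢(Plane, ℂ)) :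
    ∫ x, (𝓕 φ) x * (𝓕⁻ g) x = ∫ ξ, φ ξ * g ξ := by
  have h1 := VectorFourier.integral_fourierIntegral_smul_eq_flip (μ := (volume : Measure Plane))
    (ν := (volume : Measure Plane)) (f := g) (g := fun x => (𝓕 φ) (-x)) (L := innerₗ Plane)
    Real.continuous_fourierChar (by simpa using continuous_inner) hg
    ((𝓕 φ).integrable.comp_neg)
  have e1 : ∀ x, (𝓕⁻ g) x = VectorFourier.fourierIntegral Real.fourierChar volume
      (innerₗ Plane) g (-x) := by
    intro x; rw [Real.fourierInv_eq_fourier_neg]; rfl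
  have e2 : ∀ ξ, VectorFourier.fourierIntegral Real.fourierChar volume (innerₗ Plane).flip
      (fun x => (𝓕 φ) (-x)) ξ = φ ξ := by
    intro ξ
    have : 𝓕⁻ (𝓕 (φ : Plane → ℂ)) ξ = φ ξ := by
      rw [Continuous.fourierInv_fourier_eq φ.continuous φ.integrable]
      rw [← SchwartzMap.fourier_coe]; exact (𝓕 φ).integrable
    rw [← this, Real.fourierInv_eq_fourier_comp_neg]
    rw [flip_innerₗ]
    rfl
  simp only [smul_eq_mul, e2] at h1
  calc ∫ x, (𝓕 φ) x * (𝓕⁻ g) x = ∫ x, (𝓕 φ) (-x) * (𝓕⁻ g) (-x) :=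
        (integral_neg_eq_self (fun x => (𝓕 φ) x * (𝓕⁻ g) x) volume).symm
    _ = ∫ ξ, φ ξ * g ξ := by
        rw [show (∫ ξ, φ ξ * g ξ) = ∫ ξ, g ξ * φ ξ by simp_rw [mul_comm], ← h1]
        refine integral_congr_ae (.of_forall fun x => ?_)
        simp [e1, mul_comm]

lemma integral_fourier_Lp_mul (F : Lp (α := Plane) ℂ 2) (φ : 𝓢(Plane, ℂ)) :
    ∫ ξ, φ ξ * (𝓕 F : Lp (α := Plane) ℂ 2) ξ = ∫ x, (𝓕 φ) x * F x := by
  have h := congrArg (fun T : 𝓢'(Plane, ℂ) => T φ) (Lp.fourier_toTemperedDistribution_eq F)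
  simp only [TemperedDistribution.fourier_apply, Lp.toTemperedDistribution_apply, smul_eq_mul] at h
  exact h.symm

lemma locallyIntegrable_Lp (F : Lp (α := Plane) ℂ 2) : LocallyIntegrable F :=
  (Lp.memLp F).locallyIntegrable (by norm_num)

/-- If the inverse Fourier integral of an integrable function is square integrable, then its `L²`
Fourier transform is the function we started from. -/
lemma fourier_toLp_of_fourierInv {f g : Plane → ℂ} (hg : Integrable g) (hf : MemLp f 2)
    (hfg : f =ᵐ[volume] 𝓕⁻ g) : (𝓕 (hf.toLp f) : Lp (α := Plane) ℂ 2) =ᵐ[volume] g := by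
  refine ae_eq_of_integral_schwartz (locallyIntegrable_Lp _) hg.locallyIntegrable fun φ => ?_
  rw [integral_fourier_Lp_mul, ← integral_fourierInv_mul_fourier hg φ]
  refine integral_congr_ae ?_
  filter_upwards [hf.coeFn_toLp, hfg] with x h1 h2
  rw [h1, h2]

lemma continuous_fourierInv {g : Plane → ℂ} (hg : Integrable g) : Continuous (𝓕⁻ g) := by
  rw [Real.fourierInv_eq_fourier_comp_neg]
  exact VectorFourier.fourierIntegral_continuous Real.continuous_fourierChar
    (by simpa using continuous_inner) hg.comp_neg

/-- Fourier inversion for square integrable functions with an integrable Fourier transform. -/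
lemma ae_eq_fourierInv_fourier (F : Lp (α := Plane) ℂ 2)
    (h : Integrable (𝓕 F : Lp (α := Plane) ℂ 2)) :
    F =ᵐ[volume] 𝓕⁻ ((𝓕 F : Lp (α := Plane) ℂ 2) : Plane → ℂ) := by
  refine ae_eq_of_integral_schwartz (locallyIntegrable_Lp _)
    (continuous_fourierInv h).locallyIntegrable fun φ => ?_
  obtain ⟨ψ, rfl⟩ : ∃ ψ : 𝓢(Plane, ℂ), 𝓕 ψ = φ := ⟨𝓕⁻ φ, FourierTransform.fourier_fourierInv_eq φ⟩
  rw [integral_fourierInv_mul_fourier h, integral_fourier_Lp_mul]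

lemma ae_eq_of_fourierInv_eq {g₁ g₂ : Plane → ℂ} (h₁ : Integrable g₁) (h₂ : Integrable g₂)
    (h : 𝓕⁻ g₁ = 𝓕⁻ g₂) : g₁ =ᵐ[volume] g₂ := by
  refine ae_eq_of_integral_schwartz h₁.locallyIntegrable h₂.locallyIntegrable fun φ => ?_
  rw [← integral_fourierInv_mul_fourier h₁, ← integral_fourierInv_mul_fourier h₂, h]

lemma fourierInv_conj_neg (g : Plane → ℂ) (x : Plane) :
    (𝓕⁻ (fun ξ => (starRingEnd ℂ) (g (-ξ)))) x = (starRingEnd ℂ) ((𝓕⁻ g) x) := by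
  simp only [Real.fourierInv_eq']
  rw [← integral_conj, ← integral_neg_eq_self]
  refine integral_congr_ae (.of_forall fun ξ => ?_)
  simp [← Complex.exp_conj, Complex.conj_ofNat]

/-- The Fourier side of a real function is Hermitian. -/
lemma ae_conj_neg_of_real {f : Plane → ℝ} {g : Plane → ℂ} (hg : Integrable g)
    (h : ∀ x, (f x : ℂ) = (𝓕⁻ g) x) : ∀ᵐ ξ, g (-ξ) = (starRingEnd ℂ) (g ξ) := by
  have hg' : Integrable (fun ξ => (starRingEnd ℂ) (g (-ξ))) :=
    (Complex.conjCLE.toContinuousLinearMap.integrable_comp hg.comp_neg)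
  have := ae_eq_of_fourierInv_eq hg hg' (by
    ext x; rw [fourierInv_conj_neg, ← h]; simp)
  filter_upwards [this] with ξ hξ
  rw [hξ]; simp

open Convolution in
lemma fourierInv_convolution {g₁ g₂ : Plane → ℂ} (h₁ : Integrable g₁) (h₂ : Integrable g₂)
    (x : Plane) : (𝓕⁻ (g₁ ⋆[ContinuousLinearMap.mul ℂ ℂ] g₂)) x = (𝓕⁻ g₁) x * (𝓕⁻ g₂) x := by
  simp only [Real.fourierInv_eq_fourier_neg]
  exact Real.fourier_mul_convolution_eq h₁ h₂ (-x)

lemma norm_fourierInv_le (g : Plane → ℂ) (x : Plane) : ‖(𝓕⁻ g) x‖ ≤ ∫ ξ, ‖g ξ‖ := by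
  rw [Real.fourierInv_eq_fourier_neg]
  exact VectorFourier.norm_fourierIntegral_le_integral_norm _ _ _ _ _

lemma integrable_fourier_exp_mul {g : Plane → ℂ} (hg : Integrable g) (x : Plane) :
    Integrable fun ξ => Complex.exp (2 * Real.pi * Complex.I * (inner ℝ x ξ : ℝ)) * g ξ := by
  refine hg.bdd_mul (c := 1) ?_ (.of_forall fun ξ => ?_)
  · exact Continuous.aestronglyMeasurable (by fun_prop)
  · rw [show (2 * Real.pi * Complex.I * (inner ℝ x ξ : ℝ) : ℂ)
      = ((2 * Real.pi * inner ℝ x ξ : ℝ) : ℂ) * Complex.I by push_cast; ring]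
    rw [Complex.norm_exp_ofReal_mul_I]

lemma fourierInv_eq_integral (g : Plane → ℂ) (x : Plane) :
    (𝓕⁻ g) x = ∫ ξ, Complex.exp (2 * Real.pi * Complex.I * (inner ℝ x ξ : ℝ)) * g ξ := by
  rw [Real.fourierInv_eq']
  refine integral_congr_ae (.of_forall fun ξ => ?_)
  simp only [smul_eq_mul]
  rw [real_inner_comm]; congr 2; push_cast; ring

/-- Differentiation under the inverse Fourier integral. -/
lemma hasFDerivAt_fourierInv {g : Plane → ℂ} (hg : Integrable g)
    (hg' : Integrable fun ξ => ‖ξ‖ * ‖g ξ‖) (x : Plane) :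
    ∃ L : Plane →L[ℝ] ℂ, HasFDerivAt (𝓕⁻ g) L x ∧
      ∀ v, L v = (𝓕⁻ fun ξ => 2 * Real.pi * Complex.I * (inner ℝ ξ v : ℝ) * g ξ) x := by
  have h := Real.hasFDerivAt_fourier (f := fun ξ => g (-ξ)) hg.comp_neg
    (by simpa using hg'.comp_neg) x
  rw [← Real.fourierInv_eq_fourier_comp_neg] at h
  refine ⟨_, h, fun v => ?_⟩
  rw [Real.fourier_continuousLinearMap_apply, Real.fourierInv_eq_fourier_comp_neg]
  · refine Real.fourier_congr_ae (.of_forall fun ξ => ?_) x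
    simp [VectorFourier.fourierSMulRight_apply]
    rw [show (innerSL ℝ ξ) v = inner ℝ ξ v from rfl]
    ring
  · refine (hg'.comp_neg.const_mul (2 * Real.pi)).mono' ?_ (.of_forall fun ξ => ?_)
    · exact hg.comp_neg.aestronglyMeasurable.fourierSMulRight
    · refine (VectorFourier.norm_fourierSMulRight_le _ _ _).trans ?_
      have := norm_innerSL_le (E := Plane) ℝ
      simp only [norm_neg]
      have h3 : 0 ≤ 2 * Real.pi * (‖ξ‖ * ‖g (-ξ)‖) := by positivity
      nlinarith

/-! ### Trilinear estimates -/

section Trilinear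

variable {E₁ E₂ E₃ : Type*} [NormedAddCommGroup E₁] [NormedAddCommGroup E₂]
  [NormedAddCommGroup E₃]

lemma lintegral_enorm_mul_le {A : Plane → E₁} {g : Plane → E₂} (hA : AEStronglyMeasurable A)
    (hg : AEStronglyMeasurable g) :
    ∫⁻ x, ‖A x‖ₑ * ‖g x‖ₑ ≤ eLpNorm A 2 volume * eLpNorm g 2 volume := by
  have h := ENNReal.lintegral_mul_le_Lp_mul_Lq (volume : Measure Plane)
    (p := 2) (q := 2) (by constructor <;> norm_num) hA.enorm hg.enorm
  simpa [eLpNorm_eq_lintegral_rpow_enorm_toReal] using h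

lemma eLpNorm_comp_add_left {A : Plane → E₁} (hA : AEStronglyMeasurable A) (x : Plane) (p : ℝ≥0∞) :
    eLpNorm (fun y => A (x + y)) p volume = eLpNorm A p volume :=
  eLpNorm_comp_measurePreserving hA (measurePreserving_add_left volume x)

lemma aestronglyMeasurable_sub {f : Plane → E₁} (hf : AEStronglyMeasurable f) :
    AEStronglyMeasurable (fun p : Plane × Plane => f (p.1 - p.2)) (volume.prod volume) :=
  hf.comp_quasiMeasurePreserving (quasiMeasurePreserving_sub_of_right_invariant volume volume)

lemma aestronglyMeasurable_add {f : Plane → E₁} (hf : AEStronglyMeasurable f) :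
    AEStronglyMeasurable (fun p : Plane × Plane => f (p.1 + p.2)) (volume.prod volume) :=
  hf.comp_quasiMeasurePreserving (quasiMeasurePreserving_add volume volume)

lemma aemeasurable_trilinear {A : Plane → E₁} {f : Plane → E₂} {g : Plane → E₃}
    (hA : AEStronglyMeasurable A) (hf : AEStronglyMeasurable f) (hg : AEStronglyMeasurable g) :
    AEMeasurable (fun p : Plane × Plane => ‖A p.1‖ₑ * ‖f (p.1 - p.2)‖ₑ * ‖g p.2‖ₑ)
      (volume.prod volume) :=
  (hA.comp_fst.enorm.mul (aestronglyMeasurable_sub hf).enorm).mul hg.comp_snd.enorm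

/-- Translating x by y frees the argument of f. For each fixed x, Cauchy-Schwarz in y applies to a
translate of A against g, and f is integrated last. -/
lemma lintegral_trilinear_le {A : Plane → E₁} {f : Plane → E₂} {g : Plane → E₃}
    (hA : AEStronglyMeasurable A) (hf : AEStronglyMeasurable f) (hg : AEStronglyMeasurable g) :
    ∫⁻ p : Plane × Plane, ‖A p.1‖ₑ * ‖f (p.1 - p.2)‖ₑ * ‖g p.2‖ₑ ∂(volume.prod volume) ≤
      eLpNorm A 2 volume * eLpNorm f 1 volume * eLpNorm g 2 volume := by
  rw [lintegral_prod_symm _ (aemeasurable_trilinear hA hf hg)]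
  have h1 : ∀ y, ∫⁻ x, ‖A x‖ₑ * ‖f (x - y)‖ₑ * ‖g y‖ₑ
      = ∫⁻ x, ‖A (x + y)‖ₑ * ‖f x‖ₑ * ‖g y‖ₑ := fun y => by
    rw [← lintegral_add_right_eq_self _ y]; simp
  simp only [h1]
  rw [lintegral_lintegral_swap]
  · calc ∫⁻ x, ∫⁻ y, ‖A (x + y)‖ₑ * ‖f x‖ₑ * ‖g y‖ₑ
        = ∫⁻ x, ‖f x‖ₑ * ∫⁻ y, ‖A (x + y)‖ₑ * ‖g y‖ₑ := by
          refine lintegral_congr fun x => ?_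
          rw [← lintegral_const_mul' _ _ enorm_ne_top]
          refine lintegral_congr fun y => ?_
          ring
      _ ≤ ∫⁻ x, ‖f x‖ₑ * (eLpNorm A 2 volume * eLpNorm g 2 volume) := by
          gcongr with x
          rw [← eLpNorm_comp_add_left hA x]
          exact lintegral_enorm_mul_le (hA.comp_quasiMeasurePreserving
            (measurePreserving_add_left volume x).quasiMeasurePreserving) hg
      _ = _ := by
          rw [lintegral_mul_const'' _ hf.enorm, eLpNorm_one_eq_lintegral_enorm]; ring
  · have h2 := ((aestronglyMeasurable_add hA).enorm.mul hf.comp_fst.enorm).mul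
      (hg.comp_snd.enorm)
    exact h2.prod_swap

/-- The substitution y ↦ x - y exchanges the roles of f and g. -/
lemma lintegral_trilinear_le' {A : Plane → E₁} {f : Plane → E₂} {g : Plane → E₃}
    (hA : AEStronglyMeasurable A) (hf : AEStronglyMeasurable f) (hg : AEStronglyMeasurable g) :
    ∫⁻ p : Plane × Plane, ‖A p.1‖ₑ * ‖f (p.1 - p.2)‖ₑ * ‖g p.2‖ₑ ∂(volume.prod volume) ≤
      eLpNorm A 2 volume * eLpNorm f 2 volume * eLpNorm g 1 volume := by
  have h := lintegral_trilinear_le hA hg hf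
  rw [lintegral_prod _ (aemeasurable_trilinear hA hg hf)] at h
  rw [lintegral_prod _ (aemeasurable_trilinear hA hf hg)]
  calc _ = _ := ?_
    _ ≤ _ := h
    _ = _ := by ring
  refine lintegral_congr fun x => ?_
  rw [← lintegral_sub_left_eq_self _ x]
  refine lintegral_congr fun y => ?_
  simp only [sub_sub_cancel]
  ring

end Trilinear

/-! ### Weights -/

/-- The weight `1 + |2 π ξ|`. -/
noncomputable def br (ξ : Plane) : ℝ := 1 + 2 * Real.pi * ‖ξ‖

lemma one_le_br (ξ : Plane) : 1 ≤ br ξ := by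
  unfold br; have := Real.pi_pos; have := norm_nonneg ξ; nlinarith [mul_nonneg Real.pi_pos.le this]

lemma br_pos (ξ : Plane) : 0 < br ξ := one_pos.trans_le (one_le_br ξ)

lemma norm_le_br (ξ : Plane) : 2 * Real.pi * ‖ξ‖ ≤ br ξ := by unfold br; linarith

@[fun_prop]
lemma continuous_br : Continuous br := by unfold br; fun_prop

lemma abs_br_sub_le (ξ η : Plane) : |br ξ - br η| ≤ 2 * Real.pi * ‖ξ - η‖ := by
  unfold br
  rw [show 1 + 2 * Real.pi * ‖ξ‖ - (1 + 2 * Real.pi * ‖η‖) = 2 * Real.pi * (‖ξ‖ - ‖η‖) by ring,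
    abs_mul, abs_of_pos Real.two_pi_pos]
  exact mul_le_mul_of_nonneg_left (abs_norm_sub_norm_le ξ η) Real.two_pi_pos.le

/-- The third order Sobolev norm on the Fourier side. -/
noncomputable def sob (g : Plane → ℂ) : ℝ≥0∞ := eLpNorm (fun ξ => br ξ ^ 3 * ‖g ξ‖) 2 volume

/-- The square decays like |ξ|⁻⁴, and integrability in the plane needs only an exponent above 2. -/
lemma memLp_br_inv_sq : MemLp (fun ξ => (br ξ ^ 2)⁻¹) 2 (volume : Measure Plane) := by
  have h0 : AEStronglyMeasurable (fun ξ => (br ξ ^ 2)⁻¹) (volume : Measure Plane) :=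
    (Continuous.inv₀ (by fun_prop) fun ξ => (pow_pos (br_pos ξ) 2).ne').aestronglyMeasurable
  rw [memLp_two_iff_integrable_sq h0]
  have h : Integrable (fun x : Plane => (1 + ‖x‖) ^ (-(4 : ℝ))) volume :=
    integrable_one_add_norm (by simp; norm_num)
  refine h.mono' (h0.pow 2) (.of_forall fun ξ => ?_)
  rw [Real.norm_of_nonneg (by positivity), Real.rpow_neg (by positivity)]
  rw [← inv_pow, inv_pow, inv_pow, ← pow_mul]
  rw [show (4 : ℝ) = ((2 * 2 : ℕ) : ℝ) by norm_num, Real.rpow_natCast]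
  gcongr
  unfold br
  have := Real.pi_gt_three; have := norm_nonneg ξ
  nlinarith

/-- The `L²` norm of the weight `(1 + |2 π ξ|) ^ (-2)`. -/
noncomputable def cbr : ℝ≥0 := (eLpNorm (fun ξ => (br ξ ^ 2)⁻¹) 2 (volume : Measure Plane)).toNNReal

lemma coe_cbr : (cbr : ℝ≥0∞) = eLpNorm (fun ξ => (br ξ ^ 2)⁻¹) 2 (volume : Measure Plane) :=
  ENNReal.coe_toNNReal memLp_br_inv_sq.eLpNorm_ne_top

lemma eLpNorm_one_mul_le {f g : Plane → ℝ} (hf : AEStronglyMeasurable f)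
    (hg : AEStronglyMeasurable g) :
    eLpNorm (fun x => f x * g x) 1 volume ≤ eLpNorm f 2 volume * eLpNorm g 2 volume := by
  rw [eLpNorm_one_eq_lintegral_enorm]
  simp only [enorm_mul]
  exact lintegral_enorm_mul_le hf hg

/-- Cauchy-Schwarz after writing the weight as its power -2 times its cube. This is the Sobolev
embedding into C¹, seen on the Fourier side. -/
lemma eLpNorm_one_br_le {g : Plane → ℂ} (hg : AEStronglyMeasurable g) :
    eLpNorm (fun ξ => br ξ * ‖g ξ‖) 1 volume ≤ cbr * sob g := by
  have h : (fun ξ => br ξ * ‖g ξ‖) = fun ξ => (br ξ ^ 2)⁻¹ * (br ξ ^ 3 * ‖g ξ‖) := by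
    ext ξ; have := br_pos ξ; field_simp
  rw [h, coe_cbr]
  exact eLpNorm_one_mul_le memLp_br_inv_sq.1
    ((by fun_prop : Continuous fun ξ => br ξ ^ 3).aestronglyMeasurable.mul hg.norm)

lemma eLpNorm_le_sob {g : Plane → ℂ} {w : Plane → ℝ} (hw : ∀ ξ, |w ξ| ≤ br ξ ^ 3) :
    eLpNorm (fun ξ => w ξ * ‖g ξ‖) 2 volume ≤ sob g := by
  refine eLpNorm_mono fun ξ => ?_
  simp only [norm_mul, Real.norm_eq_abs]
  exact mul_le_mul_of_nonneg_right ((hw ξ).trans (le_abs_self _)) (abs_nonneg _)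

lemma eLpNorm_two_le_sob (g : Plane → ℂ) : eLpNorm g 2 volume ≤ sob g := by
  have h := eLpNorm_le_sob (g := g) (w := fun _ => 1) fun ξ => by
    simpa using one_le_pow₀ (one_le_br ξ)
  simpa using h

/-! ### Functions and fields given by their Fourier side -/

/-- The real function `f` is the inverse Fourier integral of `g`, and `g` has a finite third order
Sobolev norm. -/
structure Rep (f : Plane → ℝ) (g : Plane → ℂ) : Prop where
  meas : AEStronglyMeasurable g
  fin : sob g ≠ ∞
  eq : ∀ x, (f x : ℂ) = (𝓕⁻ g) x

/-- The size of a vector field on the Fourier side. -/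
noncomputable def fsize (û : Fin 2 → Plane → ℂ) : ℝ≥0∞ :=
  ∑ j, (eLpNorm (fun ζ => br ζ * ‖û j ζ‖) 1 volume +
    eLpNorm (fun ζ => ‖ζ‖ ^ 3 * ‖û j ζ‖) 2 volume)

/-- The real divergence-free vector field `u` is the inverse Fourier integral of `û`. -/
structure Field (u : Plane → Plane) (û : Fin 2 → Plane → ℂ) : Prop where
  meas : ∀ j, AEStronglyMeasurable (û j)
  fin : fsize û ≠ ∞
  eq : ∀ x j, (u x j : ℂ) = (𝓕⁻ (û j)) x
  div : ∀ᵐ ζ : Plane, ∑ j, (ζ j : ℂ) * û j ζ = 0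

lemma norm_apply_le (x : Plane) (j : Fin 2) : |x j| ≤ ‖x‖ := by
  simpa using PiLp.norm_apply_le x j

lemma inner_eq (x y : Plane) : inner ℝ x y = x 0 * y 0 + x 1 * y 1 := by
  simp [PiLp.inner_apply, Fin.sum_univ_two]; ring

namespace Rep

variable {f : Plane → ℝ} {g : Plane → ℂ}

lemma integrable_br (h : Rep f g) : Integrable fun ξ => br ξ * ‖g ξ‖ := by
  rw [← memLp_one_iff_integrable]
  exact ⟨(continuous_br.aestronglyMeasurable.mul h.meas.norm),
    (eLpNorm_one_br_le h.meas).trans_lt (ENNReal.mul_lt_top ENNReal.coe_lt_top h.fin.lt_top)⟩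

lemma integrable (h : Rep f g) : Integrable g :=
  h.integrable_br.mono' h.meas (.of_forall fun ξ =>
    le_mul_of_one_le_left (norm_nonneg _) (one_le_br ξ))

lemma memLp (h : Rep f g) : MemLp g 2 volume :=
  ⟨h.meas, (eLpNorm_two_le_sob g).trans_lt h.fin.lt_top⟩

lemma integrable_norm_mul (h : Rep f g) : Integrable fun ξ => ‖ξ‖ * ‖g ξ‖ := by
  refine h.integrable_br.mono' (continuous_norm.aestronglyMeasurable.mul h.meas.norm)
    (.of_forall fun ξ => ?_)
  rw [Real.norm_of_nonneg (by positivity)]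
  gcongr
  have := norm_le_br ξ; have := Real.pi_gt_three; have := norm_nonneg ξ
  nlinarith

end Rep

/-- The Fourier side of the `j`-th partial derivative. -/
noncomputable def ghat (g : Plane → ℂ) (j : Fin 2) (η : Plane) : ℂ :=
  2 * Real.pi * Complex.I * (η j : ℝ) * g η

lemma norm_ghat_le (g : Plane → ℂ) (j : Fin 2) (η : Plane) : ‖ghat g j η‖ ≤ br η * ‖g η‖ := by
  unfold ghat
  simp only [norm_mul, Complex.norm_I, Complex.norm_real, Real.norm_eq_abs, mul_one,
    abs_of_pos Real.pi_pos, Complex.norm_ofNat]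
  gcongr
  refine le_trans ?_ (norm_le_br η)
  have := norm_apply_le η j
  gcongr

lemma aestronglyMeasurable_ghat {g : Plane → ℂ} (hg : AEStronglyMeasurable g) (j : Fin 2) :
    AEStronglyMeasurable (ghat g j) := by
  unfold ghat
  exact (Continuous.aestronglyMeasurable (by fun_prop)).mul hg

lemma Rep.integrable_ghat {f g} (h : Rep f g) (j : Fin 2) : Integrable (ghat g j) :=
  h.integrable_br.mono' (aestronglyMeasurable_ghat h.meas j) (.of_forall (norm_ghat_le g j))

lemma eLpNorm_ghat_le (g : Plane → ℂ) (j : Fin 2) : eLpNorm (ghat g j) 2 volume ≤ sob g := by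
  refine (eLpNorm_mono (g := fun ξ => br ξ * ‖g ξ‖) fun ξ => ?_).trans
    (eLpNorm_le_sob fun ξ => ?_)
  · exact (norm_ghat_le g j ξ).trans (le_abs_self _)
  · have := one_le_br ξ
    rw [abs_of_pos (br_pos ξ)]
    exact le_self_pow₀ this (by norm_num)

lemma Rep.memLp_ghat {f g} (h : Rep f g) (j : Fin 2) : MemLp (ghat g j) 2 volume :=
  ⟨aestronglyMeasurable_ghat h.meas j, (eLpNorm_ghat_le g j).trans_lt h.fin.lt_top⟩

/-- Square integrable complex functions on the plane. -/
abbrev L2 : Type := Lp ℂ 2 (volume : Measure Plane)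

/-- Plancherel's theorem for the inverse transform given by an integral: it agrees almost everywhere
with the L² one, because g is also integrable. -/
lemma memLp_fourierInv {g : Plane → ℂ} (h1 : Integrable g) (h2 : MemLp g 2 volume) :
    MemLp (𝓕⁻ g) 2 volume ∧ eLpNorm (𝓕⁻ g) 2 volume = eLpNorm g 2 volume := by
  let F : L2 := 𝓕⁻ (h2.toLp g)
  have hF : (𝓕 F : L2) = h2.toLp g := FourierTransform.fourier_fourierInv_eq _
  have hF' : (𝓕 F : L2) =ᵐ[volume] g := by rw [hF]; exact h2.coeFn_toLp
  have h3 := ae_eq_fourierInv_fourier F (h1.congr hF'.symm)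
  have h4 : 𝓕⁻ ((𝓕 F : L2) : Plane → ℂ) = 𝓕⁻ g := by
    ext x; exact Real.fourierInv_congr_ae hF' x
  rw [h4] at h3
  refine ⟨(memLp_congr_ae h3).1 (Lp.memLp F), ?_⟩
  have h5 : ‖(𝓕 F : L2)‖ₑ = ‖F‖ₑ := by
    rw [← ofReal_norm, ← ofReal_norm, Lp.norm_fourier_eq]
  rw [Lp.enorm_def, Lp.enorm_def] at h5
  rw [← eLpNorm_congr_ae h3, ← eLpNorm_congr_ae hF', h5]

/-- The inverse Fourier integral is differentiated as a complex function. Its imaginary part is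
identically zero, so the derivative is real. -/
lemma Rep.hasFDerivAt {f g} (h : Rep f g) (x : Plane) :
    ∃ L : Plane →L[ℝ] ℝ, HasFDerivAt f L x ∧ ∀ v, ((L v : ℝ) : ℂ) =
      (𝓕⁻ fun ξ => 2 * Real.pi * Complex.I * (inner ℝ ξ v : ℝ) * g ξ) x := by
  obtain ⟨L, hL, hLv⟩ := hasFDerivAt_fourierInv h.integrable h.integrable_norm_mul x
  have hf : (fun x => (f x : ℂ)) = 𝓕⁻ g := funext h.eq
  rw [← hf] at hL
  have h2 := Complex.reCLM.hasFDerivAt.comp x hL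
  have h3 := Complex.imCLM.hasFDerivAt.comp x hL
  have h4 : (Complex.imCLM : ℂ → ℝ) ∘ (fun x => (f x : ℂ)) = fun _ => 0 := by ext; simp
  have h5 : (Complex.reCLM : ℂ → ℝ) ∘ (fun x => (f x : ℂ)) = f := by ext; simp
  rw [h4] at h3; rw [h5] at h2
  have h6 := h3.unique (hasFDerivAt_const 0 x)
  refine ⟨_, h2, fun v => ?_⟩
  rw [← hLv]
  have h7 : (L v).im = 0 := by simpa using congrArg (fun M : Plane →L[ℝ] ℝ => M v) h6
  apply Complex.ext <;> simp [h7]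

lemma Rep.differentiable {f g} (h : Rep f g) : Differentiable ℝ f := fun x =>
  let ⟨_, hL, _⟩ := h.hasFDerivAt x; hL.differentiableAt

lemma Rep.gradient_apply {f g} (h : Rep f g) (x : Plane) (j : Fin 2) :
    (gradient f x j : ℂ) = (𝓕⁻ (ghat g j)) x := by
  obtain ⟨L, hL, hLv⟩ := h.hasFDerivAt x
  have h1 : gradient f x j = L (EuclideanSpace.single j 1) := by
    have h2 := (h.differentiable x).hasGradientAt.hasFDerivAt.unique hL
    rw [← h2, InnerProductSpace.toDual_apply_apply, inner_eq]
    fin_cases j <;> simp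
  rw [h1, hLv]
  refine Real.fourierInv_congr_ae (.of_forall fun ξ => ?_) x
  simp [ghat, EuclideanSpace.inner_single_right]

/-! ### The transport term on the Fourier side -/

open Convolution in
/-- The Fourier side of `u · ∇ f`. -/
noncomputable def adv (û : Fin 2 → Plane → ℂ) (g : Plane → ℂ) (ξ : Plane) : ℂ :=
  ∑ j, (ghat g j ⋆[ContinuousLinearMap.mul ℂ ℂ] û j) ξ

namespace Field

variable {u : Plane → Plane} {û : Fin 2 → Plane → ℂ}

lemma eLpNorm_br_le (û : Fin 2 → Plane → ℂ) (j : Fin 2) :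
    eLpNorm (fun ζ => br ζ * ‖û j ζ‖) 1 volume ≤ fsize û :=
  le_self_add.trans (Finset.single_le_sum (f := fun j =>
    eLpNorm (fun ζ => br ζ * ‖û j ζ‖) 1 volume +
    eLpNorm (fun ζ => ‖ζ‖ ^ 3 * ‖û j ζ‖) 2 volume) (fun _ _ => bot_le) (Finset.mem_univ j))

lemma eLpNorm_cubic_le (û : Fin 2 → Plane → ℂ) (j : Fin 2) :
    eLpNorm (fun ζ => ‖ζ‖ ^ 3 * ‖û j ζ‖) 2 volume ≤ fsize û :=
  le_add_self.trans (Finset.single_le_sum (f := fun j =>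
    eLpNorm (fun ζ => br ζ * ‖û j ζ‖) 1 volume +
    eLpNorm (fun ζ => ‖ζ‖ ^ 3 * ‖û j ζ‖) 2 volume) (fun _ _ => bot_le) (Finset.mem_univ j))

lemma integrable_br (h : Field u û) (j : Fin 2) : Integrable fun ξ => br ξ * ‖û j ξ‖ := by
  rw [← memLp_one_iff_integrable]
  exact ⟨(continuous_br.aestronglyMeasurable.mul (h.meas j).norm),
    (eLpNorm_br_le û j).trans_lt h.fin.lt_top⟩

lemma integrable (h : Field u û) (j : Fin 2) : Integrable (û j) :=
  (h.integrable_br j).mono' (h.meas j) (.of_forall fun ξ =>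
    le_mul_of_one_le_left (norm_nonneg _) (one_le_br ξ))

lemma integral_norm_le (h : Field u û) (j : Fin 2) : ∫ ξ, br ξ * ‖û j ξ‖ ≤ (fsize û).toReal := by
  rw [integral_eq_lintegral_of_nonneg_ae (.of_forall fun ξ => ?_) (h.integrable_br j).1]
  · refine ENNReal.toReal_mono h.fin (le_trans (le_of_eq ?_) (eLpNorm_br_le û j))
    rw [eLpNorm_one_eq_lintegral_enorm]
    refine lintegral_congr fun ξ => ?_
    rw [Real.enorm_of_nonneg (mul_nonneg (br_pos ξ).le (norm_nonneg _))]
  · exact mul_nonneg (br_pos ξ).le (norm_nonneg _)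

lemma abs_apply_le (h : Field u û) (x : Plane) (j : Fin 2) : |u x j| ≤ (fsize û).toReal := by
  have h1 : |u x j| = ‖(u x j : ℂ)‖ := by simp
  rw [h1, h.eq]
  refine (norm_fourierInv_le _ _).trans (le_trans ?_ (h.integral_norm_le j))
  exact integral_mono (h.integrable j).norm (h.integrable_br j) fun ξ =>
    le_mul_of_one_le_left (norm_nonneg _) (one_le_br ξ)

lemma continuous_apply (h : Field u û) (j : Fin 2) : Continuous fun x => u x j := by
  have h1 : (fun x => u x j) = fun x => ((𝓕⁻ (û j)) x).re := by
    ext x; rw [← h.eq]; simp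
  rw [h1]
  exact Complex.continuous_re.comp (continuous_fourierInv (h.integrable j))

/-- A field with a finite size is Lipschitz continuous. -/
lemma norm_sub_le (h : Field u û) (x y : Plane) :
    ‖u x - u y‖ ≤ 2 * (fsize û).toReal * ‖x - y‖ := by
  have key : ∀ j, |u x j - u y j| ≤ (fsize û).toReal * ‖x - y‖ := by
    intro j
    have h1 : |u x j - u y j| = ‖(𝓕⁻ (û j)) x - (𝓕⁻ (û j)) y‖ := by
      rw [← h.eq, ← h.eq, ← Complex.ofReal_sub, Complex.norm_real, Real.norm_eq_abs]
    rw [h1, fourierInv_eq_integral, fourierInv_eq_integral,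
      ← integral_sub (integrable_fourier_exp_mul (h.integrable j) x)
        (integrable_fourier_exp_mul (h.integrable j) y)]
    calc _ ≤ ∫ ξ, (br ξ * ‖û j ξ‖) * ‖x - y‖ := by
          refine norm_integral_le_of_norm_le ((h.integrable_br j).mul_const _)
            (.of_forall fun ξ => ?_)
          rw [← sub_mul, norm_mul]
          have h2 : ‖Complex.exp (2 * Real.pi * Complex.I * (inner ℝ x ξ : ℝ)) -
              Complex.exp (2 * Real.pi * Complex.I * (inner ℝ y ξ : ℝ))‖ ≤ br ξ * ‖x - y‖ := by
            have e : ∀ z : Plane, (2 * Real.pi * Complex.I * (inner ℝ z ξ : ℝ) : ℂ) =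
                Complex.I * ((2 * Real.pi * inner ℝ z ξ : ℝ) : ℂ) := by
              intro z; push_cast; ring
            rw [e, e]
            have e2 : Complex.exp (Complex.I * ((2 * Real.pi * inner ℝ x ξ : ℝ) : ℂ)) -
              Complex.exp (Complex.I * ((2 * Real.pi * inner ℝ y ξ : ℝ) : ℂ)) =
              Complex.exp (Complex.I * ((2 * Real.pi * inner ℝ y ξ : ℝ) : ℂ)) *
              (Complex.exp (Complex.I * ((2 * Real.pi * inner ℝ (x - y) ξ : ℝ) : ℂ)) - 1) := by
              rw [mul_sub, mul_one, ← Complex.exp_add]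
              congr 2
              rw [inner_sub_left]; push_cast; ring
            rw [e2, norm_mul, mul_comm Complex.I, Complex.norm_exp_ofReal_mul_I, one_mul]
            refine (Real.norm_exp_I_mul_ofReal_sub_one_le).trans ?_
            rw [norm_mul, Real.norm_of_nonneg Real.two_pi_pos.le]
            have := norm_inner_le_norm (𝕜 := ℝ) (x - y) ξ
            have h5 := norm_le_br ξ
            have h6 := norm_nonneg (x - y)
            have h7 := Real.pi_pos
            nlinarith
          calc _ ≤ br ξ * ‖x - y‖ * ‖û j ξ‖ := by gcongr
            _ = _ := by ring
      _ = (∫ ξ, br ξ * ‖û j ξ‖) * ‖x - y‖ := by rw [integral_mul_const]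
      _ ≤ _ := by gcongr; exact h.integral_norm_le j
  calc ‖u x - u y‖ ≤ ∑ j, |u x j - u y j| := by
        rw [EuclideanSpace.norm_eq]
        refine Real.sqrt_le_iff.2 ⟨Finset.sum_nonneg fun _ _ => abs_nonneg _, ?_⟩
        simp only [Fin.sum_univ_two, PiLp.sub_apply, Real.norm_eq_abs]
        nlinarith [abs_nonneg (u x 0 - u y 0), abs_nonneg (u x 1 - u y 1)]
    _ ≤ ∑ _j : Fin 2, (fsize û).toReal * ‖x - y‖ := Finset.sum_le_sum fun j _ => key j
    _ = _ := by simp; ring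

end Field

lemma Field.integrable_adv {u û f g} (hu : Field u û) (hf : Rep f g) : Integrable (adv û g) := by
  unfold adv
  exact integrable_finsetSum _ fun j _ =>
    (hf.integrable_ghat j).integrable_convolution _ (hu.integrable j)

lemma Field.fourierInv_adv {u û f g} (hu : Field u û) (hf : Rep f g) (x : Plane) :
    (𝓕⁻ (adv û g)) x = ((inner ℝ (u x) (gradient f x) : ℝ) : ℂ) := by
  have h1 : (𝓕⁻ (adv û g)) x = ∑ j, (𝓕⁻ (ghat g j)) x * (𝓕⁻ (û j)) x := by
    rw [fourierInv_eq_integral]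
    simp only [adv, Finset.mul_sum]
    rw [integral_finsetSum]
    · refine Finset.sum_congr rfl fun j _ => ?_
      rw [← fourierInv_convolution (hf.integrable_ghat j) (hu.integrable j),
        fourierInv_eq_integral]
    · exact fun j _ => integrable_fourier_exp_mul
        ((hf.integrable_ghat j).integrable_convolution _ (hu.integrable j)) x
  rw [h1]
  simp only [← hf.gradient_apply, ← hu.eq]
  rw [inner_eq]
  simp [Fin.sum_univ_two, mul_comm]

/-- The transport term is square integrable. -/
lemma Field.memLp_inner_gradient {u û f g} (hu : Field u û) (hf : Rep f g) :
    MemLp (fun x => ((inner ℝ (u x) (gradient f x) : ℝ) : ℂ)) 2 volume ∧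
    eLpNorm (fun x => ((inner ℝ (u x) (gradient f x) : ℝ) : ℂ)) 2 volume
      ≤ 2 * fsize û * sob g := by
  have h1 : (fun x => ((inner ℝ (u x) (gradient f x) : ℝ) : ℂ)) =
      ∑ j, fun x => (u x j : ℂ) * (𝓕⁻ (ghat g j)) x := by
    ext x
    rw [Finset.sum_apply]
    simp only [← hf.gradient_apply]
    rw [inner_eq]
    simp [Fin.sum_univ_two]
  have h2 : ∀ j, AEStronglyMeasurable (fun x => (u x j : ℂ) * (𝓕⁻ (ghat g j)) x) :=
    fun j => ((Complex.continuous_ofReal.comp (hu.continuous_apply j)).mul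
      (continuous_fourierInv (hf.integrable_ghat j))).aestronglyMeasurable
  have h3 : ∀ j, eLpNorm (fun x => (u x j : ℂ) * (𝓕⁻ (ghat g j)) x) 2 volume
      ≤ fsize û * sob g := by
    intro j
    have h4 : ∀ x, ‖(u x j : ℂ) * (𝓕⁻ (ghat g j)) x‖ ≤
        (fsize û).toReal * ‖(𝓕⁻ (ghat g j)) x‖ := fun x => by
      rw [norm_mul]; gcongr
      simpa using hu.abs_apply_le x j
    refine (eLpNorm_le_mul_eLpNorm_of_ae_le_mul (.of_forall h4) 2).trans ?_
    rw [ENNReal.ofReal_toReal hu.fin,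
      (memLp_fourierInv (hf.integrable_ghat j) (hf.memLp_ghat j)).2]
    gcongr
    exact eLpNorm_ghat_le g j
  have h5 : eLpNorm (fun x => ((inner ℝ (u x) (gradient f x) : ℝ) : ℂ)) 2 volume
      ≤ 2 * fsize û * sob g := by
    rw [h1]
    refine (eLpNorm_sum_le (fun j _ => h2 j) (by norm_num)).trans ?_
    refine (Finset.sum_le_sum fun j _ => h3 j).trans ?_
    simp [two_mul, add_mul]
  refine ⟨⟨?_, h5.trans_lt (ENNReal.mul_lt_top (ENNReal.mul_lt_top (by simp) hu.fin.lt_top)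
    hf.fin.lt_top)⟩, h5⟩
  rw [h1]
  exact Finset.aestronglyMeasurable_sum _ fun j _ => h2 j

/-! ### Antisymmetry of the transport term and the commutator estimate -/

/-- The integrand of the Fourier side of `u · ∇ f`. -/
noncomputable def advK (û : Fin 2 → Plane → ℂ) (g : Plane → ℂ) (p : Plane × Plane) : ℂ :=
  ∑ j, ghat g j p.2 * û j (p.1 - p.2)

lemma lintegral_mul_advK_le {h : Plane → ℂ} {û : Fin 2 → Plane → ℂ} {g : Plane → ℂ}
    (hh : AEStronglyMeasurable h) (hû : ∀ j, AEStronglyMeasurable (û j))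
    (hg : ∀ j, AEStronglyMeasurable (ghat g j)) :
    ∫⁻ p, ‖(starRingEnd ℂ) (h p.1) * advK û g p‖ₑ ∂(volume.prod volume) ≤
      ∑ j, eLpNorm h 2 volume * eLpNorm (û j) 1 volume * eLpNorm (ghat g j) 2 volume := by
  calc _ ≤ ∫⁻ p : Plane × Plane, ∑ j, ‖h p.1‖ₑ * ‖û j (p.1 - p.2)‖ₑ * ‖ghat g j p.2‖ₑ
        ∂(volume.prod volume) := by
        refine lintegral_mono fun p => ?_
        rw [enorm_mul, RCLike.enorm_conj, advK]
        refine (mul_le_mul_right (enorm_sum_le _ _) _).trans (le_of_eq ?_)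
        rw [Finset.mul_sum]
        refine Finset.sum_congr rfl fun j _ => ?_
        rw [enorm_mul]; ring
    _ = ∑ j, ∫⁻ p : Plane × Plane, ‖h p.1‖ₑ * ‖û j (p.1 - p.2)‖ₑ * ‖ghat g j p.2‖ₑ
        ∂(volume.prod volume) :=
        lintegral_finsetSum' _ fun j _ => aemeasurable_trilinear hh (hû j) (hg j)
    _ ≤ _ := Finset.sum_le_sum fun j _ => lintegral_trilinear_le hh (hû j) (hg j)

lemma aestronglyMeasurable_advK {û : Fin 2 → Plane → ℂ} {g : Plane → ℂ}
    (hû : ∀ j, AEStronglyMeasurable (û j))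
    (hg : ∀ j, AEStronglyMeasurable (ghat g j)) :
    AEStronglyMeasurable (advK û g) (volume.prod volume) := by
  unfold advK
  exact Finset.aestronglyMeasurable_fun_sum _ fun j _ =>
    (hg j).comp_snd.mul (aestronglyMeasurable_sub (hû j))

lemma integrable_mul_advK {h : Plane → ℂ} {û : Fin 2 → Plane → ℂ} {g : Plane → ℂ}
    (hh : MemLp h 2 volume) (hû : ∀ j, Integrable (û j))
    (hg : ∀ j, MemLp (ghat g j) 2 volume) :
    Integrable (fun p => (starRingEnd ℂ) (h p.1) * advK û g p) (volume.prod volume) := by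
  refine ⟨?_, ?_⟩
  · exact (Complex.continuous_conj.comp_aestronglyMeasurable hh.1.comp_fst).mul
      (aestronglyMeasurable_advK (fun j => (hû j).1) fun j => (hg j).1)
  · refine (lintegral_mul_advK_le hh.1 (fun j => (hû j).1) fun j => (hg j).1).trans_lt ?_
    refine ENNReal.sum_lt_top.2 fun j _ => ?_
    exact ENNReal.mul_lt_top (ENNReal.mul_lt_top hh.2 (memLp_one_iff_integrable.2 (hû j)).2)
      (hg j).2

/-- Fubini unfolds the convolution. Antisymmetry and commutators are read off from the resulting
double integral, where both frequencies are visible. -/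
lemma integral_conj_mul_adv {h : Plane → ℂ} {û : Fin 2 → Plane → ℂ} {g : Plane → ℂ}
    (hh : MemLp h 2 volume) (hû : ∀ j, Integrable (û j))
    (hg : ∀ j, MemLp (ghat g j) 2 volume) (hg' : ∀ j, Integrable (ghat g j)) :
    ∫ ξ, (starRingEnd ℂ) (h ξ) * adv û g ξ =
      ∫ p, (starRingEnd ℂ) (h p.1) * advK û g p ∂(volume.prod volume) := by
  rw [integral_prod _ (integrable_mul_advK hh hû hg)]
  have hae : ∀ᵐ ξ : Plane, ∀ j, ConvolutionExistsAt (ghat g j) (û j) ξ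
      (ContinuousLinearMap.mul ℂ ℂ) volume := by
    rw [ae_all_iff]
    exact fun j => (hg' j).ae_convolution_exists _ (hû j)
  refine integral_congr_ae ?_
  filter_upwards [hae] with ξ hξ
  rw [integral_const_mul]
  congr 1
  have hξ' : ∀ j, Integrable (fun t => ghat g j t * û j (ξ - t)) := hξ
  simp only [advK]
  rw [integral_finsetSum _ fun j _ => hξ' j]
  rfl

lemma Field.ae_herm {u û} (hu : Field u û) :
    ∀ᵐ ζ : Plane, ∀ j, û j (-ζ) = (starRingEnd ℂ) (û j ζ) := by
  rw [ae_all_iff]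
  exact fun j => ae_conj_neg_of_real (hu.integrable j) fun x => hu.eq x j

/-- Transport by a divergence-free field is antisymmetric. -/
lemma Field.re_integral_advK_eq_zero {u û} (hu : Field u û) (G : Plane → ℂ) :
    (∫ p, (starRingEnd ℂ) (G p.1) * advK û G p ∂(volume.prod volume)).re = 0 := by
  set K : Plane × Plane → ℂ := fun p => (starRingEnd ℂ) (G p.1) * advK û G p
  have h1 : ∫ p, K p.swap ∂(volume.prod volume) = ∫ p, K p ∂(volume.prod volume) :=
    integral_prod_swap K
  -- Exchanging ξ and η turns û(ξ - η) into its conjugate by Hermitian symmetry. The relation ∑ (ξ_j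
  -- - η_j) û_j(ξ - η) = 0 then allows the factor ξ_j to be replaced by η_j, and the factor i
  -- supplies the sign.
  have h2 : ∀ᵐ p : Plane × Plane ∂(volume.prod volume),
      K p.swap = -(starRingEnd ℂ) (K p) := by
    have hq := quasiMeasurePreserving_sub_of_right_invariant (volume : Measure Plane)
      (volume : Measure Plane)
    filter_upwards [hq.ae hu.ae_herm, hq.ae hu.div] with p hp hd
    have e1 : ∀ j, û j (p.2 - p.1) = (starRingEnd ℂ) (û j (p.1 - p.2)) := fun j => by
      rw [← hp j, neg_sub]
    simp only [Fin.sum_univ_two, PiLp.sub_apply, Complex.ofReal_sub] at hd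
    have hd' := congrArg (starRingEnd ℂ) hd
    simp only [map_add, map_mul, map_sub, Complex.conj_ofReal, map_zero] at hd'
    simp only [K, advK, Prod.fst_swap, Prod.snd_swap, e1, ghat, Fin.sum_univ_two, map_mul,
      map_add, Complex.conj_conj, Complex.conj_I, Complex.conj_ofReal, Complex.conj_ofNat]
    linear_combination (2 * Real.pi * Complex.I * G p.1 * (starRingEnd ℂ) (G p.2)) * hd'
  rw [integral_congr_ae h2, integral_neg, integral_conj] at h1
  have := congrArg Complex.re h1
  simp only [Complex.neg_re, Complex.conj_re] at this
  linarith

/-- Bounded weights that are comparable with third order derivatives. -/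
structure Weight (a : Plane → ℝ) : Prop where
  cont : Continuous a
  nonneg : ∀ ξ, 0 ≤ a ξ
  le : ∀ ξ, a ξ ≤ br ξ ^ 3
  bdd : ∃ C, ∀ ξ, a ξ ≤ C
  comm : ∀ ξ η, |a ξ - a η| ≤
    12 * Real.pi * ‖ξ - η‖ * (br η ^ 2 + 4 * Real.pi ^ 2 * ‖ξ - η‖ ^ 2)

/-- The weight `min (1 + |2 π ξ|) n ^ 3`. -/
noncomputable def cutWeight (n : ℕ) (ξ : Plane) : ℝ := min (br ξ) n ^ 3

lemma weight_cutWeight (n : ℕ) : Weight (cutWeight n) := by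
  have h0 : ∀ ξ, 0 ≤ min (br ξ) (n : ℝ) := fun ξ => le_min (br_pos ξ).le n.cast_nonneg
  refine ⟨by unfold cutWeight; fun_prop, fun ξ => pow_nonneg (h0 ξ) 3, fun ξ =>
    pow_le_pow_left₀ (h0 ξ) (min_le_left _ _) 3, ⟨(n : ℝ) ^ 3, fun ξ =>
    pow_le_pow_left₀ (h0 ξ) (min_le_right _ _) 3⟩, fun ξ η => ?_⟩
  unfold cutWeight
  set x := min (br ξ) (n : ℝ) with hx
  set y := min (br η) (n : ℝ) with hy
  set d := 2 * Real.pi * ‖ξ - η‖ with hd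
  have hd0 : 0 ≤ d := by positivity
  have hxy : |x - y| ≤ d :=
    (abs_min_sub_min_le_max _ _ _ _).trans (max_le (abs_br_sub_le ξ η) (by simpa using hd0))
  have hy0 := h0 η
  have hx0 := h0 ξ
  have hyb : y ≤ br η := min_le_left _ _
  have h1 : x ^ 3 - y ^ 3 = (x - y) * (x ^ 2 + x * y + y ^ 2) := by ring
  have hxd : x ≤ y + d := by linarith [(abs_le.1 hxy).2]
  -- Truncation does not increase differences, so x ≤ y + d holds for every n and the bound is
  -- uniform in n.
  have h2 : x ^ 2 + x * y + y ^ 2 ≤ 6 * (br η ^ 2 + d ^ 2) := by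
    have : y ^ 2 ≤ br η ^ 2 := by gcongr
    nlinarith [sq_nonneg (y - d), mul_nonneg hy0 hx0, mul_nonneg hy0 hd0,
      mul_nonneg (sub_nonneg.2 hxd) hx0, mul_nonneg (sub_nonneg.2 hxd) hy0,
      mul_nonneg (sub_nonneg.2 hxd) hd0]
  rw [h1, abs_mul, abs_of_nonneg (by positivity : 0 ≤ x ^ 2 + x * y + y ^ 2)]
  calc _ ≤ d * (6 * (br η ^ 2 + d ^ 2)) := by gcongr
    _ = _ := by rw [hd]; ring

lemma weight_one : Weight fun _ => 1 :=
  ⟨continuous_const, fun _ => zero_le_one, fun ξ => one_le_pow₀ (one_le_br ξ), ⟨1, fun _ => le_rfl⟩,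
    fun ξ η => by simp only [sub_self, abs_zero]; positivity⟩

/-- The constant of the commutator estimate. -/
noncomputable def kcomm : ℝ≥0 := 2 * (6 + Real.toNNReal (48 * Real.pi ^ 3) * cbr)

lemma ghat_smul (a : Plane → ℝ) (g : Plane → ℂ) (j : Fin 2) (η : Plane) :
    ghat (fun ξ => (a ξ : ℂ) * g ξ) j η = a η * ghat g j η := by unfold ghat; ring

/-- The energy estimate for the transport term. -/
lemma Field.abs_re_integral_adv_le {u û f g a} (hu : Field u û) (hf : Rep f g) (ha : Weight a) :
    |(∫ ξ, (starRingEnd ℂ) ((a ξ : ℂ) * g ξ) * ((a ξ : ℂ) * adv û g ξ)).re| ≤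
      (kcomm * eLpNorm (fun ξ => (a ξ : ℂ) * g ξ) 2 volume * fsize û * sob g).toReal := by
  obtain ⟨C, hC⟩ := ha.bdd
  have habs : ∀ ξ, |a ξ| = a ξ := fun ξ => abs_of_nonneg (ha.nonneg ξ)
  have ham : AEStronglyMeasurable (fun ξ => (a ξ : ℂ)) (volume : Measure Plane) :=
    (Complex.continuous_ofReal.comp ha.cont).aestronglyMeasurable
  have hmul : ∀ {h : Plane → ℂ}, MemLp h 2 volume → MemLp (fun ξ => (a ξ : ℂ) * h ξ) 2 volume :=
    fun {h} hh => MemLp.of_le_mul (c := C) hh (ham.mul hh.1) (.of_forall fun ξ => by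
      rw [norm_mul, Complex.norm_real, Real.norm_eq_abs, habs]
      exact mul_le_mul_of_nonneg_right (hC ξ) (norm_nonneg _))
  set G : Plane → ℂ := fun ξ => (a ξ : ℂ) * g ξ with hG
  have hGm : MemLp G 2 volume := hmul hf.memLp
  have hGg : ∀ j, MemLp (ghat G j) 2 volume := fun j => by
    have := hmul (hf.memLp_ghat j)
    exact this.congr_norm ((hmul (hf.memLp_ghat j)).1.congr
      (.of_forall fun ξ => (ghat_smul a g j ξ).symm)) (.of_forall fun ξ => by
        rw [hG, ghat_smul])
  have hI : ∫ ξ, (starRingEnd ℂ) (G ξ) * ((a ξ : ℂ) * adv û g ξ) =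
      ∫ p, (starRingEnd ℂ) ((a p.1 : ℂ) * G p.1) * advK û g p ∂(volume.prod volume) := by
    rw [← integral_conj_mul_adv (hmul hGm) hu.integrable hf.memLp_ghat hf.integrable_ghat]
    refine integral_congr_ae (.of_forall fun ξ => ?_)
    simp only [map_mul, Complex.conj_ofReal]; ring
  have i1 := integrable_mul_advK (hmul hGm) hu.integrable hf.memLp_ghat
  have i2 := integrable_mul_advK hGm hu.integrable hGg
  -- The transport of the weighted function itself contributes nothing by antisymmetry. What is left
  -- is the commutator, whose kernel carries the factor a(ξ) - a(η).
  have h3 : ∫ p, (starRingEnd ℂ) ((a p.1 : ℂ) * G p.1) * advK û g p ∂(volume.prod volume) =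
      ∫ p, (starRingEnd ℂ) (G p.1) * advK û G p ∂(volume.prod volume) +
      ∫ p, ((starRingEnd ℂ) ((a p.1 : ℂ) * G p.1) * advK û g p -
        (starRingEnd ℂ) (G p.1) * advK û G p) ∂(volume.prod volume) := by
    rw [integral_sub i1 i2]; ring
  rw [hI, h3, Complex.add_re, hu.re_integral_advK_eq_zero, zero_add]
  refine (Complex.abs_re_le_norm _).trans ?_
  rw [← toReal_enorm]
  have hbg : AEStronglyMeasurable (fun ξ => br ξ * ‖g ξ‖) (volume : Measure Plane) :=
    continuous_br.aestronglyMeasurable.mul hf.meas.norm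
  have hbg3 : AEStronglyMeasurable (fun ξ => br ξ ^ 3 * ‖g ξ‖) (volume : Measure Plane) :=
    (continuous_br.pow 3).aestronglyMeasurable.mul hf.meas.norm
  have hbu : ∀ j, AEStronglyMeasurable (fun ζ => br ζ * ‖û j ζ‖) (volume : Measure Plane) :=
    fun j => continuous_br.aestronglyMeasurable.mul (hu.meas j).norm
  have hcu : ∀ j, AEStronglyMeasurable (fun ζ => ‖ζ‖ ^ 3 * ‖û j ζ‖) (volume : Measure Plane) :=
    fun j => (continuous_norm.pow 3).aestronglyMeasurable.mul (hu.meas j).norm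
  refine ENNReal.toReal_mono (ENNReal.mul_ne_top (ENNReal.mul_ne_top (ENNReal.mul_ne_top
    ENNReal.coe_ne_top hGm.eLpNorm_ne_top) hu.fin) hf.fin) ?_
  set k : ℝ≥0 := Real.toNNReal (48 * Real.pi ^ 3)
  have hk : (k : ℝ) = 48 * Real.pi ^ 3 := Real.coe_toNNReal _ (by positivity)
  calc _ ≤ ∫⁻ p : Plane × Plane, ∑ j, (6 * (‖G p.1‖ₑ * ‖br (p.1 - p.2) * ‖û j (p.1 - p.2)‖‖ₑ *
            ‖br p.2 ^ 3 * ‖g p.2‖‖ₑ) +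
          k * (‖G p.1‖ₑ * ‖‖p.1 - p.2‖ ^ 3 * ‖û j (p.1 - p.2)‖‖ₑ * ‖br p.2 * ‖g p.2‖‖ₑ))
          ∂(volume.prod volume) := by
        refine (enorm_integral_le_lintegral_enorm _).trans (lintegral_mono fun p => ?_)
        have e1 : (starRingEnd ℂ) ((a p.1 : ℂ) * G p.1) * advK û g p -
            (starRingEnd ℂ) (G p.1) * advK û G p = ∑ j, (starRingEnd ℂ) (G p.1) *
              ((((a p.1 - a p.2 : ℝ) : ℂ) * ghat g j p.2) * û j (p.1 - p.2)) := by
          simp only [advK, Finset.mul_sum, ← Finset.sum_sub_distrib]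
          refine Finset.sum_congr rfl fun j _ => ?_
          rw [hG, ghat_smul]
          simp only [map_mul, Complex.conj_ofReal, Complex.ofReal_sub]; ring
        rw [e1]
        refine (enorm_sum_le _ _).trans (Finset.sum_le_sum fun j _ => ?_)
        rw [enorm_mul, RCLike.enorm_conj]
        rw [show (6 : ℝ≥0∞) = ((6 : ℝ≥0) : ℝ≥0∞) by norm_num]
        simp only [enorm_eq_nnnorm]
        norm_cast
        rw [← NNReal.coe_le_coe]
        push_cast
        rw [hk]
        simp only [norm_mul, norm_pow, norm_norm, ← Complex.ofReal_sub, Complex.norm_real]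
        simp only [Real.norm_eq_abs, abs_of_pos (br_pos _)]
        have c1 := ha.comm p.1 p.2
        have c2 := norm_ghat_le g j p.2
        have c3 : 2 * Real.pi * ‖p.1 - p.2‖ ≤ br (p.1 - p.2) := norm_le_br _
        have c4 := br_pos p.2
        have c5 := Real.pi_pos
        -- The commutator bound distributes the derivatives in two ways: three on g and one on the
        -- field, or one on g and three on the field. These match the two parts of `fsize`.
        calc ‖G p.1‖ * (|a p.1 - a p.2| * ‖ghat g j p.2‖ * ‖û j (p.1 - p.2)‖)
            ≤ ‖G p.1‖ * ((12 * Real.pi * ‖p.1 - p.2‖ * (br p.2 ^ 2 +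
              4 * Real.pi ^ 2 * ‖p.1 - p.2‖ ^ 2)) * (br p.2 * ‖g p.2‖) * ‖û j (p.1 - p.2)‖) := by
              gcongr
          _ = 6 * (‖G p.1‖ * ((2 * Real.pi * ‖p.1 - p.2‖) * ‖û j (p.1 - p.2)‖) *
                (br p.2 ^ 3 * ‖g p.2‖)) + 48 * Real.pi ^ 3 * (‖G p.1‖ *
                (‖p.1 - p.2‖ ^ 3 * ‖û j (p.1 - p.2)‖) * (br p.2 * ‖g p.2‖)) := by ring
          _ ≤ _ := by gcongr
    _ = ∑ j, ((6 * ∫⁻ p : Plane × Plane, ‖G p.1‖ₑ * ‖br (p.1 - p.2) * ‖û j (p.1 - p.2)‖‖ₑ *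
            ‖br p.2 ^ 3 * ‖g p.2‖‖ₑ ∂(volume.prod volume)) +
          k * ∫⁻ p : Plane × Plane, ‖G p.1‖ₑ * ‖‖p.1 - p.2‖ ^ 3 * ‖û j (p.1 - p.2)‖‖ₑ *
            ‖br p.2 * ‖g p.2‖‖ₑ ∂(volume.prod volume)) := by
        have m1 := fun j => aemeasurable_trilinear hGm.1 (hbu j) hbg3
        have m2 := fun j => aemeasurable_trilinear hGm.1 (hcu j) hbg
        refine (lintegral_finsetSum' _ fun j _ =>
          ((m1 j).const_mul 6).add ((m2 j).const_mul _)).trans ?_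
        refine Finset.sum_congr rfl fun j _ => ?_
        refine (lintegral_add_left' ((m1 j).const_mul 6) _).trans ?_
        rw [lintegral_const_mul'' _ (m1 j), lintegral_const_mul'' _ (m2 j)]
    _ ≤ ∑ _j : Fin 2, (6 * (eLpNorm G 2 volume * fsize û * sob g) +
          k * (eLpNorm G 2 volume * fsize û * (cbr * sob g))) := by
        refine Finset.sum_le_sum fun j _ => ?_
        gcongr
        · refine (lintegral_trilinear_le hGm.1 (hbu j) hbg3).trans ?_
          gcongr
          · exact Field.eLpNorm_br_le û j
          · exact le_rfl
        · refine (lintegral_trilinear_le' hGm.1 (hcu j) hbg).trans ?_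
          gcongr
          · exact Field.eLpNorm_cubic_le û j
          · exact eLpNorm_one_br_le hf.meas
    _ = _ := by
        simp only [Fin.sum_univ_two, kcomm]
        push_cast
        ring

/-- The energy identity for the transport term. -/
lemma Field.re_integral_adv_eq_zero {u û f g} (hu : Field u û) (hf : Rep f g) :
    (∫ ξ, (starRingEnd ℂ) (g ξ) * adv û g ξ).re = 0 := by
  rw [integral_conj_mul_adv hf.memLp hu.integrable hf.memLp_ghat hf.integrable_ghat]
  exact hu.re_integral_advK_eq_zero g

/-! ### Weakly differentiable curves in a Hilbert space -/

section Hilbert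

variable {E : Type*} [NormedAddCommGroup E] [InnerProductSpace ℂ E]

/-- The bound is a closed condition on φ, so it extends to the whole space, and φ = v is then
admissible. -/
lemma norm_le_of_dense_inner_le {D : Set E} (hD : Dense D) {v : E} {C : ℝ} (hC : 0 ≤ C)
    (h : ∀ φ ∈ D, ‖inner ℂ φ v‖ ≤ C * ‖φ‖) : ‖v‖ ≤ C := by
  have h1 : ∀ φ : E, ‖inner ℂ φ v‖ ≤ C * ‖φ‖ := by
    intro φ
    have hcl : IsClosed {φ : E | ‖inner ℂ φ v‖ ≤ C * ‖φ‖} :=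
      isClosed_le (by fun_prop) (by fun_prop)
    exact hcl.closure_subset_iff.2 h (hD φ)
  have h2 := h1 v
  rw [inner_self_eq_norm_sq_to_K] at h2
  simp only [norm_pow, RCLike.norm_ofReal, abs_norm] at h2
  rcases (norm_nonneg v).eq_or_lt with hv | hv
  · rwa [← hv]
  · nlinarith

/-- A curve that is weakly differentiable against a dense set of vectors, with a bounded weak
derivative, is Lipschitz continuous. -/
lemma lipschitz_of_weak_deriv {D : Set E} (hD : Dense D) {u F : ℝ → E} {a b C : ℝ} (hab : a < b)
    (hC : 0 ≤ C)
    (hc : ∀ φ ∈ D, ContinuousOn (fun t => inner ℂ φ (u t)) (Icc a b))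
    (hd : ∀ φ ∈ D, ∀ t ∈ Ioo a b, HasDerivAt (fun t => inner ℂ φ (u t)) (inner ℂ φ (F t)) t)
    (hF : ∀ t ∈ Ioo a b, ‖F t‖ ≤ C) :
    ∀ s ∈ Icc a b, ∀ t ∈ Icc a b, ‖u t - u s‖ ≤ C * |t - s| := by
  intro s hs t ht
  refine norm_le_of_dense_inner_le hD (by positivity) fun φ hφ => ?_
  have hL : LipschitzOnWith (Real.toNNReal (C * ‖φ‖)) (fun t => inner ℂ φ (u t)) (Ioo a b) := by
    refine LipschitzOnWith.of_dist_le_mul fun x hx y hy => ?_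
    rw [dist_eq_norm, dist_eq_norm, Real.coe_toNNReal _ (by positivity)]
    refine (convex_Ioo a b).norm_image_sub_le_of_norm_hasDerivWithin_le
      (fun r hr => (hd φ hφ r hr).hasDerivWithinAt) (fun r hr => ?_) hy hx
    rw [mul_comm]
    exact (norm_inner_le_norm _ _).trans
      (mul_le_mul_of_nonneg_left (hF r hr) (norm_nonneg _))
  have hL' := LipschitzOnWith.closure (by rw [closure_Ioo hab.ne]; exact hc φ hφ) hL
  rw [closure_Ioo hab.ne] at hL'
  have := hL'.dist_le_mul t ht s hs
  rw [dist_eq_norm, dist_eq_norm, Real.coe_toNNReal _ (by positivity), ← inner_sub_right] at this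
  calc _ ≤ _ := this
    _ = _ := by rw [Real.norm_eq_abs]; ring

/-- Approximate φ by ψ in D. By the Lipschitz bound, the error in the difference quotient is at most
2C‖φ - ψ‖, independently of the time increment. -/
lemma weak_deriv_extend {D : Set E} (hD : Dense D) {u F : ℝ → E} {a b C : ℝ}
    (hC : 0 ≤ C)
    (hl : ∀ s ∈ Icc a b, ∀ t ∈ Icc a b, ‖u t - u s‖ ≤ C * |t - s|)
    (hd : ∀ φ ∈ D, ∀ t ∈ Ioo a b, HasDerivAt (fun t => inner ℂ φ (u t)) (inner ℂ φ (F t)) t)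
    (hF : ∀ t ∈ Ioo a b, ‖F t‖ ≤ C) (φ : E) {t : ℝ} (ht : t ∈ Ioo a b) :
    HasDerivAt (fun t => inner ℂ φ (u t)) (inner ℂ φ (F t)) t := by
  rw [hasDerivAt_iff_isLittleO]
  rw [Asymptotics.isLittleO_iff]
  intro ε hε
  obtain ⟨ψ, hψ, hφψ⟩ : ∃ ψ ∈ D, ‖φ - ψ‖ < ε / (4 * (C + 1)) := by
    have := Metric.dense_iff.1 hD φ (ε / (4 * (C + 1))) (by positivity)
    obtain ⟨ψ, h1, h2⟩ := this
    exact ⟨ψ, h2, by rwa [Metric.mem_ball, dist_comm, dist_eq_norm] at h1⟩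
  have h1 := (hasDerivAt_iff_isLittleO.1 (hd ψ hψ t ht))
  rw [Asymptotics.isLittleO_iff] at h1
  filter_upwards [h1 (half_pos hε), Ioo_mem_nhds ht.1 ht.2] with s hs hs'
  have e : inner ℂ φ (u s) - inner ℂ φ (u t) - (s - t) • inner ℂ φ (F t) =
      (inner ℂ ψ (u s) - inner ℂ ψ (u t) - (s - t) • inner ℂ ψ (F t)) +
      (inner ℂ (φ - ψ) (u s - u t) - (s - t) • inner ℂ (φ - ψ) (F t)) := by
    simp only [inner_sub_left, inner_sub_right, Complex.real_smul]; ring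
  rw [e]
  refine (norm_add_le _ _).trans ?_
  have h2 : ‖inner ℂ (φ - ψ) (u s - u t)‖ ≤ ‖φ - ψ‖ * (C * |s - t|) :=
    (norm_inner_le_norm _ _).trans (mul_le_mul_of_nonneg_left
      (hl t (Ioo_subset_Icc_self ht) s (Ioo_subset_Icc_self hs')) (norm_nonneg _))
  have h3 : ‖(s - t) • inner ℂ (φ - ψ) (F t)‖ ≤ |s - t| * (‖φ - ψ‖ * C) := by
    rw [norm_smul, Real.norm_eq_abs]
    gcongr
    exact (norm_inner_le_norm _ _).trans (mul_le_mul_of_nonneg_left (hF t ht) (norm_nonneg _))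
  have h4 := norm_sub_le (inner ℂ (φ - ψ) (u s - u t)) ((s - t) • inner ℂ (φ - ψ) (F t))
  have h5 : ‖φ - ψ‖ * (2 * C) ≤ ε / 2 := by
    rw [lt_div_iff₀ (by positivity)] at hφψ
    nlinarith [norm_nonneg (φ - ψ)]
  rw [Real.norm_eq_abs] at hs ⊢
  nlinarith [abs_nonneg (s - t), mul_le_mul_of_nonneg_right h5 (abs_nonneg (s - t))]

/-- The derivative of the squared norm of a weakly differentiable Lipschitz curve. -/
lemma hasDerivAt_norm_sq {u F : ℝ → E} {a b C : ℝ}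
    (hl : ∀ s ∈ Icc a b, ∀ t ∈ Icc a b, ‖u t - u s‖ ≤ C * |t - s|)
    {t : ℝ} (ht : t ∈ Ioo a b)
    (hd : ∀ φ, HasDerivAt (fun t => inner ℂ φ (u t)) (inner ℂ φ (F t)) t) :
    HasDerivAt (fun s => ‖u s‖ ^ 2) (2 * (inner ℂ (u t) (F t)).re) t := by
  -- The Lipschitz bound makes this quantity quadratic in s - t. Only the cross term of the expanded
  -- square contributes, and it is differentiable by weak differentiability tested against u t.
  have h1 : HasDerivAt (fun s => ‖u s - u t‖ ^ 2) 0 t := by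
    rw [hasDerivAt_iff_isLittleO]
    have h2 : (fun s => ‖u s - u t‖ ^ 2 - ‖u t - u t‖ ^ 2 - (s - t) • (0 : ℝ)) =O[nhds t]
        fun s => (s - t) ^ 2 := by
      refine Asymptotics.IsBigO.of_bound (C ^ 2) ?_
      filter_upwards [Ioo_mem_nhds ht.1 ht.2] with s hs
      have := hl t (Ioo_subset_Icc_self ht) s (Ioo_subset_Icc_self hs)
      have h0 : ‖u s - u t‖ ^ 2 ≤ (C * |s - t|) ^ 2 := pow_le_pow_left₀ (norm_nonneg _) this 2
      simpa [mul_pow] using h0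
    refine h2.trans_isLittleO ?_
    have h3 : (fun s : ℝ => (s - t) ^ 2) =o[nhds t] fun s => (s - t) ^ 1 := by
      have := Asymptotics.isLittleO_pow_pow (𝕜 := ℝ) (show 1 < 2 by norm_num)
      have h4 : Filter.Tendsto (fun s : ℝ => s - t) (nhds t) (nhds 0) := by
        have : Filter.Tendsto (fun s : ℝ => s - t) (nhds t) (nhds (t - t)) :=
          (continuous_id.sub continuous_const).tendsto t
        simpa using this
      exact this.comp_tendsto h4
    simpa using h3
  have h2 : HasDerivAt (fun s => (inner ℂ (u t) (u s)).re) (inner ℂ (u t) (F t)).re t :=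
    Complex.reCLM.hasFDerivAt.comp_hasDerivAt t (hd (u t))
  have h3 : (fun s => ‖u s‖ ^ 2) = fun s =>
      ‖u s - u t‖ ^ 2 + (2 * (inner ℂ (u t) (u s)).re - ‖u t‖ ^ 2) := by
    ext s
    have := norm_sub_sq (𝕜 := ℂ) (u s) (u t)
    rw [inner_re_symm] at this
    simp only [RCLike.re_to_complex] at this
    linarith
  rw [h3]
  refine (h1.add ((h2.const_mul 2).sub_const (‖u t‖ ^ 2))).congr_deriv ?_
  simp

end Hilbert
/-! ### The `L²` Fourier transform of real functions -/

lemma l2Fourier_of_memLp {f : Plane → ℝ} (h : MemLp (fun x => (f x : ℂ)) 2 (volume : Measure Plane)) :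
    l2Fourier f = ((𝓕 (h.toLp (fun x => (f x : ℂ)) : L2) : L2) : Plane → ℂ) := by
  unfold l2Fourier; rw [dif_pos h]

lemma memLp_l2Fourier {f : Plane → ℝ} (h : MemLp (fun x => (f x : ℂ)) 2 (volume : Measure Plane)) :
    MemLp (l2Fourier f) 2 volume := by
  rw [l2Fourier_of_memLp h]; exact Lp.memLp _

lemma memLp_l2Fourier_real {f : Plane → ℝ} (h : MemLp f 2 (volume : Measure Plane)) :
    MemLp (l2Fourier f) 2 volume := memLp_l2Fourier h.ofReal

lemma eLpNorm_l2Fourier {f : Plane → ℝ}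
    (h : MemLp (fun x => (f x : ℂ)) 2 (volume : Measure Plane)) :
    eLpNorm (l2Fourier f) 2 volume = eLpNorm f 2 volume := by
  have h5 : ‖(𝓕 (h.toLp (fun x => (f x : ℂ)) : L2) : L2)‖ₑ
      = ‖(h.toLp (fun x => (f x : ℂ)) : L2)‖ₑ := by
    rw [← ofReal_norm, ← ofReal_norm, Lp.norm_fourier_eq]
  rw [Lp.enorm_def, Lp.enorm_def, eLpNorm_congr_ae h.coeFn_toLp] at h5
  rw [l2Fourier_of_memLp h, h5]
  exact eLpNorm_congr_norm_ae (.of_forall fun x => by simp)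

/-- A continuous square integrable function with a finite Sobolev norm is given by its Fourier
transform at every point. -/
lemma rep_l2Fourier {f : Plane → ℝ} (hc : Continuous f)
    (h : MemLp (fun x => (f x : ℂ)) 2 (volume : Measure Plane)) (hs : sob (l2Fourier f) ≠ ∞) :
    Rep f (l2Fourier f) := by
  have hm : AEStronglyMeasurable (l2Fourier f) (volume : Measure Plane) := (memLp_l2Fourier h).1
  have hi : Integrable (l2Fourier f) := by
    have : Integrable fun ξ => br ξ * ‖l2Fourier f ξ‖ := by
      rw [← memLp_one_iff_integrable]
      exact ⟨continuous_br.aestronglyMeasurable.mul hm.norm,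
        (eLpNorm_one_br_le hm).trans_lt (ENNReal.mul_lt_top ENNReal.coe_lt_top hs.lt_top)⟩
    exact this.mono' hm (.of_forall fun ξ =>
      le_mul_of_one_le_left (norm_nonneg _) (one_le_br ξ))
  refine ⟨hm, hs, fun x => ?_⟩
  have h1 := ae_eq_fourierInv_fourier (h.toLp (fun x => (f x : ℂ)))
    (by rw [← l2Fourier_of_memLp h]; exact hi)
  rw [← l2Fourier_of_memLp h] at h1
  have h2 : (fun x => (f x : ℂ)) =ᵐ[volume] 𝓕⁻ (l2Fourier f) := h.coeFn_toLp.symm.trans h1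
  exact congrFun (Continuous.ae_eq_iff_eq volume (Complex.continuous_ofReal.comp hc)
    (continuous_fourierInv hi) |>.1 h2) x

/-- The Fourier transform of a directional derivative. -/
lemma l2Fourier_fderiv {f : Plane → ℝ} {v : Plane} (hf : Differentiable ℝ f)
    (h : MemLp f 2 volume) (h' : MemLp (fun x => fderiv ℝ f x v) 2 volume) :
    l2Fourier (fun x => fderiv ℝ f x v) =ᵐ[volume]
      fun ξ => 2 * Real.pi * Complex.I * (inner ℝ ξ v : ℝ) * l2Fourier f ξ := by
  have hL : Continuous fun ξ : Plane => (2 * Real.pi * Complex.I * (inner ℝ ξ v : ℝ) : ℂ) := by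
    fun_prop
  have hc : MemLp (fun x => (f x : ℂ)) 2 volume := h.ofReal
  have hc' : MemLp (fun x => (fderiv ℝ f x v : ℂ)) 2 volume := h'.ofReal
  have hfd : ∀ x, fderiv ℝ (fun x => (f x : ℂ)) x v = (fderiv ℝ f x v : ℂ) := fun x => by
    have := Complex.ofRealCLM.hasFDerivAt.comp x (hf x).hasFDerivAt
    rw [show (Complex.ofRealCLM : ℝ → ℂ) ∘ f = fun x => (f x : ℂ) from rfl] at this
    rw [this.fderiv]; simp
  rw [l2Fourier_of_memLp hc, l2Fourier_of_memLp hc']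
  refine ae_eq_of_integral_schwartz (locallyIntegrable_Lp _)
    ((locallyIntegrable_Lp _).continuous_mul hL) fun φ => ?_
  rw [integral_fourier_Lp_mul]
  set ψ : 𝓢(Plane, ℂ) := SchwartzMap.smulLeftCLM ℂ (fun x : Plane => inner ℝ x v) φ
  have hψ : ∀ ξ, ψ ξ = (inner ℝ ξ v : ℝ) * φ ξ := fun ξ => by
    simp only [ψ]
    rw [SchwartzMap.smulLeftCLM_apply_apply (by fun_prop)]; simp
  have h1 : ∫ ξ, φ ξ * (2 * Real.pi * Complex.I * (inner ℝ ξ v : ℝ) *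
      (𝓕 (hc.toLp (fun x => (f x : ℂ)) : L2) : L2) ξ) =
      2 * Real.pi * Complex.I * ∫ x, (𝓕 ψ) x * (hc.toLp (fun x => (f x : ℂ)) : L2) x := by
    rw [← integral_fourier_Lp_mul, ← integral_const_mul]
    refine integral_congr_ae (.of_forall fun ξ => ?_)
    simp only [hψ]; ring
  rw [h1]
  -- The frequency factor on the test function is a derivative of its transform, so the claim
  -- reduces to an integration by parts against 𝓕 φ.
  have h2 : ∀ x, fderiv ℝ (𝓕 φ : 𝓢(Plane, ℂ)) x v = -(2 * Real.pi * Complex.I) * (𝓕 ψ) x := by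
    intro x
    rw [← SchwartzMap.lineDerivOp_apply_eq_fderiv, SchwartzMap.lineDerivOp_fourier_eq]
    rw [FourierTransform.fourier_smul]
    simp [ψ]
  have hS : ∀ χ : 𝓢(Plane, ℂ), MemLp χ 2 (volume : Measure Plane) := fun χ => χ.memLp 2 volume
  have i1 : Integrable fun x => (𝓕 φ : 𝓢(Plane, ℂ)) x * (fderiv ℝ f x v : ℂ) :=
    (hS (𝓕 φ)).integrable_mul hc'
  have i2 : Integrable fun x => fderiv ℝ (𝓕 φ : 𝓢(Plane, ℂ)) x v * (f x : ℂ) := by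
    simp only [h2, mul_assoc]
    exact ((hS (𝓕 ψ)).integrable_mul hc).const_mul _
  have i3 : Integrable fun x => (𝓕 φ : 𝓢(Plane, ℂ)) x * (f x : ℂ) :=
    (hS (𝓕 φ)).integrable_mul hc
  have h3 := integral_mul_fderiv_eq_neg_fderiv_mul_of_integrable (v := v) (μ := volume)
    (f := (𝓕 φ : 𝓢(Plane, ℂ))) (g := fun x => (f x : ℂ)) i2 (by simpa only [hfd] using i1) i3
    (fun x _ => (𝓕 φ : 𝓢(Plane, ℂ)).differentiable.differentiableAt)
    (fun x _ => Complex.ofRealCLM.differentiableAt.comp x (hf x))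
  simp only [hfd, h2] at h3
  calc _ = ∫ x, (𝓕 φ : 𝓢(Plane, ℂ)) x * (fderiv ℝ f x v : ℂ) := by
        refine integral_congr_ae ?_
        filter_upwards [hc'.coeFn_toLp] with x hx
        rw [hx]
    _ = _ := h3
    _ = _ := by
        rw [← integral_const_mul, ← integral_neg]
        refine integral_congr_ae ?_
        filter_upwards [hc.coeFn_toLp] with x hx
        rw [hx]; ring

/-! ### Functions that are homogeneous at infinity -/

/-- Smooth functions outside the origin that are homogeneous of degree `d`. -/
structure Homog (d : ℝ) (f : Plane → ℝ) : Prop where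
  smooth : ContDiffOn ℝ (⊤ : ℕ∞) f {0}ᶜ
  hom : ∀ l : ℝ, 0 < l → ∀ x, x ≠ 0 → f (l • x) = l ^ d * f x

lemma Homog.bound {d f} (h : Homog d f) : ∃ C, 0 ≤ C ∧ ∀ x, x ≠ 0 → |f x| ≤ C * ‖x‖ ^ d := by
  have hc : ContinuousOn f (Metric.sphere 0 1) := h.smooth.continuousOn.mono fun x hx => by
    simp only [mem_compl_iff, mem_singleton_iff]
    rintro rfl
    simp at hx
  obtain ⟨C, hC⟩ := (isCompact_sphere (0 : Plane) 1).exists_bound_of_continuousOn hc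
  refine ⟨max C 0, le_max_right _ _, fun x hx => ?_⟩
  have hn : 0 < ‖x‖ := norm_pos_iff.2 hx
  have h1 : x = ‖x‖ • (‖x‖⁻¹ • x) := by rw [smul_smul, mul_inv_cancel₀ hn.ne', one_smul]
  have h2 : ‖x‖⁻¹ • x ∈ Metric.sphere (0 : Plane) 1 := by
    simp [norm_smul, hn.ne']
  have h3 : ‖x‖⁻¹ • x ≠ 0 := smul_ne_zero (inv_ne_zero hn.ne') hx
  rw [h1, h.hom _ hn _ h3, ← h1, abs_mul, abs_of_nonneg (Real.rpow_nonneg hn.le d), mul_comm]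
  gcongr
  exact (hC _ h2).trans (le_max_left _ _)

/-- Differentiate the scaling relation in x and divide by l. -/
lemma Homog.deriv {d f} (h : Homog d f) (v : Plane) :
    Homog (d - 1) fun x => fderiv ℝ f x v := by
  have hd : ∀ x, x ≠ 0 → DifferentiableAt ℝ f x := fun x hx =>
    (h.smooth.differentiableOn (by simp)).differentiableAt (isOpen_compl_singleton.mem_nhds hx)
  refine ⟨?_, fun l hl x hx => ?_⟩
  · have := ((contDiffOn_infty_iff_fderiv_of_isOpen isOpen_compl_singleton).1 h.smooth).2
    exact this.clm_apply contDiffOn_const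
  · have h1 : HasFDerivAt (fun y => f (l • y)) (l • fderiv ℝ f (l • x)) x := by
      have h2 : HasFDerivAt (fun y : Plane => l • y) (l • ContinuousLinearMap.id ℝ Plane) x :=
        (hasFDerivAt_id x).const_smul l
      have := (hd (l • x) (smul_ne_zero hl.ne' hx)).hasFDerivAt.comp x h2
      refine this.congr_fderiv ?_
      ext y; simp
    have h3 : HasFDerivAt (fun y => f (l • y)) (l ^ d • fderiv ℝ f x) x := by
      refine ((hd x hx).hasFDerivAt.const_mul (l ^ d)).congr_of_eventuallyEq ?_
      filter_upwards [isOpen_compl_singleton.mem_nhds hx] with y hy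
      exact h.hom l hl y hy
    have h4 := congrArg (fun L : Plane →L[ℝ] ℝ => L v) (h1.unique h3)
    simp only [smul_apply, smul_eq_mul] at h4
    rw [Real.rpow_sub_one hl.ne', div_mul_eq_mul_div, ← h4]
    field_simp

/-- Smooth functions that agree with a homogeneous function outside a ball. -/
structure Tail (d : ℝ) (f : Plane → ℝ) : Prop where
  smooth : ContDiff ℝ (⊤ : ℕ∞) f
  tail : ∃ h r, 0 < r ∧ Homog d h ∧ ∀ x, r < ‖x‖ → f x = h x

lemma Tail.deriv {d f} (h : Tail d f) (v : Plane) : Tail (d - 1) fun x => fderiv ℝ f x v := by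
  obtain ⟨k, r, hr, hk, hfk⟩ := h.tail
  refine ⟨(contDiff_infty_iff_fderiv.1 h.smooth).2.clm_apply contDiff_const, _, r, hr,
    hk.deriv v, fun x hx => ?_⟩
  have : f =ᶠ[nhds x] k := by
    filter_upwards [(isOpen_lt continuous_const continuous_norm).mem_nhds hx] with y hy
    exact hfk y hy
  rw [this.fderiv_eq]

/-- The condition d < -1 is square integrability of |x|^d at infinity in the plane. On a large ball
the function is bounded by continuity. -/
lemma Tail.memLp {d f} (h : Tail d f) (hd : d < -1) : MemLp f 2 volume := by
  obtain ⟨k, r, hr, hk, hfk⟩ := h.tail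
  obtain ⟨C, hC, hkC⟩ := hk.bound
  set ρ := max r 1
  obtain ⟨M, hM⟩ := (isCompact_closedBall (0 : Plane) ρ).exists_bound_of_continuousOn
    h.smooth.continuous.continuousOn
  have hρ : 1 ≤ ρ := le_max_right _ _
  have hM0 : 0 ≤ M := (norm_nonneg _).trans (hM 0 (by simp; linarith))
  set A := M * (1 + ρ) ^ (-d) + C * (2 : ℝ) ^ (-d)
  have hb : ∀ x, |f x| ≤ A * (1 + ‖x‖) ^ d := by
    intro x
    have hx0 := norm_nonneg x
    have p1 : 0 < (1 + ‖x‖) ^ d := Real.rpow_pos_of_pos (by linarith) d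
    have p2 : 0 < (1 + ρ) ^ (-d) := Real.rpow_pos_of_pos (by linarith) _
    have p3 : (0 : ℝ) < 2 ^ (-d) := by positivity
    by_cases hx : ‖x‖ ≤ ρ
    · have h1 : |f x| ≤ M := hM x (by simpa using hx)
      have h2 : 1 ≤ (1 + ρ) ^ (-d) * (1 + ‖x‖) ^ d := by
        rw [Real.rpow_neg (by linarith), inv_mul_eq_div, one_le_div (by positivity)]
        exact Real.rpow_le_rpow_of_nonpos (by linarith) (by linarith) (by linarith)
      calc |f x| ≤ M * 1 := by linarith
        _ ≤ M * ((1 + ρ) ^ (-d) * (1 + ‖x‖) ^ d) := by gcongr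
        _ ≤ _ := by
          simp only [A]; nlinarith [mul_nonneg (mul_nonneg hC p3.le) p1.le]
    · push Not at hx
      have hx1 : 1 ≤ ‖x‖ := hρ.trans hx.le
      rw [hfk x ((le_max_left _ _).trans_lt hx)]
      have h2 : ‖x‖ ^ d ≤ 2 ^ (-d) * (1 + ‖x‖) ^ d := by
        have : ‖x‖ ^ d ≤ ((1 + ‖x‖) / 2) ^ d :=
          Real.rpow_le_rpow_of_nonpos (by linarith) (by linarith) (by linarith)
        rw [Real.div_rpow (by linarith) (by norm_num)] at this
        rwa [Real.rpow_neg (by norm_num), inv_mul_eq_div]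
      calc |k x| ≤ C * ‖x‖ ^ d := hkC x (norm_pos_iff.1 (by linarith))
        _ ≤ C * (2 ^ (-d) * (1 + ‖x‖) ^ d) := by gcongr
        _ ≤ _ := by
          simp only [A]; nlinarith [mul_nonneg (mul_nonneg hM0 p2.le) p1.le]
  have hm : AEStronglyMeasurable f (volume : Measure Plane) :=
    h.smooth.continuous.aestronglyMeasurable
  rw [memLp_two_iff_integrable_sq hm]
  have hi : Integrable (fun x : Plane => (1 + ‖x‖) ^ (-(-2 * d))) volume :=
    integrable_one_add_norm (by simp; linarith)
  refine (hi.const_mul (A ^ 2)).mono' (hm.pow 2) (.of_forall fun x => ?_)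
  rw [norm_pow, Real.norm_eq_abs, neg_mul, neg_neg, mul_comm 2 d, Real.rpow_mul (by positivity),
    Real.rpow_two, ← mul_pow]
  exact pow_le_pow_left₀ (abs_nonneg _) (hb x) 2

/-- Every derivative lowers the degree, so f and its third derivatives along the two axes are square
integrable. Their transforms together dominate the cubic weight times the transform of f. -/
lemma Tail.rep {d f} (h : Tail d f) (hd : d < -1) : Rep f (l2Fourier f) := by
  have hm := (h.memLp hd)
  have hmc : MemLp (fun x => (f x : ℂ)) 2 volume := hm.ofReal
  refine rep_l2Fourier h.smooth.continuous hmc ?_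
  have key : ∀ v : Plane, MemLp (fun ξ => (2 * Real.pi * Complex.I * (inner ℝ ξ v : ℝ)) ^ 3 *
      l2Fourier f ξ) 2 volume := by
    intro v
    have t1 := h.deriv v
    have t2 := t1.deriv v
    have t3 := t2.deriv v
    have m1 := t1.memLp (by linarith)
    have m2 := t2.memLp (by linarith)
    have m3 := t3.memLp (by linarith)
    have e1 := l2Fourier_fderiv (h.smooth.differentiable (by simp)) hm m1
    have e2 := l2Fourier_fderiv (t1.smooth.differentiable (by simp)) m1 m2
    have e3 := l2Fourier_fderiv (t2.smooth.differentiable (by simp)) m2 m3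
    refine (memLp_congr_ae ?_).1 (memLp_l2Fourier_real m3)
    filter_upwards [e1, e2, e3] with ξ h1 h2 h3
    rw [h3, h2, h1]; ring
  have k0 := key (EuclideanSpace.single 0 1)
  have k1 := key (EuclideanSpace.single 1 1)
  have kk := (((memLp_l2Fourier hmc).norm.add k0.norm).add k1.norm).const_mul (9 : ℝ)
  refine ((eLpNorm_mono fun ξ => ?_).trans_lt kk.2).ne
  have hn : ‖ξ‖ ≤ |ξ 0| + |ξ 1| := by
    rw [EuclideanSpace.norm_eq]
    refine Real.sqrt_le_iff.2 ⟨by positivity, ?_⟩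
    simp only [Fin.sum_univ_two, Real.norm_eq_abs]
    nlinarith [abs_nonneg (ξ 0), abs_nonneg (ξ 1)]
  have e : ∀ j : Fin 2, inner ℝ ξ (EuclideanSpace.single j (1 : ℝ)) = ξ j := by
    intro j; rw [inner_eq]; fin_cases j <;> simp
  change ‖br ξ ^ 3 * ‖l2Fourier f ξ‖‖ ≤ ‖(9 : ℝ) * (‖l2Fourier f ξ‖ +
    ‖(2 * Real.pi * Complex.I * (inner ℝ ξ (EuclideanSpace.single 0 (1 : ℝ)) : ℝ)) ^ 3 *
      l2Fourier f ξ‖ +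
    ‖(2 * Real.pi * Complex.I * (inner ℝ ξ (EuclideanSpace.single 1 (1 : ℝ)) : ℝ)) ^ 3 *
      l2Fourier f ξ‖)‖
  simp only [e]
  simp only [norm_mul, norm_pow, Complex.norm_I, Complex.norm_real,
    Complex.norm_ofNat, Real.norm_eq_abs, abs_norm, abs_of_pos Real.pi_pos, mul_one, Nat.abs_ofNat]
  set X := 2 * Real.pi * |ξ 0|
  set Y := 2 * Real.pi * |ξ 1|
  have hX : 0 ≤ X := by positivity
  have hY : 0 ≤ Y := by positivity
  have hG := norm_nonneg (l2Fourier f ξ)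
  have hb : br ξ ≤ 1 + X + Y := by
    unfold br
    have := mul_le_mul_of_nonneg_left hn Real.two_pi_pos.le
    simp only [X, Y]; linarith
  have hb3 : br ξ ^ 3 ≤ 9 * (1 + X ^ 3 + Y ^ 3) := by
    refine (pow_le_pow_left₀ (br_pos ξ).le hb 3).trans ?_
    nlinarith [mul_nonneg hX (sq_nonneg (X - Y)), mul_nonneg hY (sq_nonneg (X - Y)),
      mul_nonneg hX (sq_nonneg (X - 1)), mul_nonneg hY (sq_nonneg (Y - 1)), sq_nonneg (X - 1),
      sq_nonneg (Y - 1), sq_nonneg (X - Y), mul_nonneg hX (sq_nonneg (Y - 1)),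
      mul_nonneg hY (sq_nonneg (X - 1))]
  rw [abs_of_pos (br_pos ξ)]
  have hpos : 0 ≤ ‖l2Fourier f ξ‖ + X ^ 3 * ‖l2Fourier f ξ‖ + Y ^ 3 * ‖l2Fourier f ξ‖ := by
    positivity
  rw [abs_of_nonneg hpos]
  calc _ ≤ 9 * (1 + X ^ 3 + Y ^ 3) * ‖l2Fourier f ξ‖ := by gcongr
    _ = _ := by ring

/-! ### The regularized kernel -/

lemma perp_zero (x : Plane) : perp x 0 = -x 1 := by simp [perp]
lemma perp_one (x : Plane) : perp x 1 = x 0 := by simp [perp]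

lemma norm_perp (x : Plane) : ‖perp x‖ = ‖x‖ := by
  simp [EuclideanSpace.norm_eq, Fin.sum_univ_two, perp, add_comm]

lemma inner_perp_self (x : Plane) : inner ℝ (perp x) x = 0 := by
  rw [inner_eq, perp_zero, perp_one]; ring

/-- The radial profile of the regularized kernel, a smooth function of `|x| ^ 2`. -/
noncomputable def profile (s r q : ℝ) : ℝ :=
  Real.smoothTransition (2 * q / r ^ 2 - 1) * (kernelConst s * q ^ (-(2 - s)))

/-- The power is smooth only for q > 0. The cut-off vanishes for q ≤ r²/2, hence in a neighbourhood
of every q ≤ 0. -/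
lemma contDiff_profile (s : ℝ) {r : ℝ} (hr : 0 < r) : ContDiff ℝ (⊤ : ℕ∞) (profile s r) := by
  rw [contDiff_iff_contDiffAt]
  intro q
  by_cases hq : 0 < q
  · refine ContDiffAt.mul ?_ (contDiffAt_const.mul ?_)
    · exact Real.smoothTransition.contDiffAt.comp q
        (((contDiffAt_const.mul contDiffAt_id).div_const _).sub contDiffAt_const)
    · exact Real.contDiffAt_rpow_const_of_ne hq.ne'
  · have : profile s r =ᶠ[nhds q] fun _ => 0 := by
      have h2 : q < r ^ 2 / 2 := by push Not at hq; have : 0 < r ^ 2 / 2 := by positivity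
                                    linarith
      filter_upwards [Iio_mem_nhds h2] with p hp
      simp only [mem_Iio] at hp
      rw [profile, Real.smoothTransition.zero_of_nonpos, zero_mul]
      rw [sub_nonpos, div_le_one (by positivity)]; linarith
    exact contDiffAt_const.congr_of_eventuallyEq this

lemma profile_eq (s : ℝ) {r : ℝ} (hr : 0 < r) {x : Plane} (hx : r ≤ ‖x‖) :
    profile s r (‖x‖ ^ 2) = kernelConst s / ‖x‖ ^ (4 - 2 * s) := by
  have hx0 : 0 < ‖x‖ := hr.trans_le hx
  rw [profile, Real.smoothTransition.one_of_one_le, one_mul, div_eq_mul_inv]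
  · congr 1
    rw [← Real.rpow_natCast, ← Real.rpow_mul hx0.le, ← Real.rpow_neg hx0.le]
    congr 1; push_cast; ring
  · rw [le_sub_iff_add_le, le_div_iff₀ (by positivity)]
    have : r ^ 2 ≤ ‖x‖ ^ 2 := by gcongr
    linarith

/-- The regularized kernel: it is smooth, divergence-free, tangent to the circles around the origin,
and agrees with the Biot-Savart kernel outside the ball of radius `r`. -/
noncomputable def regKernel (s r : ℝ) (x : Plane) : Plane := profile s r (‖x‖ ^ 2) • perp x

lemma regKernel_eq (s : ℝ) {r : ℝ} (hr : 0 < r) {x : Plane} (hx : r ≤ ‖x‖) :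
    regKernel s r x = kernel s x := by
  rw [regKernel, kernel, profile_eq s hr hx]

lemma homog_kernel (s : ℝ) (j : Fin 2) : Homog (2 * s - 3) fun x => kernel s x j := by
  have e : (fun x => kernel s x j) =
      fun x : Plane => kernelConst s / ‖x‖ ^ (4 - 2 * s) * perp x j := by ext x; simp [kernel]
  rw [e]
  refine ⟨fun x hx => ContDiffAt.contDiffWithinAt ?_, fun l hl x hx => ?_⟩
  · have hx0 : x ≠ 0 := hx
    have hn : ‖x‖ ≠ 0 := norm_ne_zero_iff.2 hx0
    refine ContDiffAt.mul (contDiffAt_const.div ?_ ?_) ?_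
    · exact (Real.contDiffAt_rpow_const_of_ne hn).comp x (contDiffAt_norm ℝ hx0)
    · exact (Real.rpow_pos_of_pos (norm_pos_iff.2 hx0) _).ne'
    · fin_cases j
      · simp only [Fin.zero_eta, perp_zero]; fun_prop
      · simp only [Fin.mk_one, perp_one]; fun_prop
  · have h1 : perp (l • x) j = l * perp x j := by
      fin_cases j <;> simp [perp]
    have hn : 0 < ‖x‖ := norm_pos_iff.2 hx
    rw [h1, norm_smul, Real.norm_of_nonneg hl.le, Real.mul_rpow hl.le hn.le,
      show 2 * s - 3 = 1 - (4 - 2 * s) by ring, Real.rpow_sub hl 1 (4 - 2 * s), Real.rpow_one]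
    have := Real.rpow_pos_of_pos hl (4 - 2 * s)
    have := Real.rpow_pos_of_pos hn (4 - 2 * s)
    field_simp

lemma tail_regKernel (s : ℝ) {r : ℝ} (hr : 0 < r) (j : Fin 2) :
    Tail (2 * s - 3) fun x => regKernel s r x j := by
  refine ⟨?_, _, r, hr, homog_kernel s j, fun x hx => by rw [regKernel_eq s hr hx.le]⟩
  have e : (fun x => regKernel s r x j) = fun x : Plane => profile s r (‖x‖ ^ 2) * perp x j := by
    ext x; simp [regKernel]
  rw [e]
  refine ((contDiff_profile s hr).comp (contDiff_norm_sq ℝ)).mul ?_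
  fin_cases j
  · simp only [Fin.zero_eta, perp_zero]; fun_prop
  · simp only [Fin.mk_one, perp_one]; fun_prop

/-- The field is a function of |x|² times x^⊥: the gradient of the first factor is parallel to x,
hence orthogonal to x^⊥, and x^⊥ has no divergence. -/
lemma div_regKernel (s : ℝ) {r : ℝ} (hr : 0 < r) (x : Plane) :
    fderiv ℝ (fun x => regKernel s r x 0) x (EuclideanSpace.single 0 1) =
      - fderiv ℝ (fun x => regKernel s r x 1) x (EuclideanSpace.single 1 1) := by
  have hP : HasDerivAt (profile s r) (deriv (profile s r) (‖x‖ ^ 2)) (‖x‖ ^ 2) :=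
    ((contDiff_profile s hr).differentiable (by simp)).differentiableAt.hasDerivAt
  have hN : HasFDerivAt (fun x : Plane => ‖x‖ ^ 2) (2 • innerSL ℝ x) x :=
    (hasStrictFDerivAt_norm_sq x).hasFDerivAt
  have h1 := hP.comp_hasFDerivAt x hN
  have hc : ∀ j : Fin 2, HasFDerivAt (fun x : Plane => x j)
      (EuclideanSpace.proj j : Plane →L[ℝ] ℝ) x := fun j =>
    (EuclideanSpace.proj j : Plane →L[ℝ] ℝ).hasFDerivAt
  have e0 : (fun x => regKernel s r x 0) = fun x : Plane => profile s r (‖x‖ ^ 2) * -x 1 := by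
    ext x; simp [regKernel, perp_zero]
  have e1 : (fun x => regKernel s r x 1) = fun x : Plane => profile s r (‖x‖ ^ 2) * x 0 := by
    ext x; simp [regKernel, perp_one]
  have f0 : HasFDerivAt (fun x : Plane => profile s r (‖x‖ ^ 2) * -x 1) _ x := h1.mul (hc 1).neg
  have f1 : HasFDerivAt (fun x : Plane => profile s r (‖x‖ ^ 2) * x 0) _ x := h1.mul (hc 0)
  rw [e0, e1, f0.fderiv, f1.fderiv]
  have i0 : (innerSL ℝ x) (EuclideanSpace.single 0 (1 : ℝ)) = x 0 := by
    rw [show (innerSL ℝ x) (EuclideanSpace.single 0 (1 : ℝ)) = inner ℝ x _ from rfl, inner_eq]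
    simp
  have i1 : (innerSL ℝ x) (EuclideanSpace.single 1 (1 : ℝ)) = x 1 := by
    rw [show (innerSL ℝ x) (EuclideanSpace.single 1 (1 : ℝ)) = inner ℝ x _ from rfl, inner_eq]
    simp
  simp [i0, i1]
  ring

/-- The Fourier side of the regularized kernel. -/
noncomputable def regHat (s r : ℝ) (j : Fin 2) : Plane → ℂ := l2Fourier fun x => regKernel s r x j

lemma fsize_ne_top_of_sob {û : Fin 2 → Plane → ℂ} (hm : ∀ j, AEStronglyMeasurable (û j))
    (h : ∀ j, sob (û j) ≠ ∞) : fsize û ≠ ∞ := by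
  refine ENNReal.sum_ne_top.2 fun j _ => ENNReal.add_ne_top.2 ⟨?_, ?_⟩
  · exact ((eLpNorm_one_br_le (hm j)).trans_lt
      (ENNReal.mul_lt_top ENNReal.coe_lt_top (h j).lt_top)).ne
  · refine ((eLpNorm_le_sob fun ξ => ?_).trans_lt (h j).lt_top).ne
    rw [abs_of_nonneg (by positivity)]
    gcongr
    have := norm_le_br ξ; have := Real.pi_gt_three; have := norm_nonneg ξ
    nlinarith

/-- Here s < 1 makes the degree 2s - 3 smaller than -1. The vanishing divergence is transferred to
the Fourier side through the transforms of the two partial derivatives. -/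
lemma field_regKernel {s : ℝ} (hs : s < 1) {r : ℝ} (hr : 0 < r) :
    Field (regKernel s r) (regHat s r) := by
  have hd : 2 * s - 3 < -1 := by linarith
  have hrep := fun j => (tail_regKernel s hr j).rep hd
  refine ⟨fun j => (hrep j).meas, fsize_ne_top_of_sob (fun j => (hrep j).meas)
    fun j => (hrep j).fin, fun x j => (hrep j).eq x, ?_⟩
  have key : ∀ j : Fin 2, l2Fourier (fun x => fderiv ℝ (fun x => regKernel s r x j) x
      (EuclideanSpace.single j 1)) =ᵐ[volume]
      fun ξ => 2 * Real.pi * Complex.I * (ξ j : ℝ) * regHat s r j ξ := fun j => by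
    have t := tail_regKernel s hr j
    refine (l2Fourier_fderiv (v := EuclideanSpace.single j 1) (t.smooth.differentiable (by simp))
      (t.memLp hd) ((t.deriv _).memLp (by linarith))).trans (.of_forall fun ξ => ?_)
    simp only [regHat]
    congr 3
    rw [inner_eq]; fin_cases j <;> simp
  have m : ∀ j : Fin 2, MemLp (fun x => ((fderiv ℝ (fun x => regKernel s r x j) x
      (EuclideanSpace.single j 1) : ℝ) : ℂ)) 2 volume := fun j =>
    (((tail_regKernel s hr j).deriv _).memLp (by linarith)).ofReal
  have h0 : l2Fourier (fun x => fderiv ℝ (fun x => regKernel s r x 0) x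
      (EuclideanSpace.single 0 1)) =ᵐ[volume]
      fun ξ => - l2Fourier (fun x => fderiv ℝ (fun x => regKernel s r x 1) x
      (EuclideanSpace.single 1 1)) ξ := by
    rw [l2Fourier_of_memLp (m 0), l2Fourier_of_memLp (m 1)]
    have : (m 0).toLp = -(m 1).toLp := by
      rw [← MemLp.toLp_neg]
      refine MemLp.toLp_congr _ _ (.of_forall fun x => ?_)
      simp [div_regKernel s hr x]
    rw [this, show (𝓕 (-(m 1).toLp : L2) : L2) = -𝓕 ((m 1).toLp : L2) from
      (Lp.fourierTransformₗᵢ Plane ℂ).map_neg _]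
    exact Lp.coeFn_neg _
  filter_upwards [key 0, key 1, h0] with ξ h1 h2 h3
  rw [h1, h2] at h3
  have hne : (2 * Real.pi * Complex.I : ℂ) ≠ 0 := by
    simp [Real.pi_ne_zero]
  rw [Fin.sum_univ_two]
  apply mul_left_cancel₀ hne
  rw [mul_zero]
  linear_combination h3

/-! ### Translations and sums of fields -/

/-- The Fourier side of a translation. -/
noncomputable def shiftHat (z : Plane) (û : Fin 2 → Plane → ℂ) (j : Fin 2) (ζ : Plane) : ℂ :=
  Complex.exp (-(2 * Real.pi * Complex.I * (inner ℝ z ζ : ℝ))) * û j ζ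

lemma norm_exp_neg_inner (z ζ : Plane) :
    ‖Complex.exp (-(2 * Real.pi * Complex.I * (inner ℝ z ζ : ℝ)))‖ = 1 := by
  rw [show (-(2 * Real.pi * Complex.I * (inner ℝ z ζ : ℝ)) : ℂ)
      = ((-(2 * Real.pi * inner ℝ z ζ) : ℝ) : ℂ) * Complex.I by push_cast; ring,
    Complex.norm_exp_ofReal_mul_I]

lemma norm_shiftHat (z : Plane) (û : Fin 2 → Plane → ℂ) (j : Fin 2) (ζ : Plane) :
    ‖shiftHat z û j ζ‖ = ‖û j ζ‖ := by
  rw [shiftHat, norm_mul, norm_exp_neg_inner, one_mul]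

lemma fsize_shiftHat (z : Plane) (û : Fin 2 → Plane → ℂ) : fsize (shiftHat z û) = fsize û := by
  simp only [fsize, norm_shiftHat]

lemma aestronglyMeasurable_shiftHat {û : Fin 2 → Plane → ℂ} {j : Fin 2}
    (h : AEStronglyMeasurable (û j)) (z : Plane) : AEStronglyMeasurable (shiftHat z û j) := by
  unfold shiftHat
  exact (Continuous.aestronglyMeasurable (by fun_prop)).mul h

lemma Field.shift {u û} (h : Field u û) (z : Plane) :
    Field (fun x => u (x - z)) (shiftHat z û) := by
  refine ⟨fun j => aestronglyMeasurable_shiftHat (h.meas j) z, by rw [fsize_shiftHat]; exact h.fin,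
    fun x j => ?_, ?_⟩
  · rw [h.eq, fourierInv_eq_integral, fourierInv_eq_integral]
    refine integral_congr_ae (.of_forall fun ξ => ?_)
    simp only [shiftHat]
    rw [← mul_assoc, ← Complex.exp_add]
    congr 2
    rw [inner_sub_left]; push_cast; ring
  · filter_upwards [h.div] with ζ hζ
    simp only [shiftHat]
    calc _ = Complex.exp (-(2 * Real.pi * Complex.I * (inner ℝ z ζ : ℝ))) *
        ∑ j, (ζ j : ℂ) * û j ζ := by
          rw [Finset.mul_sum]; exact Finset.sum_congr rfl fun j _ => by ring
      _ = 0 := by rw [hζ, mul_zero]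

lemma fsize_add_le {û w : Fin 2 → Plane → ℂ} (hû : ∀ j, AEStronglyMeasurable (û j))
    (hw : ∀ j, AEStronglyMeasurable (w j)) : fsize (û + w) ≤ fsize û + fsize w := by
  unfold fsize
  rw [← Finset.sum_add_distrib]
  refine Finset.sum_le_sum fun j _ => ?_
  have h1 : eLpNorm (fun ζ => br ζ * ‖(û + w) j ζ‖) 1 volume ≤
      eLpNorm (fun ζ => br ζ * ‖û j ζ‖) 1 volume + eLpNorm (fun ζ => br ζ * ‖w j ζ‖) 1 volume := by
    refine (eLpNorm_mono (g := (fun ζ => br ζ * ‖û j ζ‖) + fun ζ => br ζ * ‖w j ζ‖)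
      fun ζ => ?_).trans (eLpNorm_add_le (continuous_br.aestronglyMeasurable.mul (hû j).norm)
        (continuous_br.aestronglyMeasurable.mul (hw j).norm) le_rfl)
    have := br_pos ζ
    simp only [Pi.add_apply, norm_mul, norm_norm, Real.norm_of_nonneg this.le]
    rw [← mul_add, norm_mul, Real.norm_of_nonneg this.le]
    gcongr
    exact (norm_add_le _ _).trans (le_abs_self _)
  have h2 : eLpNorm (fun ζ => ‖ζ‖ ^ 3 * ‖(û + w) j ζ‖) 2 volume ≤
      eLpNorm (fun ζ => ‖ζ‖ ^ 3 * ‖û j ζ‖) 2 volume +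
      eLpNorm (fun ζ => ‖ζ‖ ^ 3 * ‖w j ζ‖) 2 volume := by
    refine (eLpNorm_mono (g := (fun ζ => ‖ζ‖ ^ 3 * ‖û j ζ‖) + fun ζ => ‖ζ‖ ^ 3 * ‖w j ζ‖)
      fun ζ => ?_).trans (eLpNorm_add_le
        ((continuous_norm.pow 3).aestronglyMeasurable.mul (hû j).norm)
        ((continuous_norm.pow 3).aestronglyMeasurable.mul (hw j).norm) (by norm_num))
    simp only [Pi.add_apply, norm_mul, norm_norm, norm_pow]
    rw [← mul_add, norm_mul, norm_pow, norm_norm]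
    gcongr
    exact (norm_add_le _ _).trans (le_abs_self _)
  calc _ ≤ _ := add_le_add h1 h2
    _ = _ := by ring

lemma Field.add {u w û ŵ} (hu : Field u û) (hw : Field w ŵ) :
    Field (fun x => u x + w x) (û + ŵ) := by
  refine ⟨fun j => (hu.meas j).add (hw.meas j), ((fsize_add_le hu.meas hw.meas).trans_lt
    (ENNReal.add_lt_top.2 ⟨hu.fin.lt_top, hw.fin.lt_top⟩)).ne, fun x j => ?_, ?_⟩
  · rw [PiLp.add_apply, Complex.ofReal_add, hu.eq, hw.eq]
    simp only [fourierInv_eq_integral, Pi.add_apply, mul_add]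
    rw [integral_add (integrable_fourier_exp_mul (hu.integrable j) x)
      (integrable_fourier_exp_mul (hw.integrable j) x)]
  · filter_upwards [hu.div, hw.div] with ζ h1 h2
    simp only [Pi.add_apply, mul_add, Finset.sum_add_distrib, h1, h2, add_zero]

/-! ### The velocity field -/

lemma Rep.continuous {f g} (h : Rep f g) : Continuous f := h.differentiable.continuous

lemma Rep.memLp_ofReal {f g} (h : Rep f g) : MemLp (fun x => (f x : ℂ)) 2 volume := by
  rw [show (fun x => (f x : ℂ)) = 𝓕⁻ g from funext h.eq]
  exact (memLp_fourierInv h.integrable h.memLp).1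

lemma Rep.l2Fourier_ae_eq {f g} (h : Rep f g) : l2Fourier f =ᵐ[volume] g := by
  rw [l2Fourier_of_memLp h.memLp_ofReal]
  exact fourier_toLp_of_fourierInv h.integrable h.memLp_ofReal (.of_forall h.eq)

lemma Rep.eLpNorm_eq {f g} (h : Rep f g) : eLpNorm f 2 volume = eLpNorm g 2 volume := by
  rw [← eLpNorm_l2Fourier h.memLp_ofReal, eLpNorm_congr_ae h.l2Fourier_ae_eq]

lemma sob_add_le {g₁ g₂ : Plane → ℂ} (h₁ : AEStronglyMeasurable g₁)
    (h₂ : AEStronglyMeasurable g₂) : sob (g₁ + g₂) ≤ sob g₁ + sob g₂ := by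
  unfold sob
  refine (eLpNorm_mono (g := (fun ξ => br ξ ^ 3 * ‖g₁ ξ‖) + fun ξ => br ξ ^ 3 * ‖g₂ ξ‖)
      fun ξ => ?_).trans (eLpNorm_add_le
        ((continuous_br.pow 3).aestronglyMeasurable.mul h₁.norm)
        ((continuous_br.pow 3).aestronglyMeasurable.mul h₂.norm) (by norm_num))
  have := br_pos ξ
  simp only [Pi.add_apply, norm_mul, norm_norm, norm_pow, Real.norm_of_nonneg this.le]
  rw [← mul_add, norm_mul, norm_pow, Real.norm_of_nonneg this.le]
  gcongr
  exact (norm_add_le _ _).trans (le_abs_self _)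

lemma Rep.sub {f₁ f₂ g₁ g₂} (h₁ : Rep f₁ g₁) (h₂ : Rep f₂ g₂) :
    Rep (fun x => f₁ x - f₂ x) (fun ξ => g₁ ξ - g₂ ξ) := by
  refine ⟨h₁.meas.sub h₂.meas, ?_, fun x => ?_⟩
  · have e : (fun ξ => g₁ ξ - g₂ ξ) = g₁ + -g₂ := by ext; simp [sub_eq_add_neg]
    have e2 : sob (-g₂) = sob g₂ := by simp [sob]
    rw [e]
    refine ((sob_add_le h₁.meas h₂.meas.neg).trans_lt ?_).ne
    rw [e2]
    exact ENNReal.add_lt_top.2 ⟨h₁.fin.lt_top, h₂.fin.lt_top⟩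
  · rw [Complex.ofReal_sub, h₁.eq, h₂.eq]
    simp only [fourierInv_eq_integral, mul_sub]
    rw [integral_sub (integrable_fourier_exp_mul h₁.integrable x)
      (integrable_fourier_exp_mul h₂.integrable x)]

/-- The modulus of the symbol of the velocity operator. -/
noncomputable def symb (s : ℝ) (ξ : Plane) : ℝ :=
  2 * Real.pi * ‖ξ‖ * (2 * Real.pi * ‖ξ‖) ^ (-2 * s)

lemma symb_nonneg (s : ℝ) (ξ : Plane) : 0 ≤ symb s ξ := by unfold symb; positivity

/-- The low frequency part of the symbol. -/
noncomputable def lowSymb (s : ℝ) : Plane → ℝ := (Metric.ball 0 1).indicator (symb s)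

lemma measurable_symb (s : ℝ) : Measurable (symb s) := by unfold symb; fun_prop

lemma symb_eq {s : ℝ} {ξ : Plane} (hξ : ξ ≠ 0) :
    symb s ξ = (2 * Real.pi * ‖ξ‖) ^ (1 - 2 * s) := by
  have h : 0 < 2 * Real.pi * ‖ξ‖ := mul_pos Real.two_pi_pos (norm_pos_iff.2 hξ)
  rw [symb, sub_eq_add_neg, Real.rpow_add h, Real.rpow_one, neg_mul]

/-- This is where s ≥ 1/2 matters: the exponent 1 - 2s is not positive, so the symbol is at most one
outside the unit ball. -/
lemma symb_le {s : ℝ} (hs : 1 / 2 ≤ s) (ξ : Plane) : symb s ξ ≤ 1 + lowSymb s ξ := by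
  unfold lowSymb
  by_cases hξ : ξ ∈ Metric.ball (0 : Plane) 1
  · rw [indicator_of_mem hξ]; linarith
  · rw [indicator_of_notMem hξ]
    have h1 : 1 ≤ ‖ξ‖ := by simpa using hξ
    rw [symb_eq (norm_pos_iff.1 (by linarith)), add_zero]
    refine Real.rpow_le_one_of_one_le_of_nonpos ?_ (by linarith)
    have := Real.pi_gt_three
    nlinarith

/-- Away from zero the product is |2πξ| to the power 2 - 2s, which lies in (0, 1]. -/
lemma norm_mul_symb_le {s : ℝ} (hs : 1 / 2 ≤ s) (hs1 : s < 1) (ξ : Plane) :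
    2 * Real.pi * ‖ξ‖ * symb s ξ ≤ br ξ := by
  by_cases hξ : ξ = 0
  · subst hξ; simp [br]
  · have h : 0 < 2 * Real.pi * ‖ξ‖ := mul_pos Real.two_pi_pos (norm_pos_iff.2 hξ)
    rw [symb_eq hξ]
    have e : 2 * Real.pi * ‖ξ‖ * (2 * Real.pi * ‖ξ‖) ^ (1 - 2 * s) =
        (2 * Real.pi * ‖ξ‖) ^ (2 - 2 * s) := by
      rw [show 2 - 2 * s = 1 + (1 - 2 * s) by ring, Real.rpow_add h, Real.rpow_one]
    rw [e]
    refine (Real.rpow_le_rpow h.le (norm_le_br ξ) (by linarith)).trans ?_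
    calc br ξ ^ (2 - 2 * s) ≤ br ξ ^ (1 : ℝ) :=
          Real.rpow_le_rpow_of_exponent_le (one_le_br ξ) (by linarith)
      _ = br ξ := Real.rpow_one _

/-- Near the origin the square behaves like |ξ|^(2-4s), which is integrable in the plane because 4s
- 2 < 2. -/
lemma memLp_lowSymb {s : ℝ} (hs1 : s < 1) : MemLp (lowSymb s) 2 volume := by
  have hm : Measurable (lowSymb s) := (measurable_symb s).indicator measurableSet_ball
  rw [memLp_two_iff_integrable_sq hm.aestronglyMeasurable]
  have e : (fun ξ => lowSymb s ξ ^ 2) = (Metric.ball (0 : Plane) 1).indicator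
      fun ξ => symb s ξ ^ 2 := by
    ext ξ
    by_cases hξ : ξ ∈ Metric.ball (0 : Plane) 1 <;> simp [lowSymb, hξ]
  rw [e, integrable_indicator_iff measurableSet_ball]
  refine integrableOn_ball_of_norm_le_rpow (C := (2 * Real.pi) ^ (2 - 4 * s)) (α := 4 * s - 2)
    (by simp) (by simp; linarith) ?_ ?_
  · refine ae_restrict_of_ae ?_
    filter_upwards [compl_mem_ae_iff.2 (measure_singleton (μ := volume) (0 : Plane))] with ξ hξ
    have hn : 0 < ‖ξ‖ := norm_pos_iff.2 hξ
    have e1 : (2 - 4 * s) = (1 - 2 * s) * (2 : ℕ) := by push_cast; ring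
    have e2 : -(4 * s - 2) = (1 - 2 * s) * (2 : ℕ) := by push_cast; ring
    rw [symb_eq hξ, norm_pow, Real.norm_of_nonneg (by positivity), e1, e2,
      Real.rpow_mul_natCast (by positivity), Real.rpow_mul_natCast (by positivity), ← mul_pow,
      Real.mul_rpow (by positivity) (by positivity)]
  · exact ((measurable_symb s).pow_const 2).aestronglyMeasurable

/-- The `L²` norm of the low frequency part of the symbol. -/
noncomputable def clow (s : ℝ) : ℝ≥0 := (eLpNorm (lowSymb s) 2 volume).toNNReal

lemma coe_clow {s : ℝ} (hs1 : s < 1) : (clow s : ℝ≥0∞) = eLpNorm (lowSymb s) 2 volume :=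
  ENNReal.coe_toNNReal (memLp_lowSymb hs1).eLpNorm_ne_top

/-- The Fourier side of the velocity. -/
noncomputable def velHat (s : ℝ) (g : Plane → ℂ) (j : Fin 2) (ξ : Plane) : ℂ :=
  -(Complex.I * ((2 * Real.pi * perp ξ j * (2 * Real.pi * ‖ξ‖) ^ (-2 * s) : ℝ) : ℂ)) * g ξ

lemma norm_velHat_le (s : ℝ) (g : Plane → ℂ) (j : Fin 2) (ξ : Plane) :
    ‖velHat s g j ξ‖ ≤ symb s ξ * ‖g ξ‖ := by
  unfold velHat symb
  rw [norm_mul, norm_neg, norm_mul, Complex.norm_I, one_mul, Complex.norm_real, norm_mul, norm_mul,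
    Real.norm_of_nonneg Real.two_pi_pos.le, Real.norm_of_nonneg (by positivity :
      0 ≤ (2 * Real.pi * ‖ξ‖) ^ (-2 * s)), Real.norm_eq_abs]
  have := norm_apply_le (perp ξ) j
  rw [norm_perp] at this
  gcongr

lemma measurable_perp (j : Fin 2) : Measurable fun ξ : Plane => perp ξ j := by
  fin_cases j
  · simp only [Fin.zero_eta, perp_zero]; fun_prop
  · simp only [Fin.mk_one, perp_one]; fun_prop

lemma aestronglyMeasurable_velHat (s : ℝ) {g : Plane → ℂ} (hg : AEStronglyMeasurable g)
    (j : Fin 2) : AEStronglyMeasurable (velHat s g j) := by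
  unfold velHat
  refine AEStronglyMeasurable.mul ?_ hg
  have := measurable_perp j
  exact Measurable.aestronglyMeasurable (by fun_prop)

/-- The constant in the bound for the velocity. -/
noncomputable def kvel (s : ℝ) : ℝ≥0 := 2 * (clow s + 2 * cbr + 1)

/-- The symbol may be singular at frequency zero, so the velocity need not be square integrable. In
the L¹ part of `fsize` the low frequencies are handled by Cauchy-Schwarz; in the L² part the
homogeneous weight |ζ|³ absorbs the singularity. -/
lemma fsize_velHat_le {s : ℝ} (hs : 1 / 2 ≤ s) (hs1 : s < 1) {g : Plane → ℂ}
    (hg : AEStronglyMeasurable g) : fsize (velHat s g) ≤ kvel s * sob g := by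
  have h1 : ∀ j, eLpNorm (fun ζ => br ζ * ‖velHat s g j ζ‖) 1 volume ≤
      (clow s + 2 * cbr) * sob g := by
    intro j
    have m1 : AEStronglyMeasurable (fun ξ => lowSymb s ξ * ‖g ξ‖) (volume : Measure Plane) :=
      (memLp_lowSymb hs1).1.mul hg.norm
    have m2 : AEStronglyMeasurable (fun ξ => br ξ * ‖g ξ‖) (volume : Measure Plane) :=
      continuous_br.aestronglyMeasurable.mul hg.norm
    refine (eLpNorm_mono (g := (fun ξ => lowSymb s ξ * ‖g ξ‖) + (2 : ℝ) • fun ξ => br ξ * ‖g ξ‖)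
      fun ξ => ?_).trans ((eLpNorm_add_le m1 (m2.const_smul 2) le_rfl).trans ?_)
    · have hb := br_pos ξ
      have hl : 0 ≤ lowSymb s ξ := indicator_nonneg (fun x _ => symb_nonneg s x) ξ
      rw [norm_mul, norm_norm, Real.norm_of_nonneg hb.le]
      refine le_trans ?_ (le_abs_self _)
      simp only [Pi.add_apply, Pi.smul_apply, smul_eq_mul]
      have h2 := norm_velHat_le s g j ξ
      have h3 := symb_le hs ξ
      have h4 := norm_mul_symb_le hs hs1 ξ
      have h5 : br ξ * symb s ξ ≤ lowSymb s ξ + 2 * br ξ := by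
        have : br ξ * symb s ξ = symb s ξ + 2 * Real.pi * ‖ξ‖ * symb s ξ := by unfold br; ring
        rw [this]; linarith [one_le_br ξ]
      calc br ξ * ‖velHat s g j ξ‖ ≤ br ξ * (symb s ξ * ‖g ξ‖) := by gcongr
        _ = (br ξ * symb s ξ) * ‖g ξ‖ := by ring
        _ ≤ (lowSymb s ξ + 2 * br ξ) * ‖g ξ‖ := by gcongr
        _ = _ := by ring
    · rw [add_mul]
      refine add_le_add ?_ ?_
      · rw [coe_clow hs1]
        refine (eLpNorm_one_mul_le (memLp_lowSymb hs1).1 hg.norm).trans ?_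
        gcongr
        rw [eLpNorm_norm]; exact eLpNorm_two_le_sob g
      · rw [eLpNorm_const_smul, mul_assoc]
        refine mul_le_mul' (le_of_eq ?_) (eLpNorm_one_br_le hg)
        rw [Real.enorm_of_nonneg (by norm_num)]; simp
  have h2 : ∀ j, eLpNorm (fun ζ => ‖ζ‖ ^ 3 * ‖velHat s g j ζ‖) 2 volume ≤ sob g := by
    intro j
    refine eLpNorm_mono fun ξ => ?_
    have hb := br_pos ξ
    rw [norm_mul, norm_norm, norm_mul, norm_norm, norm_pow, norm_norm, norm_pow,
      Real.norm_of_nonneg hb.le]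
    have h4 := norm_mul_symb_le hs hs1 ξ
    have h5 := norm_le_br ξ
    have hx := norm_nonneg ξ
    have hsn := symb_nonneg s ξ
    have hpi := Real.pi_gt_three
    have h6 : ‖ξ‖ ≤ br ξ := by nlinarith
    have h7 : ‖ξ‖ * symb s ξ ≤ br ξ := by nlinarith [mul_nonneg hx hsn]
    calc ‖ξ‖ ^ 3 * ‖velHat s g j ξ‖ ≤ ‖ξ‖ ^ 3 * (symb s ξ * ‖g ξ‖) := by
          gcongr; exact norm_velHat_le s g j ξ
      _ = ‖ξ‖ ^ 2 * (‖ξ‖ * symb s ξ) * ‖g ξ‖ := by ring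
      _ ≤ br ξ ^ 2 * br ξ * ‖g ξ‖ := by gcongr
      _ = _ := by ring
  unfold fsize
  refine (Finset.sum_le_sum fun j _ => add_le_add (h1 j) (h2 j)).trans (le_of_eq ?_)
  simp only [Finset.sum_const, Finset.card_univ, Fintype.card_fin, nsmul_eq_mul, kvel]
  push_cast; ring

lemma velHat_congr {s : ℝ} {g₁ g₂ : Plane → ℂ} (h : g₁ =ᵐ[volume] g₂) (j : Fin 2) :
    velHat s g₁ j =ᵐ[volume] velHat s g₂ j := by
  filter_upwards [h] with ξ hξ; simp [velHat, hξ]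

lemma velocity_eq_re (s : ℝ) {f g} (h : Rep f g) (x : Plane) (j : Fin 2) :
    velocity s f x j = ((𝓕⁻ (velHat s g j)) x).re := by
  rw [← Real.fourierInv_congr_ae (velHat_congr h.l2Fourier_ae_eq j), fourierInv_eq_integral]
  simp only [velocity, velHat]
  congr 1
  refine integral_congr_ae (.of_forall fun ξ => ?_)
  simp only; ring

/-- The symbol is odd and purely imaginary, which preserves Hermitian symmetry and makes the inverse
transform real. The divergence vanishes because ζ and ζ^⊥ are orthogonal. -/
lemma Rep.field_velocity {s : ℝ} (hs : 1 / 2 ≤ s) (hs1 : s < 1) {f g} (h : Rep f g) :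
    Field (velocity s f) (velHat s g) := by
  refine ⟨aestronglyMeasurable_velHat s h.meas, ((fsize_velHat_le hs hs1 h.meas).trans_lt
    (ENNReal.mul_lt_top ENNReal.coe_lt_top h.fin.lt_top)).ne, fun x j => ?_,
    .of_forall fun ζ => ?_⟩
  · rw [velocity_eq_re s h]
    have h1 : velHat s g j =ᵐ[volume] fun ξ => (starRingEnd ℂ) (velHat s g j (-ξ)) := by
      filter_upwards [ae_conj_neg_of_real h.integrable h.eq] with ξ hξ
      have : perp (-ξ) j = - perp ξ j := by fin_cases j <;> simp [perp]
      simp only [velHat, norm_neg, hξ, this, map_mul, map_neg, Complex.conj_I, Complex.conj_conj,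
        Complex.conj_ofReal]
      push_cast; ring
    have h2 := Real.fourierInv_congr_ae h1 x
    rw [fourierInv_conj_neg] at h2
    exact Complex.conj_eq_iff_re.1 h2.symm
  · simp only [velHat, Fin.sum_univ_two, perp_zero, perp_one]
    push_cast; ring

lemma velocity_sub {s : ℝ} (hs : 1 / 2 ≤ s) (hs1 : s < 1) {f₁ f₂ g₁ g₂} (h₁ : Rep f₁ g₁)
    (h₂ : Rep f₂ g₂) (x : Plane) :
    velocity s (fun x => f₁ x - f₂ x) x = velocity s f₁ x - velocity s f₂ x := by
  ext j
  have e1 := (h₁.field_velocity hs hs1)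
  have e2 := (h₂.field_velocity hs hs1)
  rw [PiLp.sub_apply, velocity_eq_re s (h₁.sub h₂), velocity_eq_re s h₁, velocity_eq_re s h₂,
    ← Complex.sub_re, fourierInv_eq_integral, fourierInv_eq_integral, fourierInv_eq_integral,
    ← integral_sub (integrable_fourier_exp_mul (e1.integrable j) x)
      (integrable_fourier_exp_mul (e2.integrable j) x)]
  congr 1
  refine integral_congr_ae (.of_forall fun ξ => ?_)
  simp only [velHat]; ring

/-! ### The velocity at a point around which the scalar is constant -/

/-- The derivative of the heat kernel at time `t` in the direction `-v`. -/
noncomputable def heatK (v : Plane) (t : ℝ) (x : Plane) : ℝ :=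
  inner ℝ x v / (2 * t) * ((4 * Real.pi * t)⁻¹ * Real.exp (-(‖x‖ ^ 2 / (4 * t))))

/-- The Fourier side of `heatK`. -/
noncomputable def heatHat (v : Plane) (t : ℝ) (ξ : Plane) : ℂ :=
  -(2 * Real.pi * Complex.I * (inner ℝ ξ v : ℝ) *
    Complex.exp (-(4 * Real.pi ^ 2 * t : ℝ) * ‖ξ‖ ^ 2))

lemma integrable_gaussian {b : ℝ} (hb : 0 < b) :
    Integrable fun x : Plane => Complex.exp (-(b : ℂ) * ‖x‖ ^ 2) := by
  have := GaussianFourier.integrable_cexp_neg_mul_sq_norm_add (V := Plane) (b := b)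
    (by simpa using hb) 0 0
  simpa using this

lemma norm_gaussian (b : ℝ) (x : Plane) :
    ‖Complex.exp (-(b : ℂ) * ‖x‖ ^ 2)‖ = Real.exp (-(b * ‖x‖ ^ 2)) := by
  rw [show -(b : ℂ) * ‖x‖ ^ 2 = ((-(b * ‖x‖ ^ 2) : ℝ) : ℂ) by push_cast; ring,
    Complex.norm_exp_ofReal]

lemma integrable_norm_mul_gaussian {b : ℝ} (hb : 0 < b) :
    Integrable fun x : Plane => ‖x‖ * Real.exp (-(b * ‖x‖ ^ 2)) := by
  have h := (integrable_gaussian (half_pos hb)).norm.const_mul (1 + 1 / b)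
  simp only [norm_gaussian] at h
  refine h.mono' (Continuous.aestronglyMeasurable (by fun_prop)) (.of_forall fun x => ?_)
  have hx := norm_nonneg x
  rw [Real.norm_of_nonneg (by positivity)]
  have e : Real.exp (-(b * ‖x‖ ^ 2)) =
      Real.exp (-(b / 2 * ‖x‖ ^ 2)) * Real.exp (-(b / 2 * ‖x‖ ^ 2)) := by
    rw [← Real.exp_add]; congr 1; ring
  have h1 : ‖x‖ * Real.exp (-(b / 2 * ‖x‖ ^ 2)) ≤ 1 + 1 / b := by
    rw [Real.exp_neg, ← div_eq_mul_inv, div_le_iff₀ (Real.exp_pos _)]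
    have h2 := Real.add_one_le_exp (b / 2 * ‖x‖ ^ 2)
    have h3 : 0 < 1 + 1 / b := by positivity
    have h4 : (1 + 1 / b) * (b / 2 * ‖x‖ ^ 2 + 1) = b / 2 * ‖x‖ ^ 2 + 1 + ‖x‖ ^ 2 / 2 + 1 / b := by
      field_simp; ring
    have h5 : 0 < 1 / b := by positivity
    have h6 : 0 ≤ b / 2 * ‖x‖ ^ 2 := by positivity
    nlinarith [mul_le_mul_of_nonneg_left h2 h3.le, sq_nonneg (‖x‖ - 1)]
  rw [e, ← mul_assoc]
  exact mul_le_mul_of_nonneg_right h1 (Real.exp_nonneg _)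

/-- The explicit transform of a Gaussian, differentiated in the direction v under the Fourier
integral and then negated. -/
lemma fourierInv_heatHat (v : Plane) {t : ℝ} (ht : 0 < t) (x : Plane) :
    (𝓕⁻ (heatHat v t)) x = ((heatK v t x : ℝ) : ℂ) := by
  set b : ℝ := 4 * Real.pi ^ 2 * t with hb
  have hb0 : 0 < b := by positivity
  set γ : Plane → ℂ := fun ξ => Complex.exp (-(b : ℂ) * ‖ξ‖ ^ 2)
  have h1 : 𝓕⁻ γ = fun x : Plane => ((((4 * Real.pi * t)⁻¹ *
      Real.exp (-(‖x‖ ^ 2 / (4 * t))) : ℝ)) : ℂ) := by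
    ext y
    rw [Real.fourierInv_eq_fourier_neg, fourier_gaussian_innerProductSpace (by simpa using hb0)]
    simp only [finrank_euclideanSpace, Fintype.card_fin, norm_neg]
    rw [show ((2 : ℕ) : ℂ) / 2 = 1 by norm_num, Complex.cpow_one]
    push_cast
    have hpi : (Real.pi : ℂ) ≠ 0 := by simp [Real.pi_ne_zero]
    have htc : (t : ℂ) ≠ 0 := by simp [ht.ne']
    have hbc : (b : ℂ) = 4 * Real.pi ^ 2 * t := by rw [hb]; push_cast; ring
    rw [hbc]
    congr 1
    · field_simp
    · congr 1; field_simp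
  obtain ⟨L, hL, hLv⟩ := hasFDerivAt_fourierInv (g := γ) (integrable_gaussian hb0)
    (by simp only [γ, norm_gaussian]; exact integrable_norm_mul_gaussian hb0) x
  have h2 : HasFDerivAt (fun x : Plane => (4 * Real.pi * t)⁻¹ * Real.exp (-(‖x‖ ^ 2 / (4 * t))))
      ((4 * Real.pi * t)⁻¹ • (Real.exp (-(‖x‖ ^ 2 / (4 * t))) •
        (-((4 * t)⁻¹ • ((2 : ℕ) • innerSL ℝ x : Plane →L[ℝ] ℝ)) : Plane →L[ℝ] ℝ)) : Plane →L[ℝ] ℝ) x := by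
    have hN : HasFDerivAt (fun x : Plane => ‖x‖ ^ 2) ((2 : ℕ) • innerSL ℝ x : Plane →L[ℝ] ℝ) x :=
      (hasStrictFDerivAt_norm_sq x).hasFDerivAt
    have hN' : HasFDerivAt (fun x : Plane => -(‖x‖ ^ 2 / (4 * t)))
        (-((4 * t)⁻¹ • ((2 : ℕ) • innerSL ℝ x : Plane →L[ℝ] ℝ)) : Plane →L[ℝ] ℝ) x := by
      simp only [div_eq_inv_mul]
      exact (hN.const_mul _).neg
    exact (hN'.exp).const_mul _
  have h3 := Complex.ofRealCLM.hasFDerivAt.comp x h2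
  rw [h1] at hL
  have h4 := congrArg (fun M : Plane →L[ℝ] ℂ => M v) (hL.unique h3)
  simp only [hLv] at h4
  have h5 : (𝓕⁻ (heatHat v t)) x =
      -(𝓕⁻ fun ξ => 2 * Real.pi * Complex.I * (inner ℝ ξ v : ℝ) * γ ξ) x := by
    rw [fourierInv_eq_integral, fourierInv_eq_integral, ← integral_neg]
    refine integral_congr_ae (.of_forall fun ξ => ?_)
    simp only [heatHat, γ, hb]; ring
  rw [h5, h4]
  have i0 : (innerSL ℝ x) v = inner ℝ x v := rfl
  simp only [ContinuousLinearMap.comp_apply, Complex.ofRealCLM_apply, heatK, smul_apply, neg_apply,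
    smul_eq_mul, i0, nsmul_eq_mul]
  push_cast
  field_simp
  ring

lemma continuous_heatHat (v : Plane) (t : ℝ) : Continuous (heatHat v t) := by
  unfold heatHat; fun_prop

lemma norm_heatHat_le (v : Plane) (t : ℝ) (ξ : Plane) : ‖heatHat v t ξ‖ ≤
    2 * Real.pi * ‖v‖ * (‖ξ‖ * Real.exp (-((4 * Real.pi ^ 2 * t) * ‖ξ‖ ^ 2))) := by
  unfold heatHat
  rw [norm_neg, norm_mul, norm_gaussian]
  simp only [norm_mul, Complex.norm_I, Complex.norm_real, Complex.norm_ofNat, mul_one,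
    Real.norm_of_nonneg Real.pi_pos.le]
  have := norm_inner_le_norm (𝕜 := ℝ) ξ v
  calc _ ≤ 2 * Real.pi * (‖ξ‖ * ‖v‖) * Real.exp (-((4 * Real.pi ^ 2 * t) * ‖ξ‖ ^ 2)) := by gcongr
    _ = _ := by ring

lemma integrable_heatHat (v : Plane) {t : ℝ} (ht : 0 < t) : Integrable (heatHat v t) :=
  ((integrable_norm_mul_gaussian (by positivity)).const_mul _).mono'
    (continuous_heatHat v t).aestronglyMeasurable (.of_forall (norm_heatHat_le v t))

lemma abs_heatK_le (v : Plane) {t : ℝ} (ht : 0 < t) (x : Plane) : |heatK v t x| ≤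
    ‖v‖ / (8 * Real.pi * t ^ 2) * (‖x‖ * Real.exp (-((4 * t)⁻¹ * ‖x‖ ^ 2))) := by
  unfold heatK
  rw [abs_mul, abs_div, abs_of_pos (by positivity : 0 < 2 * t), abs_of_nonneg (by positivity :
    0 ≤ (4 * Real.pi * t)⁻¹ * Real.exp (-(‖x‖ ^ 2 / (4 * t))))]
  have h := abs_real_inner_le_norm x v
  calc _ ≤ ‖x‖ * ‖v‖ / (2 * t) * ((4 * Real.pi * t)⁻¹ * Real.exp (-(‖x‖ ^ 2 / (4 * t)))) := by
        gcongr
    _ = _ := by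
      rw [show ‖x‖ ^ 2 / (4 * t) = (4 * t)⁻¹ * ‖x‖ ^ 2 by field_simp]
      field_simp; ring

lemma continuous_heatK (v : Plane) (t : ℝ) : Continuous (heatK v t) := by
  unfold heatK; fun_prop

lemma integrable_heatK (v : Plane) {t : ℝ} (ht : 0 < t) : Integrable (heatK v t) :=
  ((integrable_norm_mul_gaussian (by positivity)).const_mul _).mono'
    (continuous_heatK v t).aestronglyMeasurable (.of_forall (abs_heatK_le v ht))

lemma fourier_heatK (v : Plane) {t : ℝ} (ht : 0 < t) :
    𝓕 (fun x => (heatK v t x : ℂ)) = heatHat v t := by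
  have h : (fun x => (heatK v t x : ℂ)) = 𝓕⁻ (heatHat v t) :=
    funext fun x => (fourierInv_heatHat v ht x).symm
  rw [h, Continuous.fourier_fourierInv_eq (continuous_heatHat v t) (integrable_heatHat v ht)]
  have : 𝓕 (heatHat v t) = fun x => ((heatK v t (-x) : ℝ) : ℂ) := by
    ext x
    rw [← fourierInv_heatHat v ht, Real.fourierInv_eq_fourier_neg, neg_neg]
  rw [this]
  exact (integrable_heatK v ht).comp_neg.ofReal

lemma integral_fourier_mul {K g : Plane → ℂ} (hK : Integrable K) (hg : Integrable g) :
    ∫ ξ, (𝓕 K) ξ * g ξ = ∫ x, K x * (𝓕 g) x := by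
  have h1 := VectorFourier.integral_fourierIntegral_smul_eq_flip (μ := (volume : Measure Plane))
    (ν := (volume : Measure Plane)) (f := K) (g := g) (L := innerₗ Plane)
    Real.continuous_fourierChar (by simpa using continuous_inner) hK hg
  rw [flip_innerₗ] at h1
  exact h1

lemma heatK_neg (v : Plane) (t : ℝ) (x : Plane) : heatK v t (-x) = - heatK v t x := by
  unfold heatK; rw [inner_neg_left, norm_neg]; ring

/-- The heat flow of the gradient at a point, written with the odd part of the function. -/
lemma integral_heatHat_mul (v : Plane) {t : ℝ} (ht : 0 < t) {f g} (h : Rep f g) (z : Plane) :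
    ∫ ξ, heatHat v t ξ *
      (Complex.exp (2 * Real.pi * Complex.I * (inner ℝ z ξ : ℝ)) * g ξ) =
      ((2⁻¹ * ∫ x, heatK v t x * (f (z - x) - f (z + x)) : ℝ) : ℂ) := by
  have hg' := integrable_fourier_exp_mul h.integrable z
  have hK : Integrable fun x => (heatK v t x : ℂ) := (integrable_heatK v ht).ofReal
  have e1 : ∀ x, (𝓕 fun ξ => Complex.exp (2 * Real.pi * Complex.I * (inner ℝ z ξ : ℝ)) * g ξ) x =
      ((f (z - x) : ℝ) : ℂ) := fun x => by
    rw [h.eq, fourierInv_eq_integral, Real.fourier_eq']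
    refine integral_congr_ae (.of_forall fun ξ => ?_)
    simp only [smul_eq_mul]
    rw [← mul_assoc, ← Complex.exp_add, inner_sub_left, real_inner_comm ξ x]
    congr 2; push_cast; ring
  rw [← fourier_heatK v ht, integral_fourier_mul hK hg']
  simp only [e1, ← Complex.ofReal_mul]
  refine integral_complex_ofReal.trans (congrArg _ ?_)
  obtain ⟨M, hM⟩ : ∃ M, ∀ x, |f x| ≤ M := ⟨∫ ξ, ‖g ξ‖, fun x => by
    have := norm_fourierInv_le g x
    rwa [← h.eq, Complex.norm_real] at this⟩
  have i1 : Integrable fun x => heatK v t x * f (z - x) :=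
    (integrable_heatK v ht).mul_bdd (c := M)
      (h.continuous.comp (by fun_prop)).aestronglyMeasurable (.of_forall fun x => hM _)
  have i2 : Integrable fun x => heatK v t x * f (z + x) :=
    (integrable_heatK v ht).mul_bdd (c := M)
      (h.continuous.comp (by fun_prop)).aestronglyMeasurable (.of_forall fun x => hM _)
  -- The kernel is odd, so f enters only through its odd part about z, and additive constants
  -- disappear.
  have h1 : ∫ x, heatK v t x * f (z + x) = -∫ x, heatK v t x * f (z - x) := by
    rw [← integral_neg_eq_self, ← integral_neg]
    refine integral_congr_ae (.of_forall fun x => ?_)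
    simp [heatK_neg, sub_eq_add_neg]
  simp only [mul_sub]
  rw [integral_sub i1 i2, h1]; ring

lemma rpow_mul_heatHat (s : ℝ) (v : Plane) (t : ℝ) (ξ : Plane) :
    ((t ^ (s - 1) : ℝ) : ℂ) * heatHat v t ξ = -(2 * Real.pi * Complex.I * (inner ℝ ξ v : ℝ)) *
      ((t ^ (s - 1) * Real.exp (-((2 * Real.pi * ‖ξ‖) ^ 2 * t)) : ℝ) : ℂ) := by
  unfold heatHat
  rw [show (-((4 * Real.pi ^ 2 * t : ℝ) : ℂ)) * ‖ξ‖ ^ 2 =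
    ((-((2 * Real.pi * ‖ξ‖) ^ 2 * t) : ℝ) : ℂ) by push_cast; ring]
  push_cast; ring

/-- The Gamma integral, which exhibits the multiplier of (-Δ)^(-s) as a superposition of heat
multipliers. -/
lemma integral_rpow_mul_exp {s : ℝ} (hs : 0 < s) {ξ : Plane} (hξ : ξ ≠ 0) :
    ∫ t in Ioi (0 : ℝ), t ^ (s - 1) * Real.exp (-((2 * Real.pi * ‖ξ‖) ^ 2 * t)) =
      Real.Gamma s * (2 * Real.pi * ‖ξ‖) ^ (-2 * s) := by
  have hn : 0 < 2 * Real.pi * ‖ξ‖ := by have := norm_pos_iff.2 hξ; positivity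
  rw [Real.integral_rpow_mul_exp_neg_mul_Ioi hs (by positivity), mul_comm, one_div,
    Real.inv_rpow (by positivity), ← Real.rpow_natCast, ← Real.rpow_mul hn.le, ← Real.rpow_neg hn.le]
  congr 2; push_cast; ring

/-- The Bochner integral of a non-integrable function is zero, so the positive value just computed
forces integrability. -/
lemma integrableOn_rpow_mul_exp {s : ℝ} (hs : 0 < s) {ξ : Plane} (hξ : ξ ≠ 0) :
    IntegrableOn (fun t => t ^ (s - 1) * Real.exp (-((2 * Real.pi * ‖ξ‖) ^ 2 * t))) (Ioi 0) := by
  refine .of_integral_ne_zero ?_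
  rw [integral_rpow_mul_exp hs hξ]
  have := norm_pos_iff.2 hξ
  have := Real.Gamma_pos_of_pos hs
  positivity

/-- The velocity as a superposition of heat flows of the gradient. -/
lemma velocity_eq_integral_heat {s : ℝ} (hs : 1 / 2 ≤ s) (hs1 : s < 1) {f g} (h : Rep f g)
    (z : Plane) {j : Fin 2} {v : Plane} (hv : ∀ ξ : Plane, inner ℝ ξ v = perp ξ j) :
    velocity s f z j = (Real.Gamma s)⁻¹ * ∫ t in Ioi (0 : ℝ),
      t ^ (s - 1) * (2⁻¹ * ∫ x, heatK v t x * (f (z - x) - f (z + x))) := by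
  have hs0 : 0 < s := by linarith
  set E : Plane → ℂ := fun ξ => Complex.exp (2 * Real.pi * Complex.I * (inner ℝ z ξ : ℝ)) with hE
  have hEn : ∀ ξ, ‖E ξ‖ = 1 := fun ξ => by
    rw [hE]; simp only
    rw [show 2 * (Real.pi : ℂ) * Complex.I * (inner ℝ z ξ : ℝ) =
      ((2 * Real.pi * inner ℝ z ξ : ℝ) : ℂ) * Complex.I by push_cast; ring,
      Complex.norm_exp_ofReal_mul_I]
  set G : ℝ × Plane → ℂ := fun p =>
    ((p.1 ^ (s - 1) : ℝ) : ℂ) * heatHat v p.1 p.2 * (E p.2 * g p.2) with hG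
  have hGx : ∀ t ξ, G (t, ξ) = (-(2 * Real.pi * Complex.I * (inner ℝ ξ v : ℝ)) * (E ξ * g ξ)) *
      ((t ^ (s - 1) * Real.exp (-((2 * Real.pi * ‖ξ‖) ^ 2 * t)) : ℝ) : ℂ) := fun t ξ => by
    simp only [hG]; rw [rpow_mul_heatHat]; ring
  have hne : ∀ᵐ ξ : Plane, ξ ≠ 0 := by
    simp [ae_iff, measure_singleton]
  have hmeas : AEStronglyMeasurable G ((volume.restrict (Ioi (0 : ℝ))).prod volume) := by
    refine AEStronglyMeasurable.mul ?_ (AEStronglyMeasurable.comp_snd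
      ((Continuous.aestronglyMeasurable (by fun_prop)).mul h.meas))
    refine AEStronglyMeasurable.mul ?_ ?_
    · exact Measurable.aestronglyMeasurable (by fun_prop)
    · exact Continuous.aestronglyMeasurable (by unfold heatHat; fun_prop)
  -- Integrating the modulus over t first gives Γ(s) times the modulus of the Fourier side of the
  -- velocity, which is integrable.
  have hint : Integrable G ((volume.restrict (Ioi (0 : ℝ))).prod volume) := by
    rw [integrable_prod_iff' hmeas]
    constructor
    · filter_upwards [hne] with ξ hξ
      simp only [hGx]
      exact ((integrableOn_rpow_mul_exp hs0 hξ).ofReal).const_mul _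
    · refine Integrable.congr (((h.field_velocity hs hs1).integrable j).norm.const_mul
        (Real.Gamma s)) ?_
      filter_upwards [hne] with ξ hξ
      simp only [hGx, norm_mul, norm_neg, hEn, Complex.norm_I, Complex.norm_real, Complex.norm_ofNat,
        mul_one, one_mul, velHat, integral_const_mul, hv]
      have : ∫ t in Ioi (0 : ℝ),
          ‖t ^ (s - 1)‖ * ‖Real.exp (-((2 * Real.pi * ‖ξ‖) ^ 2 * t))‖ =
          Real.Gamma s * (2 * Real.pi * ‖ξ‖) ^ (-2 * s) := by
        rw [← integral_rpow_mul_exp hs0 hξ]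
        refine setIntegral_congr_fun measurableSet_Ioi fun t (ht : 0 < t) => ?_
        have ht' : 0 ≤ t := ht.le
        rw [Real.norm_of_nonneg (by positivity), Real.norm_of_nonneg (by positivity)]
      rw [this, Real.norm_of_nonneg (by positivity : 0 ≤ (2 * Real.pi * ‖ξ‖) ^ (-2 * s))]
      rw [show ‖(2 : ℝ)‖ = 2 by norm_num]
      ring
  have hswap := integral_integral_swap (f := fun t ξ => G (t, ξ)) hint
  have hR : ∫ ξ, ∫ t in Ioi (0 : ℝ), G (t, ξ) =
      Real.Gamma s * ∫ ξ, E ξ * velHat s g j ξ := by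
    rw [← integral_const_mul]
    refine integral_congr_ae ?_
    filter_upwards [hne] with ξ hξ
    simp only [hGx, integral_const_mul]
    have := integral_complex_ofReal (μ := volume.restrict (Ioi (0 : ℝ))) (f := fun t : ℝ =>
      t ^ (s - 1) * Real.exp (-((2 * Real.pi * ‖ξ‖) ^ 2 * t)))
    rw [this, integral_rpow_mul_exp hs0 hξ, velHat, hv]
    push_cast; ring
  have hL : ∫ t in Ioi (0 : ℝ), ∫ ξ, G (t, ξ) = ((∫ t in Ioi (0 : ℝ),
      t ^ (s - 1) * (2⁻¹ * ∫ x, heatK v t x * (f (z - x) - f (z + x))) : ℝ) : ℂ) := by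
    rw [← integral_complex_ofReal]
    refine setIntegral_congr_fun measurableSet_Ioi fun t ht => ?_
    simp only [hG, mul_assoc]
    rw [integral_const_mul, integral_heatHat_mul v ht h z]
    push_cast; ring
  have hΓ : (Real.Gamma s : ℂ) ≠ 0 := by exact_mod_cast (Real.Gamma_pos_of_pos hs0).ne'
  rw [velocity_eq_re s h, fourierInv_eq_integral]
  rw [hR, hL] at hswap
  rw [show (∫ ξ, Complex.exp (2 * Real.pi * Complex.I * (inner ℝ z ξ : ℝ)) * velHat s g j ξ) =
    (Real.Gamma s : ℂ)⁻¹ * (Real.Gamma s * ∫ ξ, E ξ * velHat s g j ξ) by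
      rw [inv_mul_cancel_left₀ hΓ], ← hswap,
    ← Complex.ofReal_inv, ← Complex.ofReal_mul, Complex.ofReal_re]

/-- Decay of the differentiated heat kernel away from the origin, uniformly in time. -/
lemma abs_heatK_le_rpow (v : Plane) {t p : ℝ} (ht : 0 < t) (hp : 0 ≤ p) (hp2 : p ≤ 2) {x : Plane}
    (hx : x ≠ 0) : |heatK v t x| ≤ 16 * ‖v‖ * (t ^ (p - 2) * ‖x‖ ^ (1 - 2 * p)) := by
  have hn := norm_pos_iff.2 hx
  refine (abs_heatK_le v ht x).trans ?_
  set u := (4 * t)⁻¹ * ‖x‖ ^ 2 with hu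
  have hu0 : 0 < u := by positivity
  -- For 0 ≤ p ≤ 2 the power is at most 1 + u², and the quadratic Taylor polynomial of the
  -- exponential bounds this.
  have h1 : u ^ p ≤ 2 * Real.exp u := by
    have h2 := Real.quadratic_le_exp_of_nonneg hu0.le
    have h3 : u ^ p ≤ 1 + u ^ 2 := by
      rcases le_total u 1 with h | h
      · have := Real.rpow_le_one hu0.le h hp; nlinarith
      · have := Real.rpow_le_rpow_of_exponent_le h hp2
        rw [Real.rpow_two] at this; linarith
    linarith
  have h4 : Real.exp (-u) ≤ 2 * (u ^ p)⁻¹ := by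
    rw [Real.exp_neg, ← div_eq_mul_inv, le_div_iff₀ (by positivity), mul_comm, ← div_eq_mul_inv,
      div_le_iff₀ (Real.exp_pos u)]
    exact h1
  have h5 : (u ^ p)⁻¹ ≤ 16 * (t ^ p * ‖x‖ ^ (-2 * p)) := by
    rw [hu, Real.mul_rpow (by positivity) (by positivity), Real.inv_rpow (by positivity), mul_inv,
      inv_inv, Real.mul_rpow (by norm_num) ht.le, ← Real.rpow_natCast, ← Real.rpow_mul hn.le,
      ← Real.rpow_neg hn.le, mul_assoc]
    push_cast
    rw [neg_mul]
    have : (4 : ℝ) ^ p ≤ 16 := by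
      have := Real.rpow_le_rpow_of_exponent_le (x := 4) (by norm_num) hp2
      rw [Real.rpow_two] at this; linarith
    gcongr
  have h6 : t ^ (p - 2) = t ^ p / t ^ 2 := by rw [Real.rpow_sub ht, Real.rpow_two]
  have h7 : ‖x‖ ^ (1 - 2 * p) = ‖x‖ * ‖x‖ ^ (-2 * p) := by
    rw [show 1 - 2 * p = 1 + -2 * p by ring, Real.rpow_add hn, Real.rpow_one]
  calc ‖v‖ / (8 * Real.pi * t ^ 2) * (‖x‖ * Real.exp (-u))
      ≤ ‖v‖ / (8 * Real.pi * t ^ 2) * (‖x‖ * (2 * (16 * (t ^ p * ‖x‖ ^ (-2 * p))))) := by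
        gcongr; exact h4.trans (by gcongr)
    _ = 4 / Real.pi * (‖v‖ * (t ^ (p - 2) * ‖x‖ ^ (1 - 2 * p))) := by
        rw [h6, h7]; field_simp; ring
    _ ≤ 16 * (‖v‖ * (t ^ (p - 2) * ‖x‖ ^ (1 - 2 * p))) := by
        gcongr
        rw [div_le_iff₀ Real.pi_pos]; linarith [Real.pi_gt_three]
    _ = _ := by ring

/-- The decay exponent p of `abs_heatK_le_rpow` is chosen by the size of t. For t ≤ 1, p = 2 removes
the singularity in time. For t > 1, p = (3 - s)/2 gives the decay |x|^(s-2) and leaves t^((s-3)/2)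
after multiplication by t^(s-1), which is integrable at infinity since s < 1. -/
lemma exists_heatK_le {s r : ℝ} (hs : 1 / 2 ≤ s) (hs1 : s < 1) (hr : 0 < r) :
    ∃ m : ℝ → ℝ, (∀ t, 0 ≤ m t) ∧ IntegrableOn (fun t => t ^ (s - 1) * m t) (Ioi 0) ∧
      ∀ v t x, 0 < t → r ≤ ‖x‖ → |heatK v t x| ≤ ‖v‖ * m t * (1 + ‖x‖) ^ (s - 2) := by
  set A : ℝ := 16 * (1 + r ^ (-(1 + s))) * (1 + 1 / r) ^ (2 - s) with hA
  have hA0 : 0 ≤ A := by positivity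
  refine ⟨fun t => if t ≤ 1 then A else A * t ^ (-(1 + s) / 2), fun t => ?_, ?_, fun v t x ht hx => ?_⟩
  · simp only
    split_ifs with h
    · exact hA0
    · have : 0 ≤ t := by linarith
      positivity
  · rw [← Ioc_union_Ioi_eq_Ioi zero_le_one]
    refine IntegrableOn.union ?_ ?_
    · have h1 : IntegrableOn (fun t : ℝ => t ^ (s - 1)) (Ioc 0 1) :=
        (intervalIntegrable_iff_integrableOn_Ioc_of_le zero_le_one).1
          (intervalIntegral.intervalIntegrable_rpow' (by linarith))
      refine IntegrableOn.congr_fun (Integrable.mul_const h1 A) (fun t ht => ?_) measurableSet_Ioc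
      simp [ht.2]
    · have h1 := integrableOn_Ioi_rpow_of_lt (a := (s - 3) / 2) (by linarith) one_pos
      refine IntegrableOn.congr_fun (Integrable.const_mul h1 A) (fun t (ht : 1 < t) => ?_)
        measurableSet_Ioi
      have ht0 : 0 < t := by linarith
      simp only [if_neg (not_le.2 ht)]
      rw [mul_left_comm, ← Real.rpow_add ht0]
      congr 2; ring
  · have hn : 0 < ‖x‖ := hr.trans_le hx
    have hx0 : x ≠ 0 := norm_pos_iff.1 hn
    have hW : ‖x‖ ^ (s - 2) ≤ (1 + 1 / r) ^ (2 - s) * (1 + ‖x‖) ^ (s - 2) := by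
      have h1 : (1 + ‖x‖) ^ (2 - s) ≤ (1 + 1 / r) ^ (2 - s) * ‖x‖ ^ (2 - s) := by
        rw [← Real.mul_rpow (by positivity) (by positivity)]
        refine Real.rpow_le_rpow (by positivity) ?_ (by linarith)
        have : 1 ≤ ‖x‖ / r := (one_le_div hr).2 hx
        rw [add_mul, one_mul, one_div_mul_eq_div]; linarith
      rw [show s - 2 = -(2 - s) by ring, Real.rpow_neg hn.le, Real.rpow_neg (by positivity),
        ← div_eq_mul_inv, le_div_iff₀ (by positivity), inv_mul_le_iff₀ (by positivity), mul_comm]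
      exact h1
    have hB : 0 ≤ r ^ (-(1 + s)) := by positivity
    simp only
    split_ifs with h
    · refine (abs_heatK_le_rpow v ht (p := 2) (by norm_num) le_rfl hx0).trans ?_
      rw [sub_self, Real.rpow_zero, one_mul]
      have h3 : ‖x‖ ^ (1 - 2 * (2 : ℝ)) ≤ r ^ (-(1 + s)) * ‖x‖ ^ (s - 2) := by
        rw [show 1 - 2 * (2 : ℝ) = -(1 + s) + (s - 2) by ring, Real.rpow_add hn]
        gcongr ?_ * _
        exact Real.rpow_le_rpow_of_nonpos hr hx (by linarith)
      calc 16 * ‖v‖ * ‖x‖ ^ (1 - 2 * (2 : ℝ))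
          ≤ 16 * ‖v‖ * ((1 + r ^ (-(1 + s))) * ((1 + 1 / r) ^ (2 - s) * (1 + ‖x‖) ^ (s - 2))) := by
            gcongr
            refine h3.trans ?_
            gcongr
            linarith
        _ = _ := by rw [hA]; ring
    · refine (abs_heatK_le_rpow v ht (p := (3 - s) / 2) (by linarith) (by linarith) hx0).trans ?_
      rw [show (3 - s) / 2 - 2 = -(1 + s) / 2 by ring, show 1 - 2 * ((3 - s) / 2) = s - 2 by ring]
      calc 16 * ‖v‖ * (t ^ (-(1 + s) / 2) * ‖x‖ ^ (s - 2))
          ≤ 16 * ‖v‖ * (t ^ (-(1 + s) / 2) *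
            ((1 + r ^ (-(1 + s))) * ((1 + 1 / r) ^ (2 - s) * (1 + ‖x‖) ^ (s - 2)))) := by
            gcongr
            refine hW.trans ?_
            refine le_mul_of_one_le_left (by positivity) (by linarith)
        _ = _ := by rw [hA]; ring

/-- The square has exponent 2s - 4 < -2, so s < 1 is what gives convergence in the plane. -/
lemma memLp_one_add_norm_rpow {s : ℝ} (hs1 : s < 1) :
    MemLp (fun x : Plane => (1 + ‖x‖) ^ (s - 2)) 2 volume := by
  rw [memLp_two_iff_integrable_sq (Measurable.aestronglyMeasurable (by fun_prop))]
  have h : Integrable (fun x : Plane => (1 + ‖x‖) ^ (-(4 - 2 * s))) volume :=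
    integrable_one_add_norm (by simp; linarith)
  refine h.congr (.of_forall fun x => ?_)
  simp only
  rw [← Real.rpow_natCast, ← Real.rpow_mul (by positivity)]
  congr 1; push_cast; ring

/-- The velocity at the centre of a ball on which the scalar is constant is controlled by
the `L²` norm of the scalar. -/
lemma exists_norm_velocity_le {s r : ℝ} (hs : 1 / 2 ≤ s) (hs1 : s < 1) (hr : 0 < r) :
    ∃ C : ℝ≥0, ∀ f g, Rep f g → ∀ z β, (∀ x ∈ Metric.ball z r, f x = β) →
      ‖velocity s f z‖ ≤ C * (eLpNorm f 2 volume).toReal := by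
  obtain ⟨m, hm0, hmi, hm⟩ := exists_heatK_le hs hs1 hr
  have hs0 : 0 < s := by linarith
  set W : Plane → ℝ := fun x => (1 + ‖x‖) ^ (s - 2)
  have hW : MemLp W 2 volume := memLp_one_add_norm_rpow hs1
  set D : ℝ := (Real.Gamma s)⁻¹ * ((∫ t in Ioi (0 : ℝ), t ^ (s - 1) * m t) *
    (eLpNorm W 2 volume).toReal) with hD
  have hΓ := Real.Gamma_pos_of_pos hs0
  have hD0 : 0 ≤ D := by
    refine mul_nonneg (by positivity) (mul_nonneg ?_ ENNReal.toReal_nonneg)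
    exact setIntegral_nonneg measurableSet_Ioi fun t (ht : 0 < t) =>
      mul_nonneg (by positivity) (hm0 t)
  have key : ∀ f g, Rep f g → ∀ z β, (∀ x ∈ Metric.ball z r, f x = β) → ∀ (j : Fin 2) (v : Plane),
      ‖v‖ = 1 → (∀ ξ : Plane, inner ℝ ξ v = perp ξ j) →
      |velocity s f z j| ≤ D * (eLpNorm f 2 volume).toReal := by
    intro f g h z β hβ j v hv1 hv
    have hf : MemLp f 2 volume := ⟨h.continuous.aestronglyMeasurable, by
      rw [h.eLpNorm_eq]; exact h.memLp.eLpNorm_lt_top⟩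
    set d : Plane → ℝ := fun x => f (z - x) - f (z + x)
    have hm1 : AEStronglyMeasurable (fun x => f (z - x)) (volume : Measure Plane) :=
      (h.continuous.comp (by fun_prop)).aestronglyMeasurable
    have hm2 : AEStronglyMeasurable (fun x => f (z + x)) (volume : Measure Plane) :=
      (h.continuous.comp (by fun_prop)).aestronglyMeasurable
    have hd : eLpNorm d 2 volume ≤ 2 * eLpNorm f 2 volume := by
      refine (eLpNorm_sub_le hm1 hm2 (by norm_num)).trans ?_
      rw [two_mul]
      refine add_le_add (le_of_eq ?_) (le_of_eq ?_)
      · exact eLpNorm_comp_measurePreserving hf.1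
          (Measure.measurePreserving_sub_left volume z)
      · exact eLpNorm_comp_measurePreserving hf.1 (measurePreserving_add_left volume z)
    have hWd := (eLpNorm_one_mul_le hW.1 (hm1.sub hm2)).trans (mul_le_mul_right hd _)
    have hfin : eLpNorm W 2 volume * (2 * eLpNorm f 2 volume) ≠ ∞ :=
      ENNReal.mul_ne_top hW.eLpNorm_ne_top
        (ENNReal.mul_ne_top ENNReal.ofNat_ne_top hf.eLpNorm_ne_top)
    have hWdi : Integrable fun x => W x * d x :=
      memLp_one_iff_integrable.1 ⟨hW.1.mul (hm1.sub hm2), hWd.trans_lt hfin.lt_top⟩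
    have hI : ∫ x, ‖W x * d x‖ ≤
        2 * (eLpNorm W 2 volume).toReal * (eLpNorm f 2 volume).toReal := by
      rw [integral_norm_eq_lintegral_enorm hWdi.1, ← eLpNorm_one_eq_lintegral_enorm]
      refine (ENNReal.toReal_mono hfin hWd).trans (le_of_eq ?_)
      rw [ENNReal.toReal_mul, ENNReal.toReal_mul]; simp; ring
    have hJ : ∀ t : ℝ, 0 < t → |∫ x, heatK v t x * d x| ≤
        m t * (2 * (eLpNorm W 2 volume).toReal * (eLpNorm f 2 volume).toReal) := by
      intro t ht
      calc |∫ x, heatK v t x * d x| ≤ ∫ x, m t * ‖W x * d x‖ := by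
            rw [← Real.norm_eq_abs]
            refine norm_integral_le_of_norm_le (hWdi.norm.const_mul _) (.of_forall fun x => ?_)
            have hWx : 0 ≤ W x := by positivity
            -- For |x| < r both z - x and z + x lie in the ball of constancy, so the difference
            -- vanishes whatever the value β is. Only |x| ≥ r needs the kernel bound.
            rcases lt_or_ge ‖x‖ r with hx | hx
            · have : d x = 0 := by
                simp only [d]
                rw [hβ _ (by simpa [Metric.mem_ball, dist_eq_norm] using hx),
                  hβ _ (by simpa [Metric.mem_ball, dist_eq_norm] using hx), sub_self]
              simp [this]
            · have := hm v t x ht hx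
              rw [hv1, one_mul] at this
              rw [norm_mul, norm_mul, Real.norm_of_nonneg hWx, ← mul_assoc, Real.norm_eq_abs]
              gcongr
        _ = m t * ∫ x, ‖W x * d x‖ := integral_const_mul _ _
        _ ≤ _ := by gcongr; exact hm0 t
    rw [velocity_eq_integral_heat hs hs1 h z hv, abs_mul, abs_of_pos (inv_pos.2 hΓ), hD, mul_assoc]
    gcongr
    rw [mul_assoc, ← integral_mul_const, ← Real.norm_eq_abs]
    refine norm_integral_le_of_norm_le (Integrable.mul_const hmi _)
      ((ae_restrict_mem measurableSet_Ioi).mono fun t (ht : 0 < t) => ?_)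
    rw [norm_mul, norm_mul, Real.norm_of_nonneg (by positivity : 0 ≤ t ^ (s - 1)), mul_assoc]
    gcongr ?_ * ?_
    have := hJ t ht
    rw [Real.norm_of_nonneg (by norm_num : (0 : ℝ) ≤ 2⁻¹), Real.norm_eq_abs]
    nlinarith
  refine ⟨(2 * D).toNNReal, fun f g h z β hβ => ?_⟩
  -- The two unit vectors are those whose inner products with ξ are the components of ξ^⊥.
  have h0 := key f g h z β hβ 0 (!₂[0, -1]) (by simp [EuclideanSpace.norm_eq])
    fun ξ => by simp [PiLp.inner_apply, perp]
  have h1 := key f g h z β hβ 1 (!₂[1, 0]) (by simp [EuclideanSpace.norm_eq])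
    fun ξ => by simp [PiLp.inner_apply, perp]
  rw [Real.coe_toNNReal _ (by positivity)]
  have h2 : ‖velocity s f z‖ ≤ |velocity s f z 0| + |velocity s f z 1| := by
    rw [EuclideanSpace.norm_eq]
    refine Real.sqrt_le_iff.2 ⟨by positivity, ?_⟩
    simp only [Fin.sum_univ_two, Real.norm_eq_abs]
    nlinarith [abs_nonneg (velocity s f z 0), abs_nonneg (velocity s f z 1)]
  linarith

open Filter Topology

/-! ### Constancy around the vortex -/

/-- The equation gives only time derivatives at fixed points. Joint C¹ regularity supplies the total
derivative needed to follow moving points. -/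
lemma IsStrongSolution.hasFDerivAt {s : ℝ} {k : ℕ} {T : ℝ} {θ : ℝ → Plane → ℝ} {z : ℝ → Plane}
    (hS : IsStrongSolution s k T θ z) {t : ℝ} (ht : t ∈ Ico 0 T) (x : Plane) :
    ∃ F : ℝ × Plane →L[ℝ] ℝ,
      HasFDerivWithinAt (fun p : ℝ × Plane => θ p.1 p.2) F (Ico 0 T ×ˢ univ) (t, x) ∧
      (∀ w, F (0, w) = inner ℝ w (gradient (θ t) x)) := by
  have h1 : HasFDerivWithinAt (fun p : ℝ × Plane => θ p.1 p.2) _ (Ico 0 T ×ˢ univ) (t, x) :=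
    ((hS.contDiffOn_scalar.differentiableOn one_ne_zero) (t, x) ⟨ht, mem_univ _⟩).hasFDerivWithinAt
  refine ⟨_, h1, fun w => ?_⟩
  have h2 : HasFDerivWithinAt (fun y : Plane => (t, y)) (ContinuousLinearMap.inr ℝ ℝ Plane) univ x :=
    (hasFDerivAt_prodMk_right t x).hasFDerivWithinAt
  have h3 := (h1.comp x h2 fun y _ => ⟨ht, mem_univ _⟩).hasFDerivAt univ_mem
  have h4 : fderiv ℝ (θ t) x = _ := h3.fderiv
  rw [real_inner_comm, gradient, InnerProductSpace.toDual_symm_apply, h4]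
  simp

/-- The derivative of the scalar along a curve that avoids the vortex. -/
lemma IsStrongSolution.hasDerivWithinAt_comp {s : ℝ} {k : ℕ} {T : ℝ} {θ : ℝ → Plane → ℝ}
    {z : ℝ → Plane} (hS : IsStrongSolution s k T θ z) {t : ℝ} (ht : t ∈ Ico 0 T) {c : ℝ → Plane}
    {c' : Plane} (hc : HasDerivWithinAt c c' (Ico 0 T) t) (hx : c t ≠ z t) :
    HasDerivWithinAt (fun τ => θ τ (c τ))
      (inner ℝ (c' - (velocity s (θ t) (c t) + kernel s (c t - z t))) (gradient (θ t) (c t)))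
      (Ico 0 T) t := by
  obtain ⟨F, hF, hFw⟩ := hS.hasFDerivAt ht (c t)
  have h1 : HasDerivWithinAt (fun τ => θ τ (c t)) (F (1, 0)) (Ico 0 T) t := by
    have h : HasDerivWithinAt (fun τ : ℝ => (τ, c t)) ((1 : ℝ), (0 : Plane)) (Ico 0 T) t :=
      (hasDerivWithinAt_id t _).prodMk (hasDerivWithinAt_const t _ _)
    exact hF.comp_hasDerivWithinAt t h fun τ hτ => mk_mem_prod hτ (mem_univ _)
  have h2 := (uniqueDiffOn_Ico 0 T t ht).eq_deriv _ h1 (hS.transport t ht _ hx)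
  have h : HasDerivWithinAt (fun τ : ℝ => (τ, c τ)) ((1 : ℝ), c') (Ico 0 T) t :=
    (hasDerivWithinAt_id t _).prodMk hc
  have h3 := hF.comp_hasDerivWithinAt t h fun τ hτ => mk_mem_prod hτ (mem_univ _)
  have e : F (1, c') =
      inner ℝ (c' - (velocity s (θ t) (c t) + kernel s (c t - z t))) (gradient (θ t) (c t)) := by
    rw [show ((1 : ℝ), c') = ((1 : ℝ), (0 : Plane)) + ((0 : ℝ), c') by simp, map_add, h2, hFw,
      inner_sub_left]
    ring
  rw [← e]
  exact h3

/-- The difference quotients from the left are nonnegative at a maximum from the left. The one-sided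
form covers a maximum at the final time. -/
lemma nonneg_of_hasDerivWithinAt_of_le {g : ℝ → ℝ} {g' a t : ℝ} (hat : a < t)
    (hg : HasDerivWithinAt g g' (Icc a t) t) (hmax : ∀ᶠ τ in 𝓝[<] t, g τ ≤ g t) : 0 ≤ g' := by
  rw [hasDerivWithinAt_iff_tendsto_slope, Icc_sdiff_right, nhdsWithin_Ico_eq_nhdsLT hat] at hg
  refine ge_of_tendsto hg ?_
  filter_upwards [hmax, self_mem_nhdsWithin] with τ h1 (h2 : τ < t)
  rw [slope_def_field]
  exact div_nonneg_of_nonpos (by linarith) (by linarith)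

/-- If the scalar is constant on a ball around the vortex, it stays constant around the vortex
on a ball whose radius shrinks at an exponential rate. -/
lemma IsStrongSolution.eq_const {s : ℝ} {k : ℕ} {T : ℝ} {θ : ℝ → Plane → ℝ}
    {z : ℝ → Plane} (hS : IsStrongSolution s k T θ z) {a b : ℝ} (ha : 0 ≤ a) (hb : b < T)
    {L r β : ℝ} (hL : 0 ≤ L)
    (hv : ∀ t ∈ Icc a b, ∀ x,
      ‖velocity s (θ t) x - velocity s (θ t) (z t)‖ ≤ L * ‖x - z t‖)
    (hβ : ∀ x ∈ Metric.ball (z a) r, θ a x = β) {t : ℝ} (ht : t ∈ Icc a b) {x : Plane}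
    (hx : ‖x - z t‖ * Real.exp (L * (t - a)) < r) : θ t x = β := by
  have hr : 0 < r := lt_of_le_of_lt (by positivity) hx
  have hsub : Icc a b ⊆ Ico 0 T := fun τ hτ => ⟨ha.trans hτ.1, hτ.2.trans_lt hb⟩
  -- This is the square of the shrinking factor, so that |y|² E = r² is the boundary of the
  -- shrinking ball.
  set E : ℝ → ℝ := fun τ => Real.exp (2 * L * (τ - a)) with hE
  have hE0 : ∀ τ, 0 < E τ := fun τ => Real.exp_pos _
  have hE1 : ∀ τ ∈ Icc a b, 1 ≤ E τ := fun τ hτ =>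
    Real.one_le_exp (mul_nonneg (by positivity) (by linarith [hτ.1]))
  have hE' : ∀ τ, HasDerivAt E (2 * L * E τ) τ := fun τ => by
    have h := (((hasDerivAt_id τ).sub_const a).const_mul (2 * L)).exp
    simp only [id, mul_one] at h
    rw [mul_comm (2 * L)]
    exact h
  -- A maximum principle replaces the construction of characteristics, whose field is singular at
  -- the vortex. Inside the shrinking ball Φ vanishes at the initial time; it also vanishes at the
  -- vortex, where no equation is available, and on the boundary of the ball. Along characteristics
  -- |y|²/E does not increase and |y|² E does not decrease.
  set Φ : ℝ × Plane → ℝ := fun p => (θ p.1 (z p.1 + p.2) - β) ^ 2 *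
    (‖p.2‖ ^ 2 * (E p.1)⁻¹ * (r ^ 2 - ‖p.2‖ ^ 2 * E p.1)) with hΦ
  set K : Set (ℝ × Plane) := (Icc a b ×ˢ Metric.closedBall 0 r) ∩
    {p | ‖p.2‖ ^ 2 * E p.1 ≤ r ^ 2} with hK
  have hEc : Continuous E := by fun_prop
  have hKc : IsCompact K := (isCompact_Icc.prod (isCompact_closedBall _ _)).inter_right
    (isClosed_le (by fun_prop) continuous_const)
  have hzc : ContinuousOn z (Icc a b) := hS.contDiffOn_vortex.continuousOn.mono hsub
  have hΦc : ContinuousOn Φ K := by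
    have h1 : ContinuousOn (fun p : ℝ × Plane => θ p.1 (z p.1 + p.2)) K :=
      hS.contDiffOn_scalar.continuousOn.comp
        (f := fun p : ℝ × Plane => (p.1, z p.1 + p.2))
        (continuousOn_fst.prodMk ((hzc.comp continuousOn_fst fun p hp => hp.1.1).add
          continuousOn_snd)) fun p hp => ⟨hsub hp.1.1, mem_univ _⟩
    have h2 : Continuous fun p : ℝ × Plane => (E p.1)⁻¹ :=
      (hEc.comp continuous_fst).inv₀ fun p => (hE0 _).ne'
    exact ((h1.sub continuousOn_const).pow 2).mul (Continuous.continuousOn (by fun_prop))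
  have main : ∀ p ∈ K, Φ p ≤ 0 := by
    by_contra! hcon
    obtain ⟨p₁, hp₁, hpos⟩ := hcon
    -- Subtracting ε(t - a) makes the final inequality strict. This ε costs at most half of Φ p₁, so
    -- Φ is still positive at the maximum.
    set ε : ℝ := Φ p₁ / (2 * (b - a + 1)) with hε
    have hab : a ≤ b := hp₁.1.1.1.trans hp₁.1.1.2
    have hε0 : 0 < ε := by positivity
    obtain ⟨⟨t₀, y₀⟩, hp₀, hmax⟩ := hKc.exists_isMaxOn ⟨p₁, hp₁⟩
      (f := fun p => Φ p - ε * (p.1 - a))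
      (hΦc.sub (Continuous.continuousOn (by fun_prop)))
    have h0 : 0 < Φ (t₀, y₀) := by
      have h1 := hmax hp₁
      simp only [mem_ofPred_eq] at h1
      have h2 : ε * (p₁.1 - a) < Φ p₁ := by
        have : ε * (p₁.1 - a) ≤ ε * (b - a + 1) := by
          gcongr; linarith [hp₁.1.1.2]
        have h3 : ε * (b - a + 1) = Φ p₁ / 2 := by
          rw [hε]; have : 0 < b - a + 1 := by linarith
          field_simp
        linarith
      have h3 : 0 ≤ ε * (t₀ - a) := mul_nonneg hε0.le (by linarith [hp₀.1.1.1])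
      linarith
    have ht₀ : t₀ ∈ Icc a b := hp₀.1.1
    have hEt := hE0 t₀
    have hy₀ : y₀ ≠ 0 := by rintro rfl; simp [hΦ] at h0
    have hn : 0 < ‖y₀‖ := norm_pos_iff.2 hy₀
    have hlt : ‖y₀‖ ^ 2 * E t₀ < r ^ 2 := by
      refine lt_of_le_of_ne hp₀.2 fun h => ?_
      simp [hΦ, h] at h0
    have hyr : ‖y₀‖ < r := by
      have := hE1 t₀ ht₀
      refine lt_of_pow_lt_pow_left₀ 2 hr.le (lt_of_le_of_lt ?_ hlt)
      exact le_mul_of_one_le_right (by positivity) this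
    have hat : a < t₀ := by
      refine lt_of_le_of_ne ht₀.1 fun h => ?_
      have : θ t₀ (z t₀ + y₀) = β := by
        rw [← h]; exact hβ _ (by simpa [Metric.mem_ball, dist_eq_norm] using hyr)
      simp [hΦ, this] at h0
    have hT₀ : t₀ ∈ Ico 0 T := hsub ht₀
    -- This is the velocity relative to the vortex at the maximum point. Following the straight line
    -- with this velocity is enough, since only first derivatives at t₀ are used.
    set w : Plane := velocity s (θ t₀) (z t₀ + y₀) + kernel s y₀ - velocity s (θ t₀) (z t₀) with hw
    set y : ℝ → Plane := fun τ => y₀ + (τ - t₀) • w with hy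
    have hyt : y t₀ = y₀ := by simp [hy]
    have hy' : HasDerivAt y w t₀ := by
      have := (((hasDerivAt_id t₀).sub_const t₀).smul_const w).const_add y₀
      rw [one_smul] at this
      exact this
    have hθ' : HasDerivWithinAt (fun τ => θ τ (z τ + y τ)) 0 (Ico 0 T) t₀ := by
      have h1 := hS.hasDerivWithinAt_comp hT₀ ((hS.vortex t₀ hT₀).add hy'.hasDerivWithinAt)
        (by simp [hyt, hy₀])
      have e : velocity s (θ t₀) (z t₀) + w -
          (velocity s (θ t₀) ((z + y) t₀) + kernel s ((z + y) t₀ - z t₀)) = 0 := by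
        rw [Pi.add_apply, hyt, add_sub_cancel_left, hw]; abel
      rw [e, inner_zero_left] at h1
      exact h1
    set q : ℝ → ℝ := fun τ => ‖y τ‖ ^ 2 with hq
    have hq' : HasDerivAt q (2 * inner ℝ y₀ w) t₀ := by
      have := hy'.norm_sq
      rwa [hyt] at this
    have hqt : q t₀ = ‖y₀‖ ^ 2 := by simp [hq, hyt]
    have hqb : |2 * inner ℝ y₀ w| ≤ 2 * L * ‖y₀‖ ^ 2 := by
      -- The kernel is orthogonal to y₀, so the singular field does not change the distance to the
      -- vortex.
      have h1 : inner ℝ y₀ w =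
          inner ℝ y₀ (velocity s (θ t₀) (z t₀ + y₀) - velocity s (θ t₀) (z t₀)) := by
        rw [hw, add_sub_right_comm, inner_add_right, kernel, inner_smul_right,
          real_inner_comm (perp y₀), inner_perp_self, mul_zero, add_zero]
      have h2 := hv t₀ ht₀ (z t₀ + y₀)
      rw [add_sub_cancel_left] at h2
      rw [h1, abs_mul, abs_of_pos two_pos, mul_assoc, pow_two]
      refine mul_le_mul_of_nonneg_left ?_ two_pos.le
      refine (abs_real_inner_le_norm _ _).trans ?_
      calc _ ≤ ‖y₀‖ * (L * ‖y₀‖) := by gcongr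
        _ = _ := by ring
    obtain ⟨hq1, hq2⟩ := abs_le.1 hqb
    set g : ℝ → ℝ := fun τ => (θ τ (z τ + y τ) - β) ^ 2 *
      (q τ * (E τ)⁻¹ * (r ^ 2 - q τ * E τ)) - ε * (τ - a) with hg
    have hg' := ((((hθ'.mono (s := Icc a t₀) fun τ hτ =>
      ⟨ha.trans hτ.1, (hτ.2.trans ht₀.2).trans_lt hb⟩).sub_const β).pow 2).mul
      ((hq'.mul ((hE' t₀).inv hEt.ne')).mul
        ((hq'.mul (hE' t₀)).const_sub (r ^ 2))).hasDerivWithinAt).sub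
      ((((hasDerivAt_id t₀).sub_const a).const_mul ε).hasDerivWithinAt)
    have hle : ∀ᶠ τ in 𝓝[<] t₀, g τ ≤ g t₀ := by
      have hyc : ContinuousAt y t₀ := hy'.continuousAt
      have e1 : ∀ᶠ τ in 𝓝[<] t₀, ‖y τ‖ < r :=
        (hyc.norm.eventually_lt continuousAt_const (by rwa [hyt])).filter_mono nhdsWithin_le_nhds
      have e2 : ∀ᶠ τ in 𝓝[<] t₀, q τ * E τ < r ^ 2 :=
        ((hq'.continuousAt.mul hEc.continuousAt).eventually_lt continuousAt_const
          (by simpa [hqt] using hlt)).filter_mono nhdsWithin_le_nhds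
      filter_upwards [e1, e2, Ioo_mem_nhdsLT hat] with τ h1 h2 h3
      have h4 : (τ, y τ) ∈ K := ⟨⟨⟨h3.1.le, h3.2.le.trans ht₀.2⟩, by simpa using h1.le⟩, h2.le⟩
      have h5 := hmax h4
      simp only [mem_ofPred_eq, hΦ] at h5
      simp only [hg, hq, hyt]
      exact h5
    have hnn := nonneg_of_hasDerivWithinAt_of_le hat hg' hle
    simp only [mul_zero, zero_mul, zero_add, mul_one, hyt, hqt, Pi.mul_apply, Pi.pow_apply,
      Pi.inv_apply] at hnn
    have hsq : 0 ≤ (θ t₀ (z t₀ + y₀) - β) ^ 2 := sq_nonneg _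
    -- Both monotonicities of the barrier factors enter here. The derivative of g at t₀ is then at
    -- most -ε, contrary to the maximum.
    have key : (2 * inner ℝ y₀ w * (E t₀)⁻¹ + ‖y₀‖ ^ 2 * (-(2 * L * E t₀) / E t₀ ^ 2)) *
        (r ^ 2 - ‖y₀‖ ^ 2 * E t₀) + ‖y₀‖ ^ 2 * (E t₀)⁻¹ *
        (-(2 * inner ℝ y₀ w * E t₀ + ‖y₀‖ ^ 2 * (2 * L * E t₀))) ≤ 0 := by
      have k1 : (2 * inner ℝ y₀ w * (E t₀)⁻¹ + ‖y₀‖ ^ 2 * (-(2 * L * E t₀) / E t₀ ^ 2)) =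
          (2 * inner ℝ y₀ w - 2 * L * ‖y₀‖ ^ 2) * (E t₀)⁻¹ := by field_simp; ring
      have k2 : ‖y₀‖ ^ 2 * (E t₀)⁻¹ *
        (-(2 * inner ℝ y₀ w * E t₀ + ‖y₀‖ ^ 2 * (2 * L * E t₀))) =
        -(‖y₀‖ ^ 2 * (2 * inner ℝ y₀ w + 2 * L * ‖y₀‖ ^ 2)) := by field_simp
      rw [k1, k2]
      have k3 : (2 * inner ℝ y₀ w - 2 * L * ‖y₀‖ ^ 2) * (E t₀)⁻¹ * (r ^ 2 - ‖y₀‖ ^ 2 * E t₀) ≤ 0 :=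
        mul_nonpos_of_nonpos_of_nonneg (mul_nonpos_of_nonpos_of_nonneg (by linarith)
          (inv_pos.2 hEt).le) (by linarith)
      have k4 : 0 ≤ ‖y₀‖ ^ 2 * (2 * inner ℝ y₀ w + 2 * L * ‖y₀‖ ^ 2) :=
        mul_nonneg (by positivity) (by linarith)
      linarith
    have := mul_nonpos_of_nonneg_of_nonpos hsq key
    linarith
  have off : ∀ y : Plane, y ≠ 0 → ‖y‖ * Real.exp (L * (t - a)) < r → θ t (z t + y) = β := by
    intro y hy0 hyr
    have hn : 0 < ‖y‖ := norm_pos_iff.2 hy0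
    have hEe : E t = Real.exp (L * (t - a)) ^ 2 := by
      rw [hE, ← Real.exp_nat_mul]; push_cast; ring_nf
    have h1 : ‖y‖ ^ 2 * E t < r ^ 2 := by
      rw [hEe, ← mul_pow]; exact pow_lt_pow_left₀ hyr (by positivity) two_ne_zero
    have h2 : ‖y‖ ≤ r := by
      refine le_of_pow_le_pow_left₀ two_ne_zero hr.le (le_trans ?_ h1.le)
      exact le_mul_of_one_le_right (by positivity) (hE1 t ht)
    have h3 := main (t, y) ⟨⟨ht, by simpa using h2⟩, h1.le⟩
    have h4 : 0 < ‖y‖ ^ 2 * (E t)⁻¹ * (r ^ 2 - ‖y‖ ^ 2 * E t) :=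
      mul_pos (mul_pos (by positivity) (inv_pos.2 (hE0 t))) (by linarith)
    have h5 : (θ t (z t + y) - β) ^ 2 ≤ 0 := nonpos_of_mul_nonpos_left h3 h4
    have := pow_eq_zero_iff two_ne_zero |>.1 (le_antisymm h5 (sq_nonneg _))
    linarith
  -- The barrier says nothing at the vortex itself; the value there follows by continuity.
  by_cases hxz : x = z t
  · subst hxz
    have hcont : Continuous (θ t) := by
      have := hS.contDiffOn_scalar.continuousOn.comp (f := fun x : Plane => (t, x))
        (s := univ) (Continuous.continuousOn (by fun_prop)) fun x _ => ⟨hsub ht, mem_univ _⟩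
      exact continuousOn_univ.1 this
    have h1 : Tendsto (fun x => θ t x) (𝓝[≠] (z t)) (𝓝 (θ t (z t))) :=
      hcont.continuousAt.tendsto.mono_left nhdsWithin_le_nhds
    refine tendsto_nhds_unique h1 (tendsto_const_nhds.congr' ?_)
    have h2 : ∀ᶠ x in 𝓝[≠] (z t), ‖x - z t‖ * Real.exp (L * (t - a)) < r := by
      have : Continuous fun x => ‖x - z t‖ * Real.exp (L * (t - a)) := by fun_prop
      exact (this.continuousAt.eventually_lt continuousAt_const hx).filter_mono nhdsWithin_le_nhds
    filter_upwards [h2, self_mem_nhdsWithin] with x h3 h4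
    have := off (x - z t) (sub_ne_zero.2 h4) h3
    rw [add_sub_cancel] at this
    exact this.symm
  · have := off (x - z t) (sub_ne_zero.2 hxz) hx
    rwa [add_sub_cancel] at this

/-! ### Energy identities -/

lemma memLp_weight_mul {w : Plane → ℝ} (hw : Continuous w) {C : ℝ} (hC : ∀ ξ, |w ξ| ≤ C) (f : L2) :
    MemLp (fun ξ => (w ξ : ℂ) * f ξ) 2 volume :=
  (Lp.memLp f).of_le_mul (c := C)
    ((Complex.continuous_ofReal.comp hw).aestronglyMeasurable.mul (Lp.memLp f).1)
    (.of_forall fun ξ => by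
      rw [norm_mul, Complex.norm_real]; exact mul_le_mul_of_nonneg_right (hC ξ) (norm_nonneg _))

/-- Multiplication by a bounded continuous weight. -/
noncomputable def mulCLM (w : Plane → ℝ) (hw : Continuous w) (C : ℝ) (hC : ∀ ξ, |w ξ| ≤ C) :
    L2 →L[ℂ] L2 :=
  LinearMap.mkContinuous
    { toFun := fun f => (memLp_weight_mul hw hC f).toLp _
      map_add' := fun f g => by
        rw [← MemLp.toLp_add]
        refine MemLp.toLp_congr _ _ ?_
        filter_upwards [Lp.coeFn_add f g] with ξ h
        rw [h]; simp [mul_add]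
      map_smul' := fun c f => by
        rw [RingHom.id_apply, ← MemLp.toLp_const_smul]
        refine MemLp.toLp_congr _ _ ?_
        filter_upwards [Lp.coeFn_smul c f] with ξ h
        rw [h]; simp [mul_left_comm] } C
    fun f => by
      refine Lp.norm_le_mul_norm_of_ae_le_mul ?_
      filter_upwards [(memLp_weight_mul hw hC f).coeFn_toLp] with ξ h
      simp only [LinearMap.coe_mk, AddHom.coe_mk, h]
      rw [norm_mul, Complex.norm_real]
      exact mul_le_mul_of_nonneg_right (hC ξ) (norm_nonneg _)

lemma mulCLM_ae_eq {w : Plane → ℝ} (hw : Continuous w) {C : ℝ} (hC : ∀ ξ, |w ξ| ≤ C) (f : L2) :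
    mulCLM w hw C hC f =ᵐ[volume] fun ξ => (w ξ : ℂ) * f ξ :=
  (memLp_weight_mul hw hC f).coeFn_toLp

open Classical in
/-- The class in `L²` of a function, `0` if it is not square integrable. -/
noncomputable def toL2 (f : Plane → ℂ) : L2 := if h : MemLp f 2 volume then h.toLp f else 0

lemma toL2_of_memLp {f : Plane → ℂ} (h : MemLp f 2 volume) : toL2 f = h.toLp f := dif_pos h

/-- The curve `f` has the time derivative `F` on `[a, b]`; `g` and `G` are the Fourier sides. -/
structure Evol (a b : ℝ) (f F : ℝ → Plane → ℝ) (g G : ℝ → Plane → ℂ) (C : ℝ) : Prop where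
  rep : ∀ t ∈ Icc a b, Rep (f t) (g t)
  deriv : ∀ t ∈ Icc a b, ∀ x, HasDerivWithinAt (fun τ => f τ x) (F t x) (Icc a b) t
  integrable : ∀ t ∈ Icc a b, Integrable (G t)
  memLp : ∀ t ∈ Icc a b, MemLp (fun x => (F t x : ℂ)) 2 volume
  eq : ∀ t ∈ Icc a b, ∀ x, (F t x : ℂ) = (𝓕⁻ (G t)) x
  bound : ∀ t ∈ Icc a b, ∀ x, |F t x| ≤ C
  bound_two : ∀ t ∈ Icc a b, eLpNorm (F t) 2 volume ≤ ENNReal.ofReal C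

namespace Evol

variable {a b C : ℝ} {f F : ℝ → Plane → ℝ} {g G : ℝ → Plane → ℂ}

lemma ae_eq_deriv (h : Evol a b f F g G C) {t : ℝ} (ht : t ∈ Icc a b) :
    (𝓕 (toL2 fun x => (F t x : ℂ)) : L2) =ᵐ[volume] G t := by
  rw [toL2_of_memLp (h.memLp t ht)]
  exact fourier_toLp_of_fourierInv (h.integrable t ht) _ (.of_forall fun x => h.eq t ht x)

lemma ae_eq_self (h : Evol a b f F g G C) {t : ℝ} (ht : t ∈ Icc a b) :
    (𝓕 (toL2 fun x => (f t x : ℂ)) : L2) =ᵐ[volume] g t := by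
  rw [toL2_of_memLp (h.rep t ht).memLp_ofReal]
  exact fourier_toLp_of_fourierInv (h.rep t ht).integrable _
    (.of_forall fun x => (h.rep t ht).eq x)

lemma sub {f' F' : ℝ → Plane → ℝ} {g' G' : ℝ → Plane → ℂ} {C' : ℝ} (h : Evol a b f F g G C)
    (h' : Evol a b f' F' g' G' C') (hC : 0 ≤ C) (hC' : 0 ≤ C') :
    Evol a b (fun t x => f t x - f' t x) (fun t x => F t x - F' t x)
      (fun t ξ => g t ξ - g' t ξ) (fun t ξ => G t ξ - G' t ξ) (C + C') := by
  refine ⟨fun t ht => (h.rep t ht).sub (h'.rep t ht),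
    fun t ht x => (h.deriv t ht x).sub (h'.deriv t ht x),
    fun t ht => (h.integrable t ht).sub (h'.integrable t ht), fun t ht => ?_, fun t ht x => ?_,
    fun t ht x => (abs_sub _ _).trans (add_le_add (h.bound t ht x) (h'.bound t ht x)),
    fun t ht => ?_⟩
  · simp only [Complex.ofReal_sub]
    exact (h.memLp t ht).sub (h'.memLp t ht)
  · rw [Complex.ofReal_sub, h.eq t ht, h'.eq t ht, fourierInv_eq_integral, fourierInv_eq_integral,
      fourierInv_eq_integral,
      ← integral_sub (integrable_fourier_exp_mul (h.integrable t ht) x)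
        (integrable_fourier_exp_mul (h'.integrable t ht) x)]
    exact integral_congr_ae (.of_forall fun ξ => by ring)
  · rw [ENNReal.ofReal_add hC hC']
    have m1 : AEStronglyMeasurable (F t) (volume : Measure Plane) := by
      simpa using Complex.continuous_re.comp_aestronglyMeasurable (h.memLp t ht).1
    have m2 : AEStronglyMeasurable (F' t) (volume : Measure Plane) := by
      simpa using Complex.continuous_re.comp_aestronglyMeasurable (h'.memLp t ht).1
    exact (eLpNorm_sub_le m1 m2 (by norm_num)).trans
      (add_le_add (h.bound_two t ht) (h'.bound_two t ht))

lemma inner_toL2 {φ : 𝓢(Plane, ℂ)} {q : Plane → ℝ} (hq : MemLp (fun x => (q x : ℂ)) 2 volume) :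
    inner ℂ (φ.toLp 2 : L2) (toL2 fun x => (q x : ℂ)) =
      ∫ x, (q x : ℂ) * (starRingEnd ℂ) (φ x) := by
  rw [toL2_of_memLp hq, L2.inner_def]
  refine integral_congr_ae ?_
  filter_upwards [hq.coeFn_toLp, φ.coeFn_toLp 2] with x h1 h2
  rw [h1, h2]; simp

/-- Against a Schwartz function one differentiates under the integral with the majorant C|φ|. The
uniform L² bound on F extends the result to all of L² by density. -/
lemma weak (h : Evol a b f F g G C) (hab : a < b) (hC : 0 ≤ C) :
    (∀ s ∈ Icc a b, ∀ t ∈ Icc a b,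
      ‖toL2 (fun x => (f t x : ℂ)) - toL2 (fun x => (f s x : ℂ))‖ ≤ C * |t - s|) ∧
    ∀ (φ : L2), ∀ t ∈ Ioo a b, HasDerivAt (fun t => inner ℂ φ (toL2 fun x => (f t x : ℂ)))
      (inner ℂ φ (toL2 fun x => (F t x : ℂ))) t := by
  set D : Set L2 := range fun φ : 𝓢(Plane, ℂ) => (φ.toLp 2 : L2) with hDdef
  have hD : Dense D := by
    have := SchwartzMap.denseRange_toLpCLM (E := Plane) (F := ℂ) (p := 2)
      (μ := volume) (by simp)
    exact this
  have hFn : ∀ t ∈ Ioo a b, ‖toL2 fun x => (F t x : ℂ)‖ ≤ C := fun t ht => by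
    have ht' := Ioo_subset_Icc_self ht
    rw [toL2_of_memLp (h.memLp t ht'), Lp.norm_toLp]
    refine ENNReal.toReal_le_of_le_ofReal hC (le_trans (le_of_eq ?_) (h.bound_two t ht'))
    exact eLpNorm_congr_norm_ae (.of_forall fun x => by simp)
  have hφi : ∀ φ : 𝓢(Plane, ℂ), Integrable fun x => ‖φ x‖ := fun φ => φ.integrable.norm
  have hmf : ∀ t ∈ Icc a b, ∀ φ : 𝓢(Plane, ℂ),
      Integrable fun x => (f t x : ℂ) * (starRingEnd ℂ) (φ x) := fun t ht φ =>
    MemLp.integrable_mul (p := 2) (q := 2) (h.rep t ht).memLp_ofReal (φ.memLp 2 volume).star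
  have hd : ∀ φ ∈ D, ∀ t ∈ Ioo a b, HasDerivAt (fun t => inner ℂ φ (toL2 fun x => (f t x : ℂ)))
      (inner ℂ φ (toL2 fun x => (F t x : ℂ))) t := by
    rintro _ ⟨φ, rfl⟩ t ht
    have hnhds : Ioo a b ∈ nhds t := Ioo_mem_nhds ht.1 ht.2
    have h1 := hasDerivAt_integral_of_dominated_loc_of_deriv_le (μ := (volume : Measure Plane))
      (F := fun τ x => (f τ x : ℂ) * (starRingEnd ℂ) (φ x))
      (F' := fun τ x => (F τ x : ℂ) * (starRingEnd ℂ) (φ x)) (bound := fun x => C * ‖φ x‖) hnhds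
      (Filter.eventually_of_mem hnhds fun τ hτ => (hmf τ (Ioo_subset_Icc_self hτ) φ).1)
      (hmf t (Ioo_subset_Icc_self ht) φ)
      ((h.memLp t (Ioo_subset_Icc_self ht)).1.mul
        (Complex.continuous_conj.comp φ.continuous).aestronglyMeasurable)
      (.of_forall fun x τ hτ => by
        rw [norm_mul, RCLike.norm_conj, Complex.norm_real]
        exact mul_le_mul_of_nonneg_right (h.bound τ (Ioo_subset_Icc_self hτ) x) (norm_nonneg _))
      ((hφi φ).const_mul C)
      (.of_forall fun x τ hτ => by
        have := (h.deriv τ (Ioo_subset_Icc_self hτ) x).hasDerivAt (Icc_mem_nhds hτ.1 hτ.2)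
        exact this.ofReal_comp.mul_const _)
    rw [inner_toL2 (h.memLp t (Ioo_subset_Icc_self ht))]
    refine h1.2.congr_of_eventuallyEq ?_
    filter_upwards [hnhds] with τ hτ
    exact inner_toL2 (h.rep τ (Ioo_subset_Icc_self hτ)).memLp_ofReal
  have hc : ∀ φ ∈ D, ContinuousOn (fun t => inner ℂ φ (toL2 fun x => (f t x : ℂ))) (Icc a b) := by
    rintro _ ⟨φ, rfl⟩
    have hl : LipschitzOnWith (Real.toNNReal (C * ∫ x, ‖φ x‖))
        (fun t => inner ℂ (φ.toLp 2 : L2) (toL2 fun x => (f t x : ℂ))) (Icc a b) := by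
      refine LipschitzOnWith.of_dist_le_mul fun t ht s hs => ?_
      have hI : 0 ≤ ∫ x, ‖φ x‖ := integral_nonneg fun _ => norm_nonneg _
      rw [Real.coe_toNNReal _ (by positivity), dist_eq_norm, dist_eq_norm,
        inner_toL2 (h.rep t ht).memLp_ofReal, inner_toL2 (h.rep s hs).memLp_ofReal,
        ← integral_sub (hmf t ht φ) (hmf s hs φ)]
      calc _ ≤ ∫ x, C * ‖t - s‖ * ‖φ x‖ := by
            refine norm_integral_le_of_norm_le ((hφi φ).const_mul _) (.of_forall fun x => ?_)
            rw [← sub_mul, norm_mul, RCLike.norm_conj, ← Complex.ofReal_sub, Complex.norm_real]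
            refine mul_le_mul_of_nonneg_right ?_ (norm_nonneg _)
            exact (convex_Icc a b).norm_image_sub_le_of_norm_hasDerivWithin_le
              (fun r hr => h.deriv r hr x) (fun r hr => h.bound r hr x) hs ht
        _ = _ := by rw [integral_const_mul]; ring
    exact hl.continuousOn
  have hlip := lipschitz_of_weak_deriv hD hab hC hc hd hFn
  exact ⟨hlip, fun φ t ht => weak_deriv_extend hD hC hlip hd hFn φ ht⟩

/-- The energy identity on the Fourier side. -/
lemma energy (h : Evol a b f F g G C) (hab : a < b) (hC : 0 ≤ C) {w : Plane → ℝ} (hw : Weight w) :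
    ContinuousOn (fun t => (eLpNorm (fun ξ => (w ξ : ℂ) * g t ξ) 2 volume).toReal ^ 2) (Icc a b) ∧
    ∀ t ∈ Ioo a b, HasDerivAt
      (fun t => (eLpNorm (fun ξ => (w ξ : ℂ) * g t ξ) 2 volume).toReal ^ 2)
      (2 * (∫ ξ, (starRingEnd ℂ) ((w ξ : ℂ) * g t ξ) * ((w ξ : ℂ) * G t ξ)).re) t := by
  obtain ⟨B, hB⟩ := hw.bdd
  have hB' : ∀ ξ, |w ξ| ≤ B := fun ξ => by rw [abs_of_nonneg (hw.nonneg ξ)]; exact hB ξ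
  obtain ⟨hlip, hweak⟩ := h.weak hab hC
  -- The Fourier transform followed by a bounded weight is a bounded operator, so weak
  -- differentiability passes through it by means of the adjoint.
  set M : L2 →L[ℂ] L2 := (mulCLM w hw.cont B hB').comp
    (Lp.fourierTransformₗᵢ Plane ℂ).toContinuousLinearEquiv.toContinuousLinearMap with hM
  have hMeq : ∀ v : L2, M v = mulCLM w hw.cont B hB' (𝓕 v) := fun v => rfl
  set u : ℝ → L2 := fun t => M (toL2 fun x => (f t x : ℂ)) with hu
  set V : ℝ → L2 := fun t => M (toL2 fun x => (F t x : ℂ)) with hV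
  have hue : ∀ t ∈ Icc a b, u t =ᵐ[volume] fun ξ => (w ξ : ℂ) * g t ξ := fun t ht => by
    filter_upwards [mulCLM_ae_eq hw.cont hB' (𝓕 (toL2 fun x => (f t x : ℂ)) : L2),
      h.ae_eq_self ht] with ξ h1 h2
    rw [hu]; simp only [hMeq]; rw [h1, h2]
  have hVe : ∀ t ∈ Icc a b, V t =ᵐ[volume] fun ξ => (w ξ : ℂ) * G t ξ := fun t ht => by
    filter_upwards [mulCLM_ae_eq hw.cont hB' (𝓕 (toL2 fun x => (F t x : ℂ)) : L2),
      h.ae_eq_deriv ht] with ξ h1 h2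
    rw [hV]; simp only [hMeq]; rw [h1, h2]
  have hun : ∀ t ∈ Icc a b, (eLpNorm (fun ξ => (w ξ : ℂ) * g t ξ) 2 volume).toReal ^ 2 =
      ‖u t‖ ^ 2 := fun t ht => by
    rw [Lp.norm_def, eLpNorm_congr_ae (hue t ht)]
  have hul : ∀ s ∈ Icc a b, ∀ t ∈ Icc a b, ‖u t - u s‖ ≤ (‖M‖ * C) * |t - s| := by
    intro s hs t ht
    rw [hu]; simp only
    rw [← map_sub, mul_assoc]
    exact (M.le_opNorm _).trans (mul_le_mul_of_nonneg_left (hlip s hs t ht) (norm_nonneg _))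
  constructor
  · have : LipschitzOnWith (Real.toNNReal (‖M‖ * C)) u (Icc a b) :=
      LipschitzOnWith.of_dist_le_mul fun t ht s hs => by
        rw [Real.coe_toNNReal _ (by positivity), dist_eq_norm, Real.dist_eq]
        exact hul s hs t ht
    exact (this.continuousOn.norm.pow 2).congr hun
  · intro t ht
    have ht' := Ioo_subset_Icc_self ht
    have hw' : ∀ φ : L2, HasDerivAt (fun t => inner ℂ φ (u t)) (inner ℂ φ (V t)) t := fun φ => by
      have := hweak (ContinuousLinearMap.adjoint M φ) t ht
      simpa only [ContinuousLinearMap.adjoint_inner_left] using this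
    have h1 := hasDerivAt_norm_sq hul ht hw'
    have h2 : inner ℂ (u t) (V t) =
        ∫ ξ, (starRingEnd ℂ) ((w ξ : ℂ) * g t ξ) * ((w ξ : ℂ) * G t ξ) := by
      rw [L2.inner_def]
      refine integral_congr_ae ?_
      filter_upwards [hue t ht', hVe t ht'] with ξ h3 h4
      rw [h3, h4, RCLike.inner_apply, mul_comm]
    rw [← h2]
    refine h1.congr_of_eventuallyEq ?_
    filter_upwards [Icc_mem_nhds ht.1 ht.2] with τ hτ
    exact hun τ hτ

end Evol

/-! ### Strong solutions solve a regular transport equation -/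

lemma memLp_of_normH_ne_top {k : ℕ} {f : Plane → ℝ} (h : normH k f ≠ ∞) :
    MemLp (fun x => (f x : ℂ)) 2 (volume : Measure Plane) := by
  by_contra hn
  exact h (by unfold normH; rw [if_neg hn])

/-- From (1 + y)² ≤ 2(1 + y²) the two weights of order three differ by a factor √8 ≤ 3, and k ≥ 3 is
all that the comparison needs. -/
lemma sob_l2Fourier_le {k : ℕ} (hk : 4 ≤ k) (f : Plane → ℝ) :
    sob (l2Fourier f) ≤ 3 * normH k f := by
  by_cases hf : MemLp (fun x => (f x : ℂ)) 2 (volume : Measure Plane)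
  · unfold sob normH
    rw [if_pos hf, show (3 : ℝ≥0∞) = ENNReal.ofReal 3 by simp]
    refine eLpNorm_le_mul_eLpNorm_of_ae_le_mul (.of_forall fun ξ => ?_) 2
    set y := 2 * Real.pi * ‖ξ‖ with hy
    have hy0 : 0 ≤ y := by positivity
    have hb : br ξ = 1 + y := rfl
    rw [norm_mul, norm_mul, norm_norm, Complex.norm_real, hb, ← mul_assoc,
      Real.norm_of_nonneg (by positivity), Real.norm_of_nonneg (by positivity)]
    gcongr
    have h1 : (1 + y ^ 2) ^ ((3 : ℝ) / 2) ≤ (1 + y ^ 2) ^ ((k : ℝ) / 2) := by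
      refine Real.rpow_le_rpow_of_exponent_le (by nlinarith) ?_
      have : (4 : ℝ) ≤ k := by exact_mod_cast hk
      linarith
    refine le_trans ?_ (mul_le_mul_of_nonneg_left h1 (by norm_num))
    refine le_of_pow_le_pow_left₀ (n := 2) two_ne_zero (by positivity) ?_
    have h2 : ((1 + y ^ 2) ^ ((3 : ℝ) / 2)) ^ 2 = (1 + y ^ 2) ^ 3 := by
      rw [← Real.rpow_natCast, ← Real.rpow_mul (by positivity), ← Real.rpow_natCast]; norm_num
    rw [mul_pow, h2, ← pow_mul, mul_comm 3 2, pow_mul]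
    have h3 : (1 + y) ^ 2 ≤ 2 * (1 + y ^ 2) := by nlinarith [sq_nonneg (1 - y)]
    calc ((1 + y) ^ 2) ^ 3 ≤ (2 * (1 + y ^ 2)) ^ 3 := by gcongr
      _ = 8 * (1 + y ^ 2) ^ 3 := by ring
      _ ≤ _ := by gcongr; norm_num
  · unfold normH; rw [if_neg hf]; simp

lemma Rep.abs_gradient_le {f g} (h : Rep f g) (x : Plane) (j : Fin 2) :
    |gradient f x j| ≤ cbr * (sob g).toReal := by
  have h1 : |gradient f x j| = ‖(gradient f x j : ℂ)‖ := by simp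
  rw [h1, h.gradient_apply]
  refine (norm_fourierInv_le _ _).trans ?_
  have h2 : ∫ ξ, ‖ghat g j ξ‖ ≤ ∫ ξ, br ξ * ‖g ξ‖ :=
    integral_mono (h.integrable_ghat j).norm h.integrable_br (norm_ghat_le g j)
  refine h2.trans ?_
  have h3 : ∫ ξ, br ξ * ‖g ξ‖ = (eLpNorm (fun ξ => br ξ * ‖g ξ‖) 1 volume).toReal := by
    rw [eLpNorm_one_eq_lintegral_enorm, ← integral_norm_eq_lintegral_enorm h.integrable_br.1]
    refine integral_congr_ae (.of_forall fun ξ => ?_)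
    exact (Real.norm_of_nonneg (mul_nonneg (br_pos ξ).le (norm_nonneg _))).symm
  rw [h3]
  refine (ENNReal.toReal_mono (ENNReal.mul_ne_top ENNReal.coe_ne_top h.fin)
    (eLpNorm_one_br_le h.meas)).trans (le_of_eq ?_)
  rw [ENNReal.toReal_mul, ENNReal.coe_toReal]

lemma Rep.eLpNorm_inner_gradient_le {f g} (h : Rep f g) {v : Plane → Plane} {c : ℝ}
    (hv : ∀ x, ‖v x‖ ≤ c) :
    eLpNorm (fun x => inner ℝ (v x) (gradient f x)) 2 volume ≤
      ENNReal.ofReal c * (2 * sob g) := by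
  have hm : ∀ j, AEStronglyMeasurable (fun x => ‖(𝓕⁻ (ghat g j)) x‖) (volume : Measure Plane) :=
    fun j => (continuous_fourierInv (h.integrable_ghat j)).norm.aestronglyMeasurable
  have h1 : ∀ x, ‖inner ℝ (v x) (gradient f x)‖ ≤
      c * ‖‖(𝓕⁻ (ghat g 0)) x‖ + ‖(𝓕⁻ (ghat g 1)) x‖‖ := fun x => by
    have h0 : ∀ j, ‖(𝓕⁻ (ghat g j)) x‖ = |gradient f x j| := fun j => by
      rw [← h.gradient_apply]; simp
    rw [h0, h0, Real.norm_of_nonneg (by positivity : 0 ≤ |gradient f x 0| + |gradient f x 1|),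
      Real.norm_eq_abs, inner_eq]
    refine (abs_add_le _ _).trans ?_
    rw [abs_mul, abs_mul, mul_add]
    have := fun j => (norm_apply_le (v x) j).trans (hv x)
    gcongr <;> exact this _
  refine (eLpNorm_le_mul_eLpNorm_of_ae_le_mul (.of_forall h1) 2).trans ?_
  gcongr
  refine (eLpNorm_add_le (hm 0) (hm 1) (by norm_num)).trans ?_
  rw [two_mul]
  have h2 : ∀ j, eLpNorm (fun x => ‖(𝓕⁻ (ghat g j)) x‖) 2 volume ≤ sob g := fun j => by
    rw [eLpNorm_norm, (memLp_fourierInv (h.integrable_ghat j) (h.memLp_ghat j)).2]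
    exact eLpNorm_ghat_le g j
  exact add_le_add (h2 0) (h2 1)

/-- The size of the transporting field of a solution that is constant on a ball of radius `r`
around the vortex. -/
noncomputable def transportSize (s r : ℝ) (m : ℝ≥0) : ℝ≥0 := kvel s * m + (fsize (regHat s r)).toNNReal

/-- The transporting field, regularized near the vortex. -/
noncomputable def transportField (s r : ℝ) (f : Plane → ℝ) (z x : Plane) : Plane :=
  velocity s f x + regKernel s r (x - z)

/-- The Fourier side of the transporting field. -/
noncomputable def transportHat (s r : ℝ) (f : Plane → ℝ) (z : Plane) : Fin 2 → Plane → ℂ :=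
  velHat s (l2Fourier f) + shiftHat z (regHat s r)

section Transport

variable {s : ℝ} {k : ℕ} {T : ℝ} {θ : ℝ → Plane → ℝ} {z : ℝ → Plane}

lemma field_transport (hs : 1 / 2 ≤ s) (hs1 : s < 1) {r : ℝ} (hr : 0 < r) {f : Plane → ℝ}
    (hf : Rep f (l2Fourier f)) (z : Plane) :
    Field (transportField s r f z) (transportHat s r f z) :=
  (hf.field_velocity hs hs1).add ((field_regKernel hs1 hr).shift z)

lemma fsize_transportHat_le (hs : 1 / 2 ≤ s) (hs1 : s < 1) {r : ℝ} (hr : 0 < r) {f : Plane → ℝ}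
    (hf : Rep f (l2Fourier f)) (z : Plane) {m : ℝ≥0} (hm : sob (l2Fourier f) ≤ m) :
    fsize (transportHat s r f z) ≤ transportSize s r m := by
  refine (fsize_add_le (hf.field_velocity hs hs1).meas
    ((field_regKernel hs1 hr).shift z).meas).trans ?_
  rw [fsize_shiftHat, transportSize, ENNReal.coe_add,
    ENNReal.coe_toNNReal (field_regKernel hs1 hr).fin, ENNReal.coe_mul]
  gcongr
  exact (fsize_velHat_le hs hs1 hf.meas).trans (by gcongr)

lemma IsStrongSolution.continuous (hS : IsStrongSolution s k T θ z) {t : ℝ} (ht : t ∈ Ico 0 T) :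
    Continuous (θ t) := by
  have := hS.contDiffOn_scalar.continuousOn.comp (f := fun x : Plane => (t, x))
    (s := univ) (Continuous.continuousOn (by fun_prop)) fun x _ => ⟨ht, mem_univ _⟩
  exact continuousOn_univ.1 this

lemma IsStrongSolution.rep (hS : IsStrongSolution s k T θ z) (hk : 4 ≤ k) {t : ℝ}
    (ht : t ∈ Ico 0 T) : Rep (θ t) (l2Fourier (θ t)) := by
  obtain ⟨M, hM⟩ := hS.bounded
  have h1 : normH k (θ t) ≠ ∞ := ((hM t ht).trans_lt ENNReal.coe_lt_top).ne
  exact rep_l2Fourier (hS.continuous ht) (memLp_of_normH_ne_top h1)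
    ((sob_l2Fourier_le hk _).trans_lt (ENNReal.mul_lt_top (by simp) h1.lt_top)).ne

/-- The bound for the right-hand side of the transport equation. -/
noncomputable def transportBound (s r : ℝ) (m : ℝ≥0) : ℝ≥0 :=
  2 * transportSize s r m * (cbr + 1) * m

/-- The kernel and its regularization differ only where ∇θ vanishes, so the regular field produces
the same transport term, and the equation now holds at every point. -/
lemma IsStrongSolution.evol (hS : IsStrongSolution s k T θ z) (hs : 1 / 2 ≤ s) (hs1 : s < 1)
    (hk : 4 ≤ k) {a b r β : ℝ} (ha : 0 ≤ a) (hb : b < T) (hr : 0 < r) {m : ℝ≥0}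
    (hm : ∀ t ∈ Icc a b, sob (l2Fourier (θ t)) ≤ m)
    (hβ : ∀ t ∈ Icc a b, ∀ x ∈ Metric.ball (z t) r, θ t x = β) :
    Evol a b θ
      (fun t x => -inner ℝ (transportField s r (θ t) (z t) x) (gradient (θ t) x))
      (fun t => l2Fourier (θ t))
      (fun t ξ => -adv (transportHat s r (θ t) (z t)) (l2Fourier (θ t)) ξ)
      (transportBound s r m) := by
  have hsub : Icc a b ⊆ Ico 0 T := fun τ hτ => ⟨ha.trans hτ.1, hτ.2.trans_lt hb⟩
  have hrep := fun t (ht : t ∈ Icc a b) => hS.rep hk (hsub ht)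
  have hfield := fun t (ht : t ∈ Icc a b) => field_transport hs hs1 hr (hrep t ht) (z t)
  have hgrad : ∀ t ∈ Icc a b, ∀ x ∈ Metric.ball (z t) r, gradient (θ t) x = 0 := by
    intro t ht x hx
    have : θ t =ᶠ[nhds x] fun _ => β :=
      Filter.eventually_of_mem (Metric.isOpen_ball.mem_nhds hx) (hβ t ht)
    rw [gradient, this.fderiv_eq]; simp
  refine ⟨hrep, fun t ht x => ?_, fun t ht => ((hfield t ht).integrable_adv (hrep t ht)).neg,
    fun t ht => ?_, fun t ht x => ?_, fun t ht x => ?_, fun t ht => ?_⟩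
  -- At the vortex no equation is given. The time derivative there is obtained by differentiating
  -- θ(t, z(t)) = β, using that the gradient vanishes.
  · by_cases hx : x = z t
    · subst hx
      rw [hgrad t ht _ (Metric.mem_ball_self hr), inner_zero_right, neg_zero]
      obtain ⟨F, hF, hFw⟩ := hS.hasFDerivAt (hsub ht) (z t)
      rcases eq_or_ne a b with rfl | hab
      · obtain rfl : t = a := le_antisymm ht.2 ht.1
        rw [Icc_self, hasDerivWithinAt_iff_hasFDerivWithinAt]
        exact HasFDerivWithinAt.of_subsingleton subsingleton_singleton
      have hud := (uniqueDiffOn_Icc (lt_of_le_of_ne (ht.1.trans ht.2) hab)) t ht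
      have h1 : HasDerivWithinAt (fun τ => θ τ (z τ)) (F (1, velocity s (θ t) (z t)))
          (Icc a b) t := by
        have h : HasDerivWithinAt (fun τ : ℝ => (τ, z τ)) ((1 : ℝ), velocity s (θ t) (z t))
            (Icc a b) t := (hasDerivWithinAt_id t _).prodMk ((hS.vortex t (hsub ht)).mono hsub)
        exact hF.comp_hasDerivWithinAt t h fun τ hτ => mk_mem_prod (hsub hτ) (mem_univ _)
      have h2 : HasDerivWithinAt (fun τ => θ τ (z τ)) 0 (Icc a b) t :=
        (hasDerivWithinAt_const t _ β).congr (fun τ hτ => hβ τ hτ _ (Metric.mem_ball_self hr))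
          (hβ t ht _ (Metric.mem_ball_self hr))
      have h3 := hud.eq_deriv _ h1 h2
      have h4 : HasDerivWithinAt (fun τ => θ τ (z t)) (F (1, 0)) (Icc a b) t := by
        have h : HasDerivWithinAt (fun τ : ℝ => (τ, z t)) ((1 : ℝ), (0 : Plane)) (Icc a b) t :=
          (hasDerivWithinAt_id t _).prodMk (hasDerivWithinAt_const t _ _)
        exact hF.comp_hasDerivWithinAt t h fun τ hτ => mk_mem_prod (hsub hτ) (mem_univ _)
      rw [show ((1 : ℝ), velocity s (θ t) (z t)) =
        ((1 : ℝ), (0 : Plane)) + ((0 : ℝ), velocity s (θ t) (z t)) by simp, map_add, hFw,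
        hgrad t ht _ (Metric.mem_ball_self hr), inner_zero_right, add_zero] at h3
      rwa [h3] at h4
    · have h1 := (hS.transport t (hsub ht) x hx).mono hsub
      have e : inner ℝ (transportField s r (θ t) (z t) x) (gradient (θ t) x) =
          inner ℝ (velocity s (θ t) x + kernel s (x - z t)) (gradient (θ t) x) := by
        rcases lt_or_ge (dist x (z t)) r with hd | hd
        · rw [hgrad t ht x hd, inner_zero_right, inner_zero_right]
        · rw [transportField, regKernel_eq s hr (by rwa [← dist_eq_norm])]
      rwa [← e] at h1
  · simp only [Complex.ofReal_neg]
    exact ((hfield t ht).memLp_inner_gradient (hrep t ht)).1.neg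
  · have h1 := (hfield t ht).fourierInv_adv (hrep t ht) x
    rw [Complex.ofReal_neg, ← h1, fourierInv_eq_integral, fourierInv_eq_integral, ← integral_neg]
    exact integral_congr_ae (.of_forall fun ξ => by ring)
  · have h1 : ∀ j, |transportField s r (θ t) (z t) x j| ≤ transportSize s r m := fun j =>
      ((hfield t ht).abs_apply_le x j).trans (ENNReal.toReal_mono ENNReal.coe_ne_top
        (fsize_transportHat_le hs hs1 hr (hrep t ht) (z t) (hm t ht)))
    have h2 : ∀ j, |gradient (θ t) x j| ≤ cbr * m := fun j =>
      ((hrep t ht).abs_gradient_le x j).trans (by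
        gcongr; exact ENNReal.toReal_mono ENNReal.coe_ne_top (hm t ht))
    rw [abs_neg, inner_eq]
    refine (abs_add_le _ _).trans ?_
    rw [abs_mul, abs_mul]
    calc _ ≤ (transportSize s r m : ℝ) * (cbr * m) + transportSize s r m * (cbr * m) := by
          gcongr <;> first | exact h1 _ | exact h2 _
      _ ≤ _ := by
          unfold transportBound; push_cast
          have : 0 ≤ (transportSize s r m : ℝ) * m := by positivity
          nlinarith
  · have h1 := ((hfield t ht).memLp_inner_gradient (hrep t ht)).2
    rw [ENNReal.ofReal_coe_nnreal]
    have h2 : eLpNorm (fun x => -inner ℝ (transportField s r (θ t) (z t) x) (gradient (θ t) x))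
        2 volume = eLpNorm (fun x => ((inner ℝ (transportField s r (θ t) (z t) x)
          (gradient (θ t) x) : ℝ) : ℂ)) 2 volume :=
      eLpNorm_congr_norm_ae (.of_forall fun x => by simp)
    rw [h2]
    refine h1.trans ?_
    unfold transportBound
    push_cast
    have h3 := fsize_transportHat_le hs hs1 hr (hrep t ht) (z t) (hm t ht)
    have h4 := hm t ht
    calc _ ≤ 2 * (transportSize s r m : ℝ≥0∞) * m := by gcongr
      _ ≤ 2 * (transportSize s r m : ℝ≥0∞) * ((cbr + 1) * m) := by
          gcongr; exact le_mul_of_one_le_left bot_le le_add_self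
      _ = _ := by ring

/-! ### Growth of the third order Sobolev norm. -/

/-- Fatou's lemma: at each frequency the truncated weights are eventually equal to the full one. -/
lemma sob_le_of_cutWeight {g : Plane → ℂ} (hg : AEStronglyMeasurable g) {K : ℝ≥0∞}
    (h : ∀ n, eLpNorm (fun ξ => (cutWeight n ξ : ℂ) * g ξ) 2 volume ≤ K) : sob g ≤ K := by
  have h1 : sob g = eLpNorm (fun ξ => ((br ξ ^ 3 : ℝ) : ℂ) * g ξ) 2 volume :=
    eLpNorm_congr_norm_ae (.of_forall fun ξ => by simp)
  rw [h1]
  refine (Lp.eLpNorm_lim_le_liminf_eLpNorm (f := fun n ξ => (cutWeight n ξ : ℂ) * g ξ)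
    (fun n => (Complex.continuous_ofReal.comp (weight_cutWeight n).cont).aestronglyMeasurable.mul hg)
    _ (.of_forall fun ξ => ?_)).trans ?_
  · refine tendsto_const_nhds.congr' ?_
    filter_upwards [Filter.eventually_ge_atTop ⌈br ξ⌉₊] with n hn
    rw [cutWeight, min_eq_left ((Nat.le_ceil _).trans (by exact_mod_cast hn))]
  · exact Filter.liminf_le_of_le (by isBoundedDefault) fun b hb => by
      obtain ⟨n, hn⟩ := hb.exists
      exact hn.trans (h n)

/-- The growth of the Sobolev norm of a solution that is constant near the vortex. -/
lemma IsStrongSolution.sob_le (hS : IsStrongSolution s k T θ z) (hs : 1 / 2 ≤ s) (hs1 : s < 1)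
    (hk : 4 ≤ k) {a b r β : ℝ} (ha : 0 ≤ a) (hb : b < T) (hr : 0 < r) {m n : ℝ≥0}
    (hm : ∀ t ∈ Icc a b, sob (l2Fourier (θ t)) ≤ m)
    (hβ : ∀ t ∈ Icc a b, ∀ x ∈ Metric.ball (z t) r, θ t x = β)
    (hn : sob (l2Fourier (θ a)) ≤ n) {t : ℝ} (ht : t ∈ Icc a b) :
    (sob (l2Fourier (θ t))).toReal ^ 2 ≤
      n ^ 2 + 2 * (kcomm * transportSize s r m * m ^ 2) * (t - a) := by
  have hsub : Icc a b ⊆ Ico 0 T := fun τ hτ => ⟨ha.trans hτ.1, hτ.2.trans_lt hb⟩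
  have haI : a ∈ Icc a b := left_mem_Icc.2 (ht.1.trans ht.2)
  rcases eq_or_lt_of_le ht.1 with rfl | hat
  · rw [sub_self, mul_zero, add_zero]
    gcongr
    exact ENNReal.toReal_mono ENNReal.coe_ne_top hn
  have hab : a < b := hat.trans_le ht.2
  have hev := hS.evol hs hs1 hk ha hb hr hm hβ
  set K : ℝ := 2 * (kcomm * transportSize s r m * m ^ 2) with hK
  have hK0 : 0 ≤ K := by positivity
  have hcut : ∀ N, ∀ τ ∈ Icc a b,
      eLpNorm (fun ξ => (cutWeight N ξ : ℂ) * l2Fourier (θ τ) ξ) 2 volume ≤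
        sob (l2Fourier (θ τ)) := fun N τ _ => by
    refine le_trans (le_of_eq ?_) (eLpNorm_le_sob (w := cutWeight N) fun ξ => ?_)
    · exact eLpNorm_congr_norm_ae (.of_forall fun ξ => by simp)
    · rw [abs_of_nonneg ((weight_cutWeight N).nonneg ξ)]; exact (weight_cutWeight N).le ξ
  -- The energy identity requires a bounded weight. The resulting bound does not depend on N, so the
  -- truncation can be removed afterwards.
  have key : ∀ N, eLpNorm (fun ξ => (cutWeight N ξ : ℂ) * l2Fourier (θ t) ξ) 2 volume ≤
      ENNReal.ofReal (Real.sqrt (n ^ 2 + K * (t - a))) := by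
    intro N
    obtain ⟨hc, hd⟩ := hev.energy hab (NNReal.coe_nonneg _) (weight_cutWeight N)
    set e : ℝ → ℝ := fun t =>
      (eLpNorm (fun ξ => (cutWeight N ξ : ℂ) * l2Fourier (θ t) ξ) 2 volume).toReal ^ 2 with he
    have hderiv : ∀ τ ∈ interior (Icc a b), deriv e τ ≤ K := by
      intro τ hτ
      rw [interior_Icc] at hτ
      have hτ' := Ioo_subset_Icc_self hτ
      rw [(hd τ hτ).deriv]
      have h1 := (field_transport hs hs1 hr (hev.rep τ hτ') (z τ)).abs_re_integral_adv_le
        (hev.rep τ hτ') (weight_cutWeight N)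
      simp only [mul_neg, integral_neg, Complex.neg_re]
      have h2 : (kcomm * eLpNorm (fun ξ => (cutWeight N ξ : ℂ) * l2Fourier (θ τ) ξ) 2 volume *
          fsize (transportHat s r (θ τ) (z τ)) * sob (l2Fourier (θ τ))).toReal ≤
          kcomm * transportSize s r m * m ^ 2 := by
        have h3 : kcomm * eLpNorm (fun ξ => (cutWeight N ξ : ℂ) * l2Fourier (θ τ) ξ) 2 volume *
          fsize (transportHat s r (θ τ) (z τ)) * sob (l2Fourier (θ τ)) ≤
          ((kcomm * transportSize s r m * m ^ 2 : ℝ≥0) : ℝ≥0∞) := by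
          have h4 := fsize_transportHat_le hs hs1 hr (hev.rep τ hτ') (z τ) (hm τ hτ')
          have h5 := hm τ hτ'
          have h6 := (hcut N τ hτ').trans h5
          calc _ ≤ (kcomm : ℝ≥0∞) * m * transportSize s r m * m := by gcongr
            _ = _ := by push_cast; ring
        refine (ENNReal.toReal_mono ENNReal.coe_ne_top h3).trans (le_of_eq ?_)
        simp
      have h3 := (abs_le.1 (h1.trans h2)).1
      linarith
    have h4 := (convex_Icc a b).image_sub_le_mul_sub_of_deriv_le hc
      (fun τ hτ => by
        rw [interior_Icc] at hτ; exact (hd τ hτ).differentiableAt.differentiableWithinAt)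
      hderiv a haI t ht ht.1
    have h5 : e a ≤ n ^ 2 := by
      simp only [he]
      gcongr
      exact ENNReal.toReal_mono ENNReal.coe_ne_top ((hcut N a haI).trans hn)
    have h6 : e t ≤ n ^ 2 + K * (t - a) := by linarith
    have hfin : eLpNorm (fun ξ => (cutWeight N ξ : ℂ) * l2Fourier (θ t) ξ) 2 volume ≠ ∞ :=
      (((hcut N t ht).trans (hm t ht)).trans_lt ENNReal.coe_lt_top).ne
    rw [← ENNReal.ofReal_toReal hfin]
    exact ENNReal.ofReal_le_ofReal (Real.le_sqrt_of_sq_le h6)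
  have h1 := sob_le_of_cutWeight (hev.rep t ht).meas key
  have h2 := ENNReal.toReal_mono ENNReal.ofReal_ne_top h1
  rw [ENNReal.toReal_ofReal (Real.sqrt_nonneg _)] at h2
  have h3 : 0 ≤ n ^ 2 + K * (t - a) := by
    have : 0 ≤ t - a := by linarith
    positivity
  calc _ ≤ Real.sqrt (n ^ 2 + K * (t - a)) ^ 2 := by gcongr
    _ = _ := Real.sq_sqrt h3

end Transport

/-! ### Uniform bounds on a short time interval -/

/-- The bound 4/3 lets a ball of constancy keep three quarters of its radius; the bound 1 lets the
squared Sobolev norm grow by at most one. -/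
lemma exists_small_time {T : ℝ} (hT : 0 < T) (L K : ℝ) :
    ∃ δ, 0 < δ ∧ δ < T ∧ Real.exp (L * δ) ≤ 4 / 3 ∧ K * δ ≤ 1 := by
  have h1 : ∀ᶠ δ in nhds (0 : ℝ), Real.exp (L * δ) < 4 / 3 :=
    (Continuous.continuousAt (by fun_prop)).eventually_lt continuousAt_const (by simp; norm_num)
  have h2 : ∀ᶠ δ in nhds (0 : ℝ), K * δ < 1 :=
    (Continuous.continuousAt (by fun_prop)).eventually_lt continuousAt_const (by simp)
  obtain ⟨δ, ⟨h3, h4⟩, h5⟩ := (((h1.and h2).filter_mono nhdsWithin_le_nhds).and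
    (Ioo_mem_nhdsGT hT)).exists
  exact ⟨δ, h5.1, h5.2, h3.le, h4.le⟩

section Uniform

variable {s : ℝ} {k : ℕ} {T : ℝ} {θ : ℝ → Plane → ℝ} {z : ℝ → Plane}

lemma toReal_fsize_velHat_le (hs : 1 / 2 ≤ s) (hs1 : s < 1) {f g} (h : Rep f g) {m : ℝ≥0}
    (hm : sob g ≤ m) : (fsize (velHat s g)).toReal ≤ kvel s * m := by
  have h1 : fsize (velHat s g) ≤ ((kvel s * m : ℝ≥0) : ℝ≥0∞) := by
    rw [ENNReal.coe_mul]
    exact (fsize_velHat_le hs hs1 h.meas).trans (by gcongr)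
  exact (ENNReal.toReal_mono ENNReal.coe_ne_top h1).trans (le_of_eq (by simp))

lemma norm_velocity_sub_le (hs : 1 / 2 ≤ s) (hs1 : s < 1) {f g} (h : Rep f g) {m : ℝ≥0}
    (hm : sob g ≤ m) (x y : Plane) :
    ‖velocity s f x - velocity s f y‖ ≤ 2 * (kvel s * m) * ‖x - y‖ := by
  refine ((h.field_velocity hs hs1).norm_sub_le x y).trans ?_
  gcongr
  exact toReal_fsize_velHat_le hs hs1 h hm

lemma norm_velocity_le (hs : 1 / 2 ≤ s) (hs1 : s < 1) {f g} (h : Rep f g) {m : ℝ≥0}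
    (hm : sob g ≤ m) (x : Plane) : ‖velocity s f x‖ ≤ 2 * (kvel s * m) := by
  have h1 := fun j => ((h.field_velocity hs hs1).abs_apply_le x j).trans
    (toReal_fsize_velHat_le hs hs1 h hm)
  have h2 : 0 ≤ (kvel s * m : ℝ) := by positivity
  rw [EuclideanSpace.norm_eq]
  refine Real.sqrt_le_iff.2 ⟨by positivity, ?_⟩
  simp only [Fin.sum_univ_two, Real.norm_eq_abs]
  have h3 := pow_le_pow_left₀ (abs_nonneg _) (h1 0) 2
  have h4 := pow_le_pow_left₀ (abs_nonneg _) (h1 1) 2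
  nlinarith

lemma IsStrongSolution.eq_const_of_sob_le (hS : IsStrongSolution s k T θ z) (hs : 1 / 2 ≤ s)
    (hs1 : s < 1) (hk : 4 ≤ k) {a b : ℝ} (ha : 0 ≤ a) (hb : b < T) {m : ℝ≥0} {r β δ : ℝ}
    (hm : ∀ t ∈ Icc a b, sob (l2Fourier (θ t)) ≤ m) (hδ : b - a ≤ δ)
    (hexp : Real.exp (2 * (kvel s * m) * δ) ≤ 4 / 3)
    (hβ : ∀ x ∈ Metric.ball (z a) r, θ a x = β) :
    ∀ t ∈ Icc a b, ∀ x ∈ Metric.ball (z t) (3 / 4 * r), θ t x = β := by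
  intro t ht x hx
  refine hS.eq_const ha hb (L := 2 * (kvel s * m)) (by positivity) (fun t ht x =>
    norm_velocity_sub_le hs hs1 (hS.rep hk ⟨ha.trans ht.1, ht.2.trans_lt hb⟩) (hm t ht) x _)
    hβ ht ?_
  rw [Metric.mem_ball, dist_eq_norm] at hx
  have h1 : Real.exp (2 * (kvel s * m) * (t - a)) ≤ 4 / 3 := by
    refine le_trans (Real.exp_le_exp.2 ?_) hexp
    have := ht.2
    gcongr; linarith
  calc _ ≤ ‖x - z t‖ * (4 / 3) := by gcongr
    _ < r := by linarith

/-- On a time interval that depends only on the size of the initial data and on the radius of the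
ball on which they are constant, the solution stays bounded, and constant near the vortex. -/
lemma exists_uniform_time (hs : 1 / 2 ≤ s) (hs1 : s < 1) {T R : ℝ} (hT : 0 < T) (hR : 0 < R)
    (N : ℝ≥0) : ∃ T₀, 0 < T₀ ∧ T₀ < T ∧ ∀ (k : ℕ) (θ : ℝ → Plane → ℝ) (z : ℝ → Plane) (β : ℝ),
      4 ≤ k → IsStrongSolution s k T θ z → sob (l2Fourier (θ 0)) ≤ N →
      (∀ x ∈ Metric.ball (z 0) R, θ 0 x = β) →
      ∀ t ∈ Icc 0 T₀, sob (l2Fourier (θ t)) ≤ (N + 2 : ℝ≥0) ∧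
        ∀ x ∈ Metric.ball (z t) (R / 2), θ t x = β := by
  have hR2 : 0 < R / 2 := by positivity
  set B : ℝ≥0 := N + 2 with hB
  obtain ⟨T₀, hT₀, hT₀T, hexp, hK⟩ := exists_small_time hT (2 * (kvel s * B))
    (2 * (kcomm * transportSize s (R / 2) B * B ^ 2))
  refine ⟨T₀, hT₀, hT₀T, fun k θ z β hk hS hN hβ => ?_⟩
  have hconst : ∀ τ ≤ T₀, (∀ t ∈ Icc 0 τ, sob (l2Fourier (θ t)) ≤ B) →
      ∀ t ∈ Icc 0 τ, ∀ x ∈ Metric.ball (z t) (3 / 4 * R), θ t x = β := fun τ hτ h =>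
    hS.eq_const_of_sob_le hs hs1 hk le_rfl (hτ.trans_lt hT₀T) h (by simpa using hτ) hexp hβ
  suffices h : ∀ t ∈ Icc 0 T₀, sob (l2Fourier (θ t)) ≤ B from fun t ht =>
    ⟨h t ht, fun x hx => hconst T₀ le_rfl h t ht x (Metric.ball_subset_ball (by linarith) hx)⟩
  obtain ⟨M₀, hM₀⟩ := hS.bounded
  set M : ℝ≥0 := 3 * M₀ with hM
  have hbd : ∀ t ∈ Ico 0 T, sob (l2Fourier (θ t)) ≤ M := fun t ht => by
    rw [hM, ENNReal.coe_mul]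
    refine (sob_l2Fourier_le hk _).trans (mul_le_mul' (by simp) (hM₀ t ht))
  -- The bound M belongs to the individual solution. It fixes only the length of the continuation
  -- steps and does not enter the time T₀.
  obtain ⟨δ, hδ, -, hexpδ, hKδ⟩ := exists_small_time hT (2 * (kvel s * M))
    (2 * (kcomm * transportSize s (R / 2) M * M ^ 2))
  -- Each step starts from the estimates on the whole interval [0, τ], so losses do not accumulate.
  -- During one step the radius goes from 3R/4 to 9R/16 ≥ R/2, and the squared norm from N² + 1 to
  -- N² + 2 ≤ (N + 2)².
  have step : ∀ n : ℕ, ∀ t ∈ Icc 0 (min (n * δ) T₀), sob (l2Fourier (θ t)) ≤ B := by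
    intro n
    induction n with
    | zero =>
      intro t ht
      rw [Nat.cast_zero, zero_mul, min_eq_left hT₀.le, Icc_self, mem_singleton_iff] at ht
      rw [ht]
      refine hN.trans ?_
      rw [hB]; exact_mod_cast le_self_add
    | succ n ih =>
      intro t ht
      set τ := min (n * δ) T₀ with hτ
      have hτ0 : 0 ≤ τ := le_min (by positivity) hT₀.le
      have hτT : τ ≤ T₀ := min_le_right _ _
      rcases le_or_gt t τ with htτ | htτ
      · exact ih t ⟨ht.1, htτ⟩
      have htT : t ≤ T₀ := ht.2.trans (min_le_right _ _)
      have htδ : t - τ ≤ δ := by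
        have h1 : t ≤ n * δ + δ := by
          have := ht.2.trans (min_le_left _ _)
          push_cast at this; linarith
        rcases min_choice (n * δ) T₀ with h | h
        · rw [hτ, h]; linarith
        · rw [hτ, h] at htτ; linarith
      have c1 := hconst τ hτT ih
      have e1 := hS.sob_le hs hs1 hk le_rfl (hτT.trans_lt hT₀T) hR2 (n := N) ih
        (fun t ht x hx => c1 t ht x (Metric.ball_subset_ball (by linarith) hx)) hN
        (right_mem_Icc.2 hτ0)
      have hsub : ∀ r ∈ Icc τ t, sob (l2Fourier (θ r)) ≤ M := fun r hr =>
        hbd r ⟨hτ0.trans hr.1, (hr.2.trans htT).trans_lt hT₀T⟩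
      have c2 := hS.eq_const_of_sob_le hs hs1 hk hτ0 (htT.trans_lt hT₀T)
        hsub htδ hexpδ (c1 τ (right_mem_Icc.2 hτ0))
      have hn : sob (l2Fourier (θ τ)) ≤ (Real.sqrt (N ^ 2 + 1)).toNNReal := by
        have hfin : sob (l2Fourier (θ τ)) ≠ ∞ :=
          ((ih τ (right_mem_Icc.2 hτ0)).trans_lt ENNReal.coe_lt_top).ne
        rw [← ENNReal.ofReal_toReal hfin]
        refine ENNReal.ofReal_le_ofReal (Real.le_sqrt_of_sq_le (e1.trans ?_))
        have : 2 * (kcomm * transportSize s (R / 2) B * B ^ 2) * (τ - 0) ≤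
            2 * (kcomm * transportSize s (R / 2) B * B ^ 2 : ℝ) * T₀ := by
          gcongr; linarith
        linarith
      have e2 := hS.sob_le hs hs1 hk hτ0 (htT.trans_lt hT₀T) hR2 hsub
        (fun t ht x hx => c2 t ht x (Metric.ball_subset_ball (by linarith) hx)) hn
        (right_mem_Icc.2 htτ.le)
      rw [Real.coe_toNNReal _ (Real.sqrt_nonneg _), Real.sq_sqrt (by positivity)] at e2
      have hfin : sob (l2Fourier (θ t)) ≠ ∞ :=
        ((hsub t (right_mem_Icc.2 htτ.le)).trans_lt ENNReal.coe_lt_top).ne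
      have h1 : 2 * (kcomm * transportSize s (R / 2) M * M ^ 2) * (t - τ) ≤
          2 * (kcomm * transportSize s (R / 2) M * M ^ 2 : ℝ) * δ := by gcongr
      have h2 : (sob (l2Fourier (θ t))).toReal ≤ B := by
        refine le_of_pow_le_pow_left₀ two_ne_zero (NNReal.coe_nonneg _) ?_
        have : (B : ℝ) = N + 2 := by simp [hB]
        rw [this]
        have := N.coe_nonneg
        nlinarith
      rw [← ENNReal.ofReal_toReal hfin, ← ENNReal.ofReal_coe_nnreal]
      exact ENNReal.ofReal_le_ofReal h2
  obtain ⟨n, hn⟩ := exists_nat_ge (T₀ / δ)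
  have h1 : T₀ ≤ n * δ := (div_le_iff₀ hδ).1 hn
  have := step n
  rwa [min_eq_right h1] at this

end Uniform

/-! ### Stability -/

/-- Plancherel in the converse direction, for functions whose square integrability is first seen in
physical space, such as transport terms. -/
lemma memLp_of_memLp_fourierInv {G : Plane → ℂ} (hG : Integrable G) (h : MemLp (𝓕⁻ G) 2 volume) :
    MemLp G 2 volume ∧ eLpNorm G 2 volume = eLpNorm (𝓕⁻ G) 2 volume := by
  have h1 : (𝓕 (h.toLp (𝓕⁻ G)) : L2) =ᵐ[volume] G :=
    fourier_toLp_of_fourierInv hG h (.of_forall fun _ => rfl)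
  refine ⟨(memLp_congr_ae h1).1 (Lp.memLp _), ?_⟩
  have h2 : ‖(𝓕 (h.toLp (𝓕⁻ G)) : L2)‖ₑ = ‖(h.toLp (𝓕⁻ G) : L2)‖ₑ := by
    rw [← ofReal_norm, ← ofReal_norm, Lp.norm_fourier_eq]
  rwa [Lp.enorm_def, Lp.enorm_def, eLpNorm_congr_ae h1, eLpNorm_congr_ae h.coeFn_toLp] at h2

lemma norm_integral_conj_mul_le {g h : Plane → ℂ} (hg : MemLp g 2 volume) (hh : MemLp h 2 volume) :
    ‖∫ ξ, (starRingEnd ℂ) (g ξ) * h ξ‖ ≤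
      (eLpNorm g 2 volume).toReal * (eLpNorm h 2 volume).toReal := by
  rw [← toReal_enorm, ← ENNReal.toReal_mul]
  refine ENNReal.toReal_mono (ENNReal.mul_ne_top hg.eLpNorm_ne_top hh.eLpNorm_ne_top)
    ((enorm_integral_le_lintegral_enorm _).trans ?_)
  simp only [enorm_mul, RCLike.enorm_conj]
  exact lintegral_enorm_mul_le hg.1 hh.1

lemma integrable_conj_mul {g h : Plane → ℂ} (hg : MemLp g 2 volume) (hh : MemLp h 2 volume) :
    Integrable fun ξ => (starRingEnd ℂ) (g ξ) * h ξ :=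
  MemLp.integrable_mul (p := 2) (q := 2) hg.star hh

lemma Field.memLp_adv {u û f g} (hu : Field u û) (hf : Rep f g) : MemLp (adv û g) 2 volume := by
  refine (memLp_of_memLp_fourierInv (hu.integrable_adv hf) ?_).1
  rw [show 𝓕⁻ (adv û g) = fun x => ((inner ℝ (u x) (gradient f x) : ℝ) : ℂ) from
    funext (hu.fourierInv_adv hf)]
  exact (hu.memLp_inner_gradient hf).1

lemma Rep.gradient_sub {f₁ f₂ g₁ g₂} (h₁ : Rep f₁ g₁) (h₂ : Rep f₂ g₂) (x : Plane) :
    gradient (fun x => f₁ x - f₂ x) x = gradient f₁ x - gradient f₂ x := by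
  have := (h₁.differentiable x).hasGradientAt.hasFDerivAt.sub
    (h₂.differentiable x).hasGradientAt.hasFDerivAt
  rw [← map_sub] at this
  exact (hasGradientAt_iff_hasFDerivAt.2 this).gradient

/-- The transport of a regular scalar by the velocity of a square integrable one. -/
lemma norm_integral_adv_velHat_le {s : ℝ} (hs : 1 / 2 ≤ s) (hs1 : s < 1) {w f g g₁}
    (hw : Rep w g) (hf : Rep f g₁) {m : ℝ≥0} (hm : sob g₁ ≤ m) :
    ‖∫ ξ, (starRingEnd ℂ) (g ξ) * adv (velHat s g) g₁ ξ‖ ≤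
      2 * (clow s + cbr) * m * (eLpNorm g 2 volume).toReal ^ 2 := by
  have hv := hw.field_velocity hs hs1
  rw [integral_conj_mul_adv hw.memLp hv.integrable hf.memLp_ghat hf.integrable_ghat,
    ← toReal_enorm]
  set n := eLpNorm g 2 volume with hn
  have hn0 : n ≠ ∞ := hw.memLp.eLpNorm_ne_top
  have hlow : AEStronglyMeasurable (fun ξ => lowSymb s ξ * ‖g ξ‖) (volume : Measure Plane) :=
    (memLp_lowSymb hs1).1.mul hw.meas.norm
  have hgm := fun j => (hf.memLp_ghat j).1
  have key : ∫⁻ p, ‖(starRingEnd ℂ) (g p.1) * advK (velHat s g) g₁ p‖ₑ ∂(volume.prod volume) ≤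
      ((2 * (clow s + cbr) * m : ℝ≥0) : ℝ≥0∞) * n ^ 2 := by
    calc _ ≤ ∫⁻ p : Plane × Plane, ∑ j,
          (‖g p.1‖ₑ * ‖lowSymb s (p.1 - p.2) * ‖g (p.1 - p.2)‖‖ₑ * ‖ghat g₁ j p.2‖ₑ +
          ‖g p.1‖ₑ * ‖g (p.1 - p.2)‖ₑ * ‖ghat g₁ j p.2‖ₑ) ∂(volume.prod volume) := by
          refine lintegral_mono fun p => ?_
          rw [enorm_mul, RCLike.enorm_conj, advK]
          refine (mul_le_mul_right (enorm_sum_le _ _) _).trans ?_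
          rw [Finset.mul_sum]
          refine Finset.sum_le_sum fun j _ => ?_
          -- The low frequency part of the velocity is estimated in L¹ and the rest in L². The
          -- gradient of f takes the complementary norm in each case.
          have h1 : ‖velHat s g j (p.1 - p.2)‖ₑ ≤
              ‖lowSymb s (p.1 - p.2) * ‖g (p.1 - p.2)‖‖ₑ + ‖g (p.1 - p.2)‖ₑ := by
            have h2 : 0 ≤ lowSymb s (p.1 - p.2) := indicator_nonneg (fun x _ => symb_nonneg s x) _
            rw [← ofReal_norm, ← ofReal_norm, ← ofReal_norm,
              ← ENNReal.ofReal_add (norm_nonneg _) (norm_nonneg _)]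
            refine ENNReal.ofReal_le_ofReal ((norm_velHat_le s g j _).trans ?_)
            rw [norm_mul, norm_norm, Real.norm_of_nonneg h2]
            nlinarith [mul_le_mul_of_nonneg_right (symb_le hs (p.1 - p.2))
              (norm_nonneg (g (p.1 - p.2)))]
          rw [enorm_mul]
          calc _ ≤ ‖g p.1‖ₑ * (‖ghat g₁ j p.2‖ₑ *
                (‖lowSymb s (p.1 - p.2) * ‖g (p.1 - p.2)‖‖ₑ + ‖g (p.1 - p.2)‖ₑ)) := by gcongr
            _ = _ := by ring
      _ = ∑ j, ((∫⁻ p : Plane × Plane,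
          ‖g p.1‖ₑ * ‖lowSymb s (p.1 - p.2) * ‖g (p.1 - p.2)‖‖ₑ * ‖ghat g₁ j p.2‖ₑ
            ∂(volume.prod volume)) +
          ∫⁻ p : Plane × Plane,
          ‖g p.1‖ₑ * ‖g (p.1 - p.2)‖ₑ * ‖ghat g₁ j p.2‖ₑ ∂(volume.prod volume)) := by
          refine (lintegral_finsetSum' _ fun j _ => (aemeasurable_trilinear hw.meas hlow (hgm j)).add
            (aemeasurable_trilinear hw.meas hw.meas (hgm j))).trans ?_
          exact Finset.sum_congr rfl fun j _ =>
            lintegral_add_left' (aemeasurable_trilinear hw.meas hlow (hgm j)) _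
      _ ≤ ∑ _j : Fin 2, (n * (clow s * n) * m + n * n * (cbr * m)) := by
          refine Finset.sum_le_sum fun j _ => add_le_add ?_ ?_
          · refine (lintegral_trilinear_le hw.meas hlow (hgm j)).trans ?_
            gcongr
            · rw [coe_clow hs1, hn, ← eLpNorm_norm g]
              exact eLpNorm_one_mul_le (memLp_lowSymb hs1).1 hw.meas.norm
            · exact (eLpNorm_ghat_le g₁ j).trans hm
          · refine (lintegral_trilinear_le' hw.meas hw.meas (hgm j)).trans ?_
            gcongr
            refine (eLpNorm_mono (g := fun ξ => br ξ * ‖g₁ ξ‖) fun ξ =>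
              (norm_ghat_le g₁ j ξ).trans (le_abs_self _)).trans ?_
            exact (eLpNorm_one_br_le hf.meas).trans (by gcongr)
      _ = _ := by
          simp only [Finset.sum_const, Finset.card_univ, Fintype.card_fin, nsmul_eq_mul]
          push_cast; ring
  refine (ENNReal.toReal_mono (ENNReal.mul_ne_top ENNReal.coe_ne_top (by finiteness))
    ((enorm_integral_le_lintegral_enorm _).trans key)).trans (le_of_eq ?_)
  rw [ENNReal.toReal_mul, ENNReal.coe_toReal, ENNReal.toReal_pow]
  push_cast; ring

/-- The energy estimate for the difference of two solutions. -/
lemma abs_re_integral_sub_le {s r : ℝ} (hs : 1 / 2 ≤ s) (hs1 : s < 1) (hr : 0 < r)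
    {f₁ f₂ : Plane → ℝ} (h₁ : Rep f₁ (l2Fourier f₁)) (h₂ : Rep f₂ (l2Fourier f₂)) {m : ℝ≥0}
    (hm : sob (l2Fourier f₁) ≤ m) (z₁ z₂ : Plane) :
    |(∫ ξ, (starRingEnd ℂ) (l2Fourier f₂ ξ - l2Fourier f₁ ξ) *
      (-adv (transportHat s r f₂ z₂) (l2Fourier f₂) ξ -
        -adv (transportHat s r f₁ z₁) (l2Fourier f₁) ξ)).re| ≤
      2 * (clow s + cbr) * m *
        (eLpNorm (fun ξ => l2Fourier f₂ ξ - l2Fourier f₁ ξ) 2 volume).toReal ^ 2 +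
      4 * (fsize (regHat s r)).toReal * m *
        ((eLpNorm (fun ξ => l2Fourier f₂ ξ - l2Fourier f₁ ξ) 2 volume).toReal *
          ‖z₂ - z₁‖) := by
  set g : Plane → ℂ := fun ξ => l2Fourier f₂ ξ - l2Fourier f₁ ξ with hg
  have hw : Rep (fun x => f₂ x - f₁ x) g := h₂.sub h₁
  have hu₁ := field_transport hs hs1 hr h₁ z₁
  have hu₂ := field_transport hs hs1 hr h₂ z₂
  have hv := hw.field_velocity hs hs1
  have hR := field_regKernel hs1 hr
  set G : Plane → ℂ := fun ξ => -adv (transportHat s r f₂ z₂) (l2Fourier f₂) ξ -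
        -adv (transportHat s r f₁ z₁) (l2Fourier f₁) ξ with hG
  set P := adv (transportHat s r f₂ z₂) g with hP
  set Q := adv (velHat s g) (l2Fourier f₁) with hQ
  have iP : Integrable P := hu₂.integrable_adv hw
  have iQ : Integrable Q := hv.integrable_adv h₁
  have iG : Integrable G := (hu₂.integrable_adv h₂).neg.sub (hu₁.integrable_adv h₁).neg
  -- P is the transport of the difference by the second field and Q that of f₁ by the velocity of
  -- the difference. After they are added back, only the difference of the two translated kernels
  -- acting on f₁ remains.
  set S : Plane → ℂ := fun ξ => G ξ + P ξ + Q ξ with hS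
  have iS : Integrable S := (iG.add iP).add iQ
  have hSx : ∀ x, (𝓕⁻ S) x = ((inner ℝ (regKernel s r (x - z₁) - regKernel s r (x - z₂))
      (gradient f₁ x) : ℝ) : ℂ) := by
    intro x
    have e : (𝓕⁻ S) x = -(𝓕⁻ (adv (transportHat s r f₂ z₂) (l2Fourier f₂))) x +
        (𝓕⁻ (adv (transportHat s r f₁ z₁) (l2Fourier f₁))) x + (𝓕⁻ P) x + (𝓕⁻ Q) x := by
      simp only [fourierInv_eq_integral]
      rw [← integral_neg, ← integral_add, ← integral_add, ← integral_add]
      · exact integral_congr_ae (.of_forall fun ξ => by simp only [hS, hG]; ring)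
      all_goals
        have i1 := integrable_fourier_exp_mul (hu₂.integrable_adv h₂) x
        have i2 := integrable_fourier_exp_mul (hu₁.integrable_adv h₁) x
        have i3 := integrable_fourier_exp_mul iP x
        have i4 := integrable_fourier_exp_mul iQ x
      · exact (i1.neg.add i2).add i3
      · exact i4
      · exact i1.neg.add i2
      · exact i3
      · exact i1.neg
      · exact i2
    rw [e, hu₂.fourierInv_adv h₂, hu₁.fourierInv_adv h₁, hP, hQ, hu₂.fourierInv_adv hw,
      hv.fourierInv_adv h₁, h₂.gradient_sub h₁, velocity_sub hs hs1 h₂ h₁]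
    simp only [transportField, inner_add_left, inner_sub_left, inner_sub_right]
    push_cast; ring
  have hk : ∀ x, ‖regKernel s r (x - z₁) - regKernel s r (x - z₂)‖ ≤
      2 * (fsize (regHat s r)).toReal * ‖z₂ - z₁‖ := fun x => by
    have := hR.norm_sub_le (x - z₁) (x - z₂)
    rwa [sub_sub_sub_cancel_left] at this
  have hSn : eLpNorm (𝓕⁻ S) 2 volume ≤
      ENNReal.ofReal (2 * (fsize (regHat s r)).toReal * ‖z₂ - z₁‖) * (2 * m) := by
    rw [show eLpNorm (𝓕⁻ S) 2 volume = eLpNorm (fun x => inner ℝ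
      (regKernel s r (x - z₁) - regKernel s r (x - z₂)) (gradient f₁ x)) 2 volume from
      eLpNorm_congr_norm_ae (.of_forall fun x => by rw [hSx, Complex.norm_real])]
    exact (h₁.eLpNorm_inner_gradient_le hk).trans (by gcongr)
  have hfin : ENNReal.ofReal (2 * (fsize (regHat s r)).toReal * ‖z₂ - z₁‖) * (2 * m) ≠ ∞ := by
    finiteness
  obtain ⟨mS, eS⟩ := memLp_of_memLp_fourierInv iS
    ⟨(continuous_fourierInv iS).aestronglyMeasurable, hSn.trans_lt hfin.lt_top⟩
  have mP : MemLp P 2 volume := hu₂.memLp_adv hw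
  have mQ : MemLp Q 2 volume := hv.memLp_adv h₁
  have hsplit : ∫ ξ, (starRingEnd ℂ) (g ξ) * G ξ = (∫ ξ, (starRingEnd ℂ) (g ξ) * S ξ) -
      (∫ ξ, (starRingEnd ℂ) (g ξ) * P ξ) - ∫ ξ, (starRingEnd ℂ) (g ξ) * Q ξ := by
    rw [← integral_sub (integrable_conj_mul hw.memLp mS) (integrable_conj_mul hw.memLp mP)]
    refine Eq.trans ?_ (integral_sub ((integrable_conj_mul hw.memLp mS).sub
      (integrable_conj_mul hw.memLp mP)) (integrable_conj_mul hw.memLp mQ))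
    exact integral_congr_ae (.of_forall fun ξ => by simp only [hS]; ring)
  have hP0 : (∫ ξ, (starRingEnd ℂ) (g ξ) * P ξ).re = 0 := hu₂.re_integral_adv_eq_zero hw
  have hQ0 := norm_integral_adv_velHat_le hs hs1 hw h₁ hm
  have hS0 := norm_integral_conj_mul_le hw.memLp mS
  have hSr : (eLpNorm S 2 volume).toReal ≤ 4 * (fsize (regHat s r)).toReal * m * ‖z₂ - z₁‖ := by
    rw [eS]
    refine (ENNReal.toReal_mono hfin hSn).trans (le_of_eq ?_)
    rw [ENNReal.toReal_mul, ENNReal.toReal_ofReal (by positivity)]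
    simp; ring
  rw [hsplit, Complex.sub_re, Complex.sub_re, hP0, sub_zero]
  refine (abs_sub _ _).trans ?_
  have a1 := (Complex.abs_re_le_norm _).trans hS0
  have a2 := (Complex.abs_re_le_norm _).trans hQ0
  have a3 := mul_le_mul_of_nonneg_left hSr (ENNReal.toReal_nonneg (a := eLpNorm g 2 volume))
  calc _ ≤ _ := add_le_add a1 a2
    _ ≤ _ := by linarith

/-- Gronwall's inequality: E(t) exp(-Kt) does not increase. -/
lemma le_exp_mul_of_deriv_le {E E' : ℝ → ℝ} {b K : ℝ} (hc : ContinuousOn E (Icc 0 b))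
    (hd : ∀ t ∈ Ioo 0 b, HasDerivAt E (E' t) t) (hE : ∀ t ∈ Ioo 0 b, E' t ≤ K * E t) {t : ℝ}
    (ht : t ∈ Icc 0 b) : E t ≤ Real.exp (K * t) * E 0 := by
  have hd' : ∀ t ∈ Ioo 0 b, HasDerivAt (fun t => E t * Real.exp (-(K * t)))
      (E' t * Real.exp (-(K * t)) + E t * (Real.exp (-(K * t)) * (-(K * 1)))) t := fun t ht =>
    (hd t ht).mul (((hasDerivAt_id t).const_mul K).neg.exp)
  have h := antitoneOn_of_deriv_nonpos (convex_Icc 0 b)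
    (f := fun t => E t * Real.exp (-(K * t))) (hc.mul (Continuous.continuousOn (by fun_prop)))
    (fun t ht => by
      rw [interior_Icc] at ht; exact (hd' t ht).differentiableAt.differentiableWithinAt)
    (fun t ht => by
      rw [interior_Icc] at ht
      rw [(hd' t ht).deriv]
      nlinarith [mul_le_mul_of_nonneg_right (hE t ht) (Real.exp_nonneg (-(K * t)))])
    (left_mem_Icc.2 (ht.1.trans ht.2)) ht ht.1
  simp only [mul_zero, neg_zero, Real.exp_zero, mul_one] at h
  rw [Real.exp_neg, ← div_eq_mul_inv, div_le_iff₀ (Real.exp_pos _)] at h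
  linarith

lemma IsStrongSolution.norm_vortex_sub_le {s : ℝ} {k : ℕ} {T : ℝ} {θ : ℝ → Plane → ℝ}
    {z : ℝ → Plane} (hS : IsStrongSolution s k T θ z) (hs : 1 / 2 ≤ s) (hs1 : s < 1) (hk : 4 ≤ k)
    {b : ℝ} (hb : b < T) {m : ℝ≥0} (hm : ∀ t ∈ Icc 0 b, sob (l2Fourier (θ t)) ≤ m) {t : ℝ}
    (ht : t ∈ Icc 0 b) : ‖z t - z 0‖ ≤ 2 * (kvel s * m) * t := by
  have hsub : Icc 0 b ⊆ Ico 0 T := fun τ hτ => ⟨hτ.1, hτ.2.trans_lt hb⟩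
  have := (convex_Icc 0 b).norm_image_sub_le_of_norm_hasDerivWithin_le
    (fun τ hτ => (hS.vortex τ (hsub hτ)).mono hsub)
    (fun τ hτ => norm_velocity_le hs hs1 (hS.rep hk (hsub hτ)) (hm τ hτ) (z τ))
    (left_mem_Icc.2 (ht.1.trans ht.2)) ht
  rwa [sub_zero, Real.norm_of_nonneg ht.1] at this

/-- Stability of two solutions with uniform bounds. -/
lemma exists_stability {s r : ℝ} (hs : 1 / 2 ≤ s) (hs1 : s < 1) (hr : 0 < r) (m : ℝ≥0) :
    ∃ K : ℝ, 0 ≤ K ∧ ∀ (k : ℕ) (T b : ℝ) (θ₁ θ₂ : ℝ → Plane → ℝ) (z₁ z₂ : ℝ → Plane) (β₁ β₂ : ℝ),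
      4 ≤ k → b < T → IsStrongSolution s k T θ₁ z₁ → IsStrongSolution s k T θ₂ z₂ →
      (∀ t ∈ Icc 0 b, sob (l2Fourier (θ₁ t)) ≤ m) → (∀ t ∈ Icc 0 b, sob (l2Fourier (θ₂ t)) ≤ m) →
      (∀ t ∈ Icc 0 b, ∀ x ∈ Metric.ball (z₁ t) r, θ₁ t x = β₁) →
      (∀ t ∈ Icc 0 b, ∀ x ∈ Metric.ball (z₂ t) r, θ₂ t x = β₂) →
      (∀ t ∈ Icc 0 b, ‖z₂ t - z₁ t‖ ≤ r / 2) →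
      ∀ t ∈ Icc 0 b,
        (eLpNorm (fun x => θ₂ t x - θ₁ t x) 2 volume).toReal ^ 2 + ‖z₂ t - z₁ t‖ ^ 2 ≤
          Real.exp (K * t) *
            ((eLpNorm (fun x => θ₂ 0 x - θ₁ 0 x) 2 volume).toReal ^ 2 + ‖z₂ 0 - z₁ 0‖ ^ 2) := by
  -- While |z₂ - z₁| ≤ r/2, the ball of radius r/2 around z₁ lies in both balls of constancy, and θ₂
  -- - θ₁ is constant on it.
  obtain ⟨C, hC⟩ := exists_norm_velocity_le hs hs1 (half_pos hr)
  set K₁ : ℝ := 2 * (clow s + cbr) * m with hK₁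
  set K₂ : ℝ := 4 * (fsize (regHat s r)).toReal * m with hK₂
  set L : ℝ := 2 * (kvel s * m) with hL
  have hK₁0 : 0 ≤ K₁ := by positivity
  have hK₂0 : 0 ≤ K₂ := by positivity
  have hL0 : 0 ≤ L := by positivity
  refine ⟨2 * K₁ + 2 * K₂ + 2 * L + 2 * C, by positivity,
    fun k T b θ₁ θ₂ z₁ z₂ β₁ β₂ hk hb hS₁ hS₂ hm₁ hm₂ hβ₁ hβ₂ hz t ht => ?_⟩
  rcases eq_or_lt_of_le ht.1 with rfl | ht0
  · simp
  have hb0 : 0 < b := ht0.trans_le ht.2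
  have hsub : Icc 0 b ⊆ Ico 0 T := fun τ hτ => ⟨hτ.1, hτ.2.trans_lt hb⟩
  have ev₁ := hS₁.evol hs hs1 hk le_rfl hb hr hm₁ hβ₁
  have ev₂ := hS₂.evol hs hs1 hk le_rfl hb hr hm₂ hβ₂
  have ev := ev₂.sub ev₁ (NNReal.coe_nonneg _) (NNReal.coe_nonneg _)
  obtain ⟨hc, hd⟩ := ev.energy hb0 (by positivity) weight_one
  simp only [Complex.ofReal_one, one_mul] at hc hd
  set n : ℝ → ℝ := fun t =>
    (eLpNorm (fun ξ => l2Fourier (θ₂ t) ξ - l2Fourier (θ₁ t) ξ) 2 volume).toReal with hn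
  have hn0 : ∀ t, 0 ≤ n t := fun t => ENNReal.toReal_nonneg
  have hnw : ∀ t ∈ Icc 0 b, (eLpNorm (fun x => θ₂ t x - θ₁ t x) 2 volume).toReal = n t :=
    fun t ht => by rw [(ev.rep t ht).eLpNorm_eq]
  have hzd : ∀ t ∈ Icc 0 b, HasDerivWithinAt (fun t => z₂ t - z₁ t)
      (velocity s (θ₂ t) (z₂ t) - velocity s (θ₁ t) (z₁ t)) (Icc 0 b) t := fun t ht =>
    ((hS₂.vortex t (hsub ht)).mono hsub).sub ((hS₁.vortex t (hsub ht)).mono hsub)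
  have hzc : ContinuousOn (fun t => z₂ t - z₁ t) (Icc 0 b) := fun t ht =>
    (hzd t ht).continuousWithinAt
  have hzb : ∀ t ∈ Icc 0 b, ‖velocity s (θ₂ t) (z₂ t) - velocity s (θ₁ t) (z₁ t)‖ ≤
      L * ‖z₂ t - z₁ t‖ + C * n t := by
    intro t ht
    have h1 := norm_velocity_sub_le hs hs1 (ev₂.rep t ht) (hm₂ t ht) (z₂ t) (z₁ t)
    have h2 := hC _ _ (ev.rep t ht) (z₁ t) (β₂ - β₁) fun x hx => by
      have h3 : x ∈ Metric.ball (z₂ t) r := by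
        have := hz t ht
        rw [Metric.mem_ball] at hx ⊢
        calc dist x (z₂ t) ≤ dist x (z₁ t) + dist (z₁ t) (z₂ t) := dist_triangle _ _ _
          _ < r / 2 + r / 2 := by
              rw [dist_comm (z₁ t), dist_eq_norm (z₂ t)]; linarith
          _ = r := by ring
      rw [hβ₂ t ht x h3, hβ₁ t ht x (Metric.ball_subset_ball (by linarith) hx)]
    rw [hnw t ht, velocity_sub hs hs1 (ev₂.rep t ht) (ev₁.rep t ht)] at h2
    -- The first difference is Lipschitz in the vortex position; the second is the velocity of θ₂ -
    -- θ₁ at z₁.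
    have h3 : velocity s (θ₂ t) (z₂ t) - velocity s (θ₁ t) (z₁ t) =
        (velocity s (θ₂ t) (z₂ t) - velocity s (θ₂ t) (z₁ t)) +
        (velocity s (θ₂ t) (z₁ t) - velocity s (θ₁ t) (z₁ t)) := by abel
    rw [h3]
    exact (norm_add_le _ _).trans (add_le_add h1 h2)
  have hE := le_exp_mul_of_deriv_le (E := fun t => n t ^ 2 + ‖z₂ t - z₁ t‖ ^ 2)
    (K := 2 * K₁ + 2 * K₂ + 2 * L + 2 * C) (hc.add (hzc.norm.pow 2))
    (fun t ht => (hd t ht).add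
      ((hzd t (Ioo_subset_Icc_self ht)).hasDerivAt (Icc_mem_nhds ht.1 ht.2)).norm_sq)
    (fun t ht => by
      have ht' := Ioo_subset_Icc_self ht
      have h1 := (abs_le.1 (abs_re_integral_sub_le hs hs1 hr (ev₁.rep t ht') (ev₂.rep t ht')
        (hm₁ t ht') (z₁ t) (z₂ t))).2
      have h2 : inner ℝ (z₂ t - z₁ t) (velocity s (θ₂ t) (z₂ t) - velocity s (θ₁ t) (z₁ t)) ≤
          ‖z₂ t - z₁ t‖ * (L * ‖z₂ t - z₁ t‖ + C * n t) :=
        (real_inner_le_norm _ _).trans (mul_le_mul_of_nonneg_left (hzb t ht') (norm_nonneg _))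
      have hC0 : (0 : ℝ) ≤ C := C.coe_nonneg
      set d := ‖z₂ t - z₁ t‖ with hdd
      have hd0 : 0 ≤ d := norm_nonneg _
      have hnt := hn0 t
      have h3 : n t * d ≤ n t ^ 2 + d ^ 2 := by nlinarith [sq_nonneg (n t - d), sq_nonneg (n t + d)]
      have h4 : K₂ * (n t * d) ≤ K₂ * (n t ^ 2 + d ^ 2) := mul_le_mul_of_nonneg_left h3 hK₂0
      have h5 : C * (n t * d) ≤ C * (n t ^ 2 + d ^ 2) := mul_le_mul_of_nonneg_left h3 hC0
      have h6 : 0 ≤ K₁ * d ^ 2 := by positivity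
      have h7 : 0 ≤ L * n t ^ 2 := by positivity
      change _ ≤ K₁ * n t ^ 2 + K₂ * (n t * d) at h1
      linarith) ht
  rw [hnw t ht, hnw 0 (left_mem_Icc.2 hb0.le)]
  exact hE

end VortexWave

/-! ### Choice of the constants and conclusion. -/

theorem mainTheorem5 (s : ℝ) (hs : 1 / 2 ≤ s) (hs1 : s < 1) (k : ℕ) (hk : 4 ≤ k)
    (T : ℝ) (hT : 0 < T) (N₁ N₂ : ℝ≥0) (R₁ R₂ : ℝ) (hR₁ : 0 < R₁) (hR₂ : 0 < R₂) :
    ∃ ρ : ℝ, 0 < ρ ∧ ∃ T₀ : ℝ, 0 < T₀ ∧ T₀ < T ∧ ∃ C : ℝ≥0,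
      ∀ (θ₁ θ₂ : ℝ → VortexWave.Plane → ℝ) (z₁ z₂ : ℝ → VortexWave.Plane) (β₁ β₂ : ℝ),
        VortexWave.IsStrongSolution s k T θ₁ z₁ →
        VortexWave.IsStrongSolution s k T θ₂ z₂ →
        VortexWave.normH k (θ₁ 0) ≤ N₁ →
        VortexWave.normH k (θ₂ 0) ≤ N₂ →
        (∀ x ∈ Metric.ball (z₁ 0) R₁, θ₁ 0 x = β₁) →
        (∀ x ∈ Metric.ball (z₂ 0) R₂, θ₂ 0 x = β₂) →
        ‖z₂ 0 - z₁ 0‖ < ρ →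
        ∀ t ∈ Icc 0 T₀,
          eLpNorm (fun x => θ₂ t x - θ₁ t x) 2 volume + ‖z₂ t - z₁ t‖ₑ ≤
            C * (eLpNorm (fun x => θ₂ 0 x - θ₁ 0 x) 2 volume + ‖z₂ 0 - z₁ 0‖ₑ) := by
  open VortexWave in
  set N : ℝ≥0 := 3 * max N₁ N₂ with hN
  set R : ℝ := min R₁ R₂ with hR
  have hR0 : 0 < R := lt_min hR₁ hR₂
  set r : ℝ := R / 2 with hr
  have hr0 : 0 < r := by positivity
  obtain ⟨T₁, hT₁, hT₁T, huni⟩ := exists_uniform_time hs hs1 hT hR0 N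
  set V : ℝ := 2 * (kvel s * ((N + 2 : ℝ≥0) : ℝ)) with hV
  have hV0 : 0 ≤ V := by positivity
  obtain ⟨K, hK0, hstab⟩ := exists_stability hs hs1 hr0 (N + 2)
  -- Each vortex moves at speed at most V, hence by at most r/8 up to T₀. With ρ = r/4 the vortices
  -- stay within r/2 of each other.
  set T₀ : ℝ := min T₁ (r / (8 * (V + 1))) with hT₀
  have hT₀0 : 0 < T₀ := lt_min hT₁ (by positivity)
  have hT₀T : T₀ < T := (min_le_left _ _).trans_lt hT₁T
  have hVT : V * T₀ ≤ r / 8 := by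
    have h1 : T₀ * (8 * (V + 1)) ≤ r := (le_div_iff₀ (by positivity)).1 (min_le_right _ _)
    nlinarith
  -- The stability estimate is for squares. The factor 2 comes from (a + d)² ≤ 2(a² + d²).
  set C : ℝ := Real.sqrt (2 * Real.exp (K * T₀))
  refine ⟨r / 4, by positivity, T₀, hT₀0, hT₀T, C.toNNReal,
    fun θ₁ θ₂ z₁ z₂ β₁ β₂ hS₁ hS₂ hN₁ hN₂ hβ₁ hβ₂ hz => ?_⟩
  have hsob : ∀ {f : Plane → ℝ} {M : ℝ≥0}, normH k f ≤ M → M ≤ max N₁ N₂ →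
      sob (l2Fourier f) ≤ N := fun {f M} h1 h2 => by
    rw [hN, ENNReal.coe_mul]
    exact (sob_l2Fourier_le hk f).trans
      (mul_le_mul' (by simp) (h1.trans (by exact_mod_cast h2)))
  have hI : ∀ t ∈ Icc 0 T₀, t ∈ Icc 0 T₁ := fun t ht => ⟨ht.1, ht.2.trans (min_le_left _ _)⟩
  have u₁ := fun t ht => huni k θ₁ z₁ β₁ hk hS₁ (hsob hN₁ (le_max_left _ _))
    (fun x hx => hβ₁ x (Metric.ball_subset_ball (min_le_left _ _) hx)) t (hI t ht)
  have u₂ := fun t ht => huni k θ₂ z₂ β₂ hk hS₂ (hsob hN₂ (le_max_right _ _))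
    (fun x hx => hβ₂ x (Metric.ball_subset_ball (min_le_right _ _) hx)) t (hI t ht)
  have hdist : ∀ t ∈ Icc 0 T₀, ‖z₂ t - z₁ t‖ ≤ r / 2 := by
    intro t ht
    have h1 := hS₁.norm_vortex_sub_le hs hs1 hk hT₀T (fun t ht => (u₁ t ht).1) ht
    have h2 := hS₂.norm_vortex_sub_le hs hs1 hk hT₀T (fun t ht => (u₂ t ht).1) ht
    have h3 : V * t ≤ r / 8 := (mul_le_mul_of_nonneg_left ht.2 hV0).trans hVT
    have h4 : z₂ t - z₁ t = (z₂ t - z₂ 0) + (z₂ 0 - z₁ 0) - (z₁ t - z₁ 0) := by abel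
    rw [h4]
    have h5 := norm_sub_le ((z₂ t - z₂ 0) + (z₂ 0 - z₁ 0)) (z₁ t - z₁ 0)
    have h6 := norm_add_le (z₂ t - z₂ 0) (z₂ 0 - z₁ 0)
    linarith
  intro t ht
  have h := hstab k T T₀ θ₁ θ₂ z₁ z₂ β₁ β₂ hk hT₀T hS₁ hS₂ (fun t ht => (u₁ t ht).1)
    (fun t ht => (u₂ t ht).1) (fun t ht => (u₁ t ht).2) (fun t ht => (u₂ t ht).2) hdist t ht
  have hfin : ∀ t ∈ Icc 0 T₀, eLpNorm (fun x => θ₂ t x - θ₁ t x) 2 volume ≠ ∞ := fun t ht => by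
    have hw := (hS₂.rep hk ⟨ht.1, ht.2.trans_lt hT₀T⟩).sub (hS₁.rep hk ⟨ht.1, ht.2.trans_lt hT₀T⟩)
    rw [hw.eLpNorm_eq]
    exact hw.memLp.eLpNorm_ne_top
  rw [← ENNReal.ofReal_toReal (hfin t ht),
    ← ENNReal.ofReal_toReal (hfin 0 (left_mem_Icc.2 hT₀0.le)), ← ofReal_norm, ← ofReal_norm,
    ← ENNReal.ofReal_add ENNReal.toReal_nonneg (norm_nonneg _),
    ← ENNReal.ofReal_add ENNReal.toReal_nonneg (norm_nonneg _), ENNReal.ofNNReal_toNNReal,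
    ← ENNReal.ofReal_mul (Real.sqrt_nonneg _)]
  refine ENNReal.ofReal_le_ofReal ?_
  set a := (eLpNorm (fun x => θ₂ t x - θ₁ t x) 2 volume).toReal
  set a₀ := (eLpNorm (fun x => θ₂ 0 x - θ₁ 0 x) 2 volume).toReal
  have ha₀ : 0 ≤ a₀ := ENNReal.toReal_nonneg
  set d := ‖z₂ t - z₁ t‖
  set d₀ := ‖z₂ 0 - z₁ 0‖
  have hd₀ : 0 ≤ d₀ := norm_nonneg _
  refine abs_le_of_sq_le_sq' ?_ (by positivity) |>.2
  rw [mul_pow, Real.sq_sqrt (by positivity)]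
  have h1 : Real.exp (K * t) ≤ Real.exp (K * T₀) :=
    Real.exp_le_exp.2 (mul_le_mul_of_nonneg_left ht.2 hK0)
  calc (a + d) ^ 2 ≤ 2 * (a ^ 2 + d ^ 2) := by nlinarith [sq_nonneg (a - d)]
    _ ≤ 2 * (Real.exp (K * T₀) * (a₀ + d₀) ^ 2) := by
        gcongr
        refine h.trans ?_
        gcongr
        nlinarith [mul_nonneg ha₀ hd₀]
    _ = _ := by ring
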